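/- Notation. For a real square matrix $M$ write $M'$ for its transpose, and $M^\vee=(M')^{-1}$ if $M$ is invertible. Let $P_n$ be the space of positive definite symmetric real $n\times n$ matrices of determinant $1$, with the Riemannian metric $ds^2=\operatorname{Tr}\big((A^{-1}dA)^2\big)$. A matrix $F\in \mathbf{GL}_n(\mathbf R)$ represents a real algebraic type if $\det F=\pm1$ and $FF^\vee$ has finite order; put $V_F=\{A\in P_n : AF^\vee A=F\}$, with the metric induced from $P_n$. Let $\mathcal E$ be the set of pairs $(k,l)$ of coprime positive integers with $l<\max(3,k)/2$, and let $\Psi_{1,1}=x-1$, $\Psi_{2,1}=x+1$, $\Psi_{k,l}=x^2-2\cos(2l\pi/k)x+1$ for $k\ge3$. Theorem. Let $F$ represent a real algebraic type, let $R=FF^\vee$, let $m_{k,l}=m_{k,l}(F)$ be the multiplicity of $\Psi_{k,l}$ as a factor of the characteristic polynomial of $R$, and let $W_{k,l}=\ker\Psi_{k,l}(R^\vee)\subset\mathbf R^n$. Then there is a family $(F_{k,l})_{(k,l)\in\mathcal E}$ of representatives of the canonical components of $F$: $F_{k,l}$ is the matrix, in a suitable basis of $W_{k,l}$, of the restriction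 to $W_{k,l}$ of the form $(x,y)\mapsto x'Fy$, and $|\det F_{k,l}|=1$. For every such family: (0) each $F_{k,l}$ represents a real algebraic type, and the characteristic polynomial of $F_{k,l}F_{k,l}^\vee$ is $\Psi_{k,l}^{m_{k,l}}$; (1) $V_F$ splits along the decomposition: there is an $n\times n$ matrix $P$ such that $F=P\big(\bigoplus F_{k,l}\big)P'$ and $(A_{k,l})\mapsto P\big(\bigoplus A_{k,l}\big)P'$ is a Riemannian isometry from the Riemannian product $\prod V_{F_{k,l}}$ onto $V_F$, where sums and products are over the finitely many $(k,l)\in\mathcal E$ with $m_{k,l}>0$; (2) there are $p,q\in\mathbf N$ with $p+q=m_{1,1}$ such that $V_{F_{1,1}}$ is isometric to $\mathbf{SO}_0(p,q)/\mathbf{SO}(p)\times\mathbf{SO}(q)$; (3) there is $g\in\mathbf N$ with $2g=m_{2,1}$ such that $V_{F_{2,1}}$ is isometric to $\mathbf{Sp}_{2g}(\mathbf R)/\mathbf U(g)$; (4) for every $(k,l)\in\mathcal E$ with $k\ge3$ there are $p_{k,l},q_{k,l}\in\mathbf N$ with $p_{k,l}+q_{k,l}=m_{k,l}$ such that $V_{F_{k,l}}$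 is isometric to $\mathbf{SU}(p_{k,l},q_{k,l})/\mathbf S(\mathbf U(p_{k,l})\times\mathbf U(q_{k,l}))$. Here $\mathbf{SO}_0(p,q)$ is the identity component of $\mathbf{SO}(p,q)$, and each quotient $\mathbf G/\mathbf K$ carries the $\mathbf G$-invariant Riemannian metric given on $\mathfrak p=\{X\in\operatorname{Lie}\mathbf G : X=X^*\}$, the tangent space at the base point, by $X\mapsto 4\operatorname{Tr}X^2$ in (2) and (3) and by $X\mapsto 8\operatorname{Tr}X^2$ in (4) (for $X$ in the standard representation on $\mathbf R^{p+q}$, $\mathbf R^{2g}$, $\mathbf C^{p_{k,l}+q_{k,l}}$). -/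

import Mathlib

open scoped Matrix ContDiff Polynomial
open Diffeology

namespace Isodual

noncomputable section

/-! ### Smooth structures and Riemannian metrics

A smooth structure is recorded by its plots (the smooth maps from the spaces `ℝⁿ`), through
Mathlib's `DiffeologicalSpace`; for a manifold, an embedded submanifold or a quotient `G / K` of a
Lie group this is the usual smooth structure, and `DSmooth` maps are the usual `C^∞` maps. A
Riemannian metric is recorded by the squared norms of the velocity vectors of smooth curves. -/

/-- `HasSpeedSq γ t v`: the velocity vector of the smooth curve `γ` at time `t` has squared
Riemannian norm `v`. -/
class HasSpeed (X : Type*) where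
  HasSpeedSq : (ℝ → X) → ℝ → ℝ → Prop

/-- A Riemannian isometry: a smooth bijection with smooth inverse whose differential preserves the
norms of tangent vectors. -/
def IsRiemannianIsometry {X Y : Type*} [DiffeologicalSpace X] [HasSpeed X]
    [DiffeologicalSpace Y] [HasSpeed Y] (e : X ≃ Y) : Prop :=
  DSmooth e ∧ DSmooth e.symm ∧
    ∀ γ : ℝ → X, DSmooth γ → ∀ t v : ℝ,
      HasSpeed.HasSpeedSq γ t v ↔ HasSpeed.HasSpeedSq (fun s => e (γ s)) t v

/-- The smooth structure induced on `X` by a map `f` to a space of matrices: a map to `X` is smooth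
if and only if all the entries of its composition with `f` are smooth functions. It is used for
inclusions `f` only. -/
@[reducible]
def diffeologyOfMatrix {X ι κ 𝕜 : Type*} [RCLike 𝕜] (f : X → Matrix ι κ 𝕜) :
    DiffeologicalSpace X :=
  DiffeologicalSpace.ofCorePlotsOn {
    isPlotOn := fun {_ u} _ p => ∀ i j, ContDiffOn ℝ ∞ (fun x => f (p x) i j) u
    isPlotOn_congr := fun {n u} hu p q h => by
      refine forall_congr' fun i => forall_congr' fun j => contDiffOn_congr fun x hx => ?_
      simp only [h hx]
    isPlot := fun p => ∀ i j, ContDiff ℝ ∞ (fun x => f (p x) i j)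
    isPlotOn_univ := by simp [contDiffOn_univ]
    isPlot_const := fun _ _ _ => contDiff_const
    isPlotOn_reparam := fun _ _ _ h hp hf i j => (hp i j).comp hf h.subset_preimage
    locality := fun _ _ h i j => fun x hxu => by
      obtain ⟨v, hv, hxv, hv'⟩ := h x hxu
      exact ((hv' i j x hxv).contDiffAt (hv.mem_nhds hxv)).contDiffWithinAt }

/-- The entrywise derivative of a curve of matrices. -/
def matrixDeriv {ι κ 𝕜 : Type*} [RCLike 𝕜] (γ : ℝ → Matrix ι κ 𝕜) (t : ℝ) : Matrix ι κ 𝕜 :=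
  Matrix.of fun i j => deriv (fun s => γ s i j) t

/-! #### Riemannian products -/

instance piDiffeology {ι : Type*} (X : ι → Type*) [∀ i, DiffeologicalSpace (X i)] :
    DiffeologicalSpace (∀ i, X i) where
  plots _ := {p | ∀ i, IsPlot fun u => p u i}
  constant_plots x := fun i => DiffeologicalSpace.constant_plots (x i)
  plot_reparam hp hf := fun i => DiffeologicalSpace.plot_reparam (hp i) hf
  locality {n p} hp := fun i => DiffeologicalSpace.locality fun x => by
    obtain ⟨u, hu, hxu, h⟩ := hp x
    exact ⟨u, hu, hxu, fun hfu hf => h hfu hf i⟩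

instance piHasSpeed {ι : Type*} [Fintype ι] (X : ι → Type*) [∀ i, HasSpeed (X i)] :
    HasSpeed (∀ i, X i) where
  HasSpeedSq γ t v :=
    ∃ w : ι → ℝ, (∀ i, HasSpeed.HasSpeedSq (fun s => γ s i) t (w i)) ∧ v = ∑ i, w i

/-! ### The loci `V_F` -/

section Locus

variable {ι : Type*} [Fintype ι] [DecidableEq ι]

/-- The matrix `F^∨`, inverse of the transpose of `F`. -/
def dual (F : Matrix ι ι ℝ) : Matrix ι ι ℝ := (Fᵀ)⁻¹

/-- `F` represents a real algebraic type: `det F = ±1` and `F F^∨` has finite order. -/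
def IsRealType (F : Matrix ι ι ℝ) : Prop :=
  |F.det| = 1 ∧ IsOfFinOrder (F * dual F)

/-- The space `P_n` of positive definite symmetric matrices of determinant `1`. -/
def gramSpace (ι : Type*) [Fintype ι] [DecidableEq ι] : Set (Matrix ι ι ℝ) :=
  {A | A.PosDef ∧ A.det = 1}

/-- The locus `V_F`. -/
def locus (F : Matrix ι ι ℝ) : Set (Matrix ι ι ℝ) :=
  {A | A ∈ gramSpace ι ∧ A * dual F * A = F}

instance locusDiffeology (F : Matrix ι ι ℝ) : DiffeologicalSpace (locus F) :=
  diffeologyOfMatrix fun A => (A : Matrix ι ι ℝ)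

/-- The metric induced by the metric `ds² = Tr (A⁻¹ dA)²` of `P_n`. -/
instance locusHasSpeed (F : Matrix ι ι ℝ) : HasSpeed (locus F) where
  HasSpeedSq γ t v :=
    v = (((γ t : Matrix ι ι ℝ)⁻¹ * matrixDeriv (fun s => (γ s : Matrix ι ι ℝ)) t) ^ 2).trace

end Locus

/-! ### Canonical components of a real type -/

/-- The set of pairs `(k, l)` of coprime positive integers with `l < max (3, k) / 2`. -/
def pairs : Set (ℕ × ℕ) :=
  {kl | 0 < kl.1 ∧ 0 < kl.2 ∧ Nat.Coprime kl.1 kl.2 ∧ 2 * kl.2 < max 3 kl.1}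

/-- The polynomials `Ψ_{k,l}`. -/
def Psi (kl : ℕ × ℕ) : ℝ[X] :=
  if kl.1 = 1 then Polynomial.X - 1
  else if kl.1 = 2 then Polynomial.X + 1
  else Polynomial.X ^ 2
    - Polynomial.C (2 * Real.cos (2 * kl.2 * Real.pi / kl.1)) * Polynomial.X + 1

/-- The pair `(1, 1)`. -/
def pairSym : pairs := ⟨(1, 1), by norm_num [pairs]⟩

/-- The pair `(2, 1)`. -/
def pairAlt : pairs := ⟨(2, 1), by norm_num [pairs]⟩

section Components

variable {ι : Type*} [Fintype ι] [DecidableEq ι]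

/-- The multiplicity `m_{k,l}(F)` of `Ψ_{k,l}` in the characteristic polynomial of `F F^∨`. -/
def mult (F : Matrix ι ι ℝ) (kl : pairs) : ℕ :=
  multiplicity (Psi kl) (F * dual F).charpoly

/-- The pairs `(k, l)` such that `Ψ_{k,l}` is a factor of the characteristic polynomial. -/
def Factors (F : Matrix ι ι ℝ) : Type := {kl : pairs // 0 < mult F kl}

/-- The subspace `W_{k,l}(F) = ker Ψ_{k,l}(R^∨)`, where `R = F F^∨`. -/
def eigenW (F : Matrix ι ι ℝ) (kl : pairs) : Submodule ℝ (ι → ℝ) :=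
  LinearMap.ker (Matrix.toLin' (Polynomial.aeval (dual (F * dual F)) (Psi kl)))

/-- `G` is a family of representatives of the canonical components of `F`: each `G (k, l)` has
determinant `±1` and is the matrix, in some basis of `W_{k,l}(F)`, of the restriction to
`W_{k,l}(F)` of the bilinear form `(x, y) ↦ x' F y`. -/
def IsCanonicalFamily (F : Matrix ι ι ℝ) {d : pairs → ℕ}
    (G : ∀ kl : pairs, Matrix (Fin (d kl)) (Fin (d kl)) ℝ) : Prop :=
  ∀ kl : pairs, |(G kl).det| = 1 ∧
    ∃ b : Module.Basis (Fin (d kl)) ℝ (eigenW F kl),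
      ∀ i j, G kl i j = (b i : ι → ℝ) ⬝ᵥ (F *ᵥ (b j : ι → ℝ))

/-- A complex root of `Ψ_{k,l}` of multiplicative order `k`. -/
lemma exists_root_Psi (kl : pairs) :
    ∃ z : ℂ, Polynomial.aeval z (Psi kl) = 0 ∧ orderOf z = kl.1.1 := by
  obtain ⟨⟨k, l⟩, hk, hl, hc, hlt⟩ := kl
  simp only at hk hl hc hlt
  have hprim : IsPrimitiveRoot (Complex.exp (2 * Real.pi * Complex.I * (l / k))) k :=
    Complex.isPrimitiveRoot_exp_of_coprime l k hk.ne' hc.symm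
  refine ⟨_, ?_, hprim.eq_orderOf.symm⟩
  by_cases h1 : k = 1
  · subst h1
    have h := hprim.pow_eq_one
    rw [pow_one] at h
    rw [h]
    simp [Psi]
  by_cases h2 : k = 2
  · subst h2
    rw [hprim.eq_neg_one_of_two_right]
    simp [Psi]
  have hk0 : (k : ℂ) ≠ 0 := by exact_mod_cast hk.ne'
  have hcos : (2 : ℂ) * Complex.cos (2 * l * Real.pi / k)
      = Complex.exp (2 * Real.pi * Complex.I * (l / k))
        + (Complex.exp (2 * Real.pi * Complex.I * (l / k)))⁻¹ := by
    rw [Complex.cos, ← Complex.exp_neg]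
    have e1 : (2 * l * Real.pi / k : ℂ) * Complex.I = 2 * Real.pi * Complex.I * (l / k) := by ring
    have e2 : -(2 * l * Real.pi / k : ℂ) * Complex.I = -(2 * Real.pi * Complex.I * (l / k)) := by
      ring
    rw [e1, e2]; ring
  have hne := Complex.exp_ne_zero (2 * Real.pi * Complex.I * (l / k))
  simp only [Psi, h1, h2, if_false]
  simp only [map_add, map_sub, map_mul, map_pow, Polynomial.aeval_X, Polynomial.aeval_C, map_one,
    Complex.coe_algebraMap]
  push_cast
  rw [hcos]
  field_simp
  ring

instance finite_factors (F : Matrix ι ι ℝ) : Finite (Factors F) := by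
  have hχ : ((F * dual F).charpoly.map (algebraMap ℝ ℂ)) ≠ 0 :=
    ((Matrix.charpoly_monic _).map _).ne_zero
  set S := ((F * dual F).charpoly.map (algebraMap ℝ ℂ)).roots.toFinset with hS
  set B := S.sup orderOf with hB
  have hbound : ∀ kl : Factors F, kl.1.1 ∈ Set.Iic ((B, max 3 B) : ℕ × ℕ) := by
    rintro ⟨kl, hm⟩
    obtain ⟨z, hz, hord⟩ := exists_root_Psi kl
    have hdvd : Psi kl ∣ (F * dual F).charpoly := dvd_of_multiplicity_pos hm
    have hzS : z ∈ S := by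
      rw [hS, Multiset.mem_toFinset, Polynomial.mem_roots hχ, Polynomial.IsRoot,
        Polynomial.eval_map_algebraMap]
      obtain ⟨r, hr⟩ := hdvd
      rw [hr, map_mul, hz, zero_mul]
    have hk : kl.1.1 ≤ B := hord ▸ Finset.le_sup (f := orderOf) hzS
    refine ⟨hk, ?_⟩
    have := kl.2.2.2.2
    simp only
    omega
  exact Finite.of_injective
    (fun kl : Factors F => (⟨kl.1.1, hbound kl⟩ : Set.Iic ((B, max 3 B) : ℕ × ℕ)))
    fun a b h => Subtype.ext (Subtype.ext (congrArg (fun x : Set.Iic ((B, max 3 B) : ℕ × ℕ) => x.1) h))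

instance fintypeFactors (F : Matrix ι ι ℝ) : Fintype (Factors F) := Fintype.ofFinite _

instance decidableEqFactors (F : Matrix ι ι ℝ) : DecidableEq (Factors F) := Classical.decEq _

/-- The block diagonal sum `⊕ B (k, l)` over the factors `Ψ_{k,l}`. -/
def directSum (F : Matrix ι ι ℝ) {d : pairs → ℕ}
    (B : ∀ kl : Factors F, Matrix (Fin (d kl.1)) (Fin (d kl.1)) ℝ) :
    Matrix (Σ kl : Factors F, Fin (d kl.1)) (Σ kl : Factors F, Fin (d kl.1)) ℝ :=
  Matrix.blockDiagonal' B

end Components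

/-! ### The symmetric spaces `G / K` -/

section Coset

variable {ι 𝕜 : Type*} [Fintype ι] [DecidableEq ι] [RCLike 𝕜]

instance subgroupDiffeology (G : Subgroup (GL ι 𝕜)) : DiffeologicalSpace G :=
  diffeologyOfMatrix fun g => ((g : GL ι 𝕜) : Matrix ι ι 𝕜)

/-- The homogeneous space `G / K`, for subgroups `K ≤ G` of a linear group, where `G` is stable under
conjugate transposition and `K` is the subgroup of its unitary elements. It is endowed with the
quotient smooth structure and with the `G`-invariant Riemannian metric that is equal to
`X ↦ c Re Tr X²` on `𝔭 = {X ∈ Lie G, X = X*}`, identified with the tangent space at the base point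
(see the two instances below). -/
def Coset (_c : ℝ) (G K : Subgroup (GL ι 𝕜)) : Type _ := G ⧸ K.subgroupOf G

/-- The projection from `G` to `G / K`. -/
def Coset.proj (c : ℝ) {G : Subgroup (GL ι 𝕜)} (K : Subgroup (GL ι 𝕜)) (g : G) : Coset c G K :=
  (QuotientGroup.mk g : G ⧸ K.subgroupOf G)

/-- The quotient smooth structure: smooth maps are those that lift locally to smooth maps
to `G`. -/
instance cosetDiffeology (c : ℝ) (G K : Subgroup (GL ι 𝕜)) : DiffeologicalSpace (Coset c G K) :=
  DiffeologicalSpace.generateFrom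
    {x | ∃ q : EuclideanSpace ℝ (Fin x.1) → G, IsPlot q ∧ x.2 = fun u => Coset.proj c K (q u)}

/-- The velocity at `t` of the projection of a smooth curve `g` of `G` corresponds under
translation by `g(t)⁻¹` to the component `X ∈ 𝔭` of `ξ = g(t)⁻¹ g'(t)`. -/
instance cosetHasSpeed (c : ℝ) (G K : Subgroup (GL ι 𝕜)) : HasSpeed (Coset c G K) where
  HasSpeedSq γ t v :=
    ∃ g : ℝ → G, DSmooth g ∧ (∀ᶠ s in nhds t, γ s = Coset.proj c K (g s)) ∧
      ∃ ξ X : Matrix ι ι 𝕜,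
        ξ = (((g t)⁻¹ : G) : GL ι 𝕜).1 * matrixDeriv (fun s => ((g s : G) : GL ι 𝕜).1) t ∧
        X = (2⁻¹ : 𝕜) • (ξ + ξᴴ) ∧
        v = c * RCLike.re (X ^ 2).trace

end Coset

section Groups

variable (𝕜 : Type*) [RCLike 𝕜]

/-- The diagonal matrix `I_{p,q}`. -/
abbrev diagI (p q : ℕ) : Matrix (Fin p ⊕ Fin q) (Fin p ⊕ Fin q) 𝕜 :=
  LieAlgebra.Orthogonal.indefiniteDiagonal (Fin p) (Fin q) 𝕜

/-- The group `SU(p, q)` over `ℂ`, and `SO(p, q)` over `ℝ`. -/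
def indefiniteSU (p q : ℕ) : Subgroup (GL (Fin p ⊕ Fin q) 𝕜) where
  carrier := {g | g.1 * diagI 𝕜 p q * g.1ᴴ = diagI 𝕜 p q ∧ g.1.det = 1}
  one_mem' := by simp
  mul_mem' := by
    rintro a b ⟨ha, ha'⟩ ⟨hb, hb'⟩
    refine ⟨?_, by simp [ha', hb']⟩
    calc (a * b).1 * diagI 𝕜 p q * (a * b).1ᴴ
        = a.1 * (b.1 * diagI 𝕜 p q * b.1ᴴ) * a.1ᴴ := by
          simp [Matrix.conjTranspose_mul, Matrix.mul_assoc]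
      _ = diagI 𝕜 p q := by rw [hb, ha]
  inv_mem' := by
    rintro a ⟨ha, ha'⟩
    have h1 : (a⁻¹).1 * a.1 = 1 := a.inv_mul
    have h2 : a.1ᴴ * (a⁻¹).1ᴴ = 1 := by rw [← Matrix.conjTranspose_mul, h1]; simp
    refine ⟨?_, ?_⟩
    · calc (a⁻¹).1 * diagI 𝕜 p q * (a⁻¹).1ᴴ
          = (a⁻¹).1 * (a.1 * diagI 𝕜 p q * a.1ᴴ) * (a⁻¹).1ᴴ := by rw [ha]
        _ = ((a⁻¹).1 * a.1) * diagI 𝕜 p q * (a.1ᴴ * (a⁻¹).1ᴴ) := by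
          simp only [Matrix.mul_assoc]
        _ = diagI 𝕜 p q := by rw [h1, h2]; simp
    · have := congrArg Matrix.det h1
      rw [Matrix.det_mul, ha', mul_one, Matrix.det_one] at this
      exact this

/-- The group `S(U(p) × U(q))` over `ℂ`, embedded block-diagonally. -/
def blockSU (p q : ℕ) : Subgroup (GL (Fin p ⊕ Fin q) ℂ) where
  carrier := {g | ∃ A ∈ Matrix.unitaryGroup (Fin p) ℂ, ∃ B ∈ Matrix.unitaryGroup (Fin q) ℂ,
    A.det * B.det = 1 ∧ g.1 = Matrix.fromBlocks A 0 0 B}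
  one_mem' := ⟨1, one_mem _, 1, one_mem _, by simp, by simp⟩
  mul_mem' := by
    rintro a b ⟨A, hA, B, hB, h, ha⟩ ⟨C, hC, D, hD, h', hb⟩
    refine ⟨A * C, mul_mem hA hC, B * D, mul_mem hB hD, ?_, ?_⟩
    · rw [Matrix.det_mul, Matrix.det_mul, mul_mul_mul_comm, h, h', one_mul]
    · simp [ha, hb, Matrix.fromBlocks_multiply]
  inv_mem' := by
    rintro a ⟨A, hA, B, hB, h, ha⟩
    refine ⟨star A, Unitary.star_mem hA, star B, Unitary.star_mem hB, ?_, ?_⟩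
    · rw [Matrix.star_eq_conjTranspose, Matrix.star_eq_conjTranspose, Matrix.det_conjTranspose,
        Matrix.det_conjTranspose, ← star_mul', h, star_one]
    · refine Units.inv_eq_of_mul_eq_one_right ?_
      rw [ha, Matrix.fromBlocks_multiply, Matrix.mem_unitaryGroup_iff.mp hA,
        Matrix.mem_unitaryGroup_iff.mp hB]
      simp

/-- The group `SO(p) × SO(q)`, embedded block-diagonally. -/
def blockSO (p q : ℕ) : Subgroup (GL (Fin p ⊕ Fin q) ℝ) where
  carrier := {g | ∃ A ∈ Matrix.specialOrthogonalGroup (Fin p) ℝ,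
    ∃ B ∈ Matrix.specialOrthogonalGroup (Fin q) ℝ, g.1 = Matrix.fromBlocks A 0 0 B}
  one_mem' := ⟨1, one_mem _, 1, one_mem _, by simp⟩
  mul_mem' := by
    rintro a b ⟨A, hA, B, hB, ha⟩ ⟨C, hC, D, hD, hb⟩
    exact ⟨A * C, mul_mem hA hC, B * D, mul_mem hB hD,
      by simp [ha, hb, Matrix.fromBlocks_multiply]⟩
  inv_mem' := by
    rintro a ⟨A, hA, B, hB, ha⟩
    refine ⟨star A, (star (⟨A, hA⟩ : Matrix.specialOrthogonalGroup (Fin p) ℝ)).2, star B,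
      (star (⟨B, hB⟩ : Matrix.specialOrthogonalGroup (Fin q) ℝ)).2, ?_⟩
    refine Units.inv_eq_of_mul_eq_one_right ?_
    rw [ha, Matrix.fromBlocks_multiply,
      Matrix.mem_unitaryGroup_iff.mp (Matrix.mem_specialOrthogonalGroup_iff.mp hA).1,
      Matrix.mem_unitaryGroup_iff.mp (Matrix.mem_specialOrthogonalGroup_iff.mp hB).1]
    simp

/-- The group `SO_0(p, q)`, identity component of `SO(p, q)`. -/
def identitySO (p q : ℕ) : Subgroup (GL (Fin p ⊕ Fin q) ℝ) :=
  (Subgroup.connectedComponentOfOne (indefiniteSU ℝ p q)).map (indefiniteSU ℝ p q).subtype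

/-- The group `Sp_{2g}(ℝ)`, as a subgroup of the linear group. -/
def Sp (g : ℕ) : Subgroup (GL (Fin g ⊕ Fin g) ℝ) where
  carrier := {a | a.1 ∈ Matrix.symplecticGroup (Fin g) ℝ}
  one_mem' := one_mem (Matrix.symplecticGroup (Fin g) ℝ)
  mul_mem' := fun {_ _} ha hb => (Matrix.symplecticGroup (Fin g) ℝ).mul_mem ha hb
  inv_mem' := by
    intro a ha
    have h : ((a⁻¹ : GL _ ℝ).1) = ((⟨a.1, ha⟩ : Matrix.symplecticGroup (Fin g) ℝ)⁻¹).1 := by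
      refine Units.inv_eq_of_mul_eq_one_right ?_
      exact congrArg Subtype.val
        (mul_inv_cancel (⟨a.1, ha⟩ : Matrix.symplecticGroup (Fin g) ℝ))
    change (a⁻¹ : GL _ ℝ).1 ∈ Matrix.symplecticGroup (Fin g) ℝ
    rw [h]
    exact Subtype.property _

/-- The real matrix of size `2g` of a complex matrix `U` of size `g`. -/
def realify {g : ℕ} (U : Matrix (Fin g) (Fin g) ℂ) : Matrix (Fin g ⊕ Fin g) (Fin g ⊕ Fin g) ℝ :=
  Matrix.fromBlocks (U.map Complex.re) (-U.map Complex.im) (U.map Complex.im) (U.map Complex.re)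

lemma realify_one {g : ℕ} : realify (1 : Matrix (Fin g) (Fin g) ℂ) = 1 := by
  ext (i | i) (j | j) <;> by_cases h : i = j <;> simp [realify, Matrix.one_apply, h]

lemma realify_mul {g : ℕ} (U V : Matrix (Fin g) (Fin g) ℂ) :
    realify (U * V) = realify U * realify V := by
  ext (i | i) (j | j) <;>
    simp [realify, Matrix.mul_apply, Fintype.sum_sum_type, Finset.sum_add_distrib,
      sub_eq_add_neg, add_comm]

/-- The group `U(g)`, embedded in the real linear group of size `2g`. -/
def realU (g : ℕ) : Subgroup (GL (Fin g ⊕ Fin g) ℝ) where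
  carrier := {a | ∃ U ∈ Matrix.unitaryGroup (Fin g) ℂ, a.1 = realify U}
  one_mem' := ⟨1, one_mem _, by simp [realify_one]⟩
  mul_mem' := by
    rintro a b ⟨U, hU, ha⟩ ⟨V, hV, hb⟩
    exact ⟨U * V, mul_mem hU hV, by simp [ha, hb, realify_mul]⟩
  inv_mem' := by
    rintro a ⟨U, hU, ha⟩
    refine ⟨star U, Unitary.star_mem hU, Units.inv_eq_of_mul_eq_one_right ?_⟩
    rw [ha, ← realify_mul, Matrix.mem_unitaryGroup_iff.mp hU, realify_one]

end Groups

end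

end Isodual

namespace Isodual

noncomputable section

/-! ### Smooth curves and derivatives of matrices -/

section Calculus

variable {ι κ μ 𝕜 : Type*} [RCLike 𝕜]

/-! Everything is governed by the cosquare `S = F^∨ F`, which is `R^∨` and satisfies `F' S = F`. If
a form `B` satisfies `S' B S = B`, then `S⁻¹` is the adjoint of `S` for `B`; since each `Ψ_{k,l}` is
self-reciprocal up to sign, the subspaces `W_{k,l}` are then pairwise `B`-orthogonal
(`dotProduct_eq_zero_of_ne`). The form `F` is invariant in this sense, and so is every `A` in `V_F`,
because `S = (F^∨ A)²` and `F^∨ A` is an isometry of `A`. As `S` has finite order, it is semisimple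
with roots of unity as eigenvalues, so `ℝⁿ` is the sum of the `W_{k,l}` (`exists_sum_eigenW`). In a
basis adapted to this sum, `F` and all points of `V_F` are block diagonal at once, which gives the
Riemannian product (`exists_isometry_locus_blocks`).

On one component `G`, the cosquare is annihilated by a single `Ψ_{k,l}`. For `x - 1` the form `G` is
symmetric, for `x + 1` it is alternating. Otherwise `S = cos θ + sin θ j` with `j² = -1`, and
dividing `G` by the square root `cos (θ/2) + sin (θ/2) j` of `S` leaves a symmetric form preserved
by `j`, that is, a Hermitian form. A change of basis, which acts on loci by isometries, brings `G`
to `I_{p,q}`, to `J`, or to the real matrix of `e^{iθ/2} I_{p,q}`.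

These normal forms `D` are orthogonal, so `D^∨ = D` and `V_D` is the set of positive definite `A`
with `A D A = D`. By polar decomposition `g ↦ g g*` identifies `G / K` with this set, the inverse
being the positive square root (`exists_isometry_coset_locus`). Its smoothness follows from the
inverse function theorem, since the differential `X ↦ C X + X C` of squaring is injective at
positive definite `C`. The differential of `g g*` at the base point is `X ↦ 2X` on `𝔭`, hence the
factor `4`; it becomes `8` in the complex case because passing to real matrices doubles the trace.
-/

lemma contDiff_entries_of_dSmooth {X : Type*} {f : X → Matrix ι κ 𝕜} {γ : ℝ → X}
    (h : @DSmooth ℝ X _ (diffeologyOfMatrix f) γ) (i : ι) (j : κ) :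
    ContDiff ℝ ∞ (fun s => f (γ s) i j) := by
  -- Plots live on Euclidean spaces, so `ℝ` is first replaced by the one-dimensional one.
  let g := toEuclidean (E := ℝ)
  have h1 := h _ _ (g.symm.contDiff (n := ∞)).isPlot i j
  have h2 := h1.comp (g.contDiff (n := ∞))
  simpa [Function.comp_def] using h2

lemma matrixDeriv_apply (γ : ℝ → Matrix ι κ 𝕜) (t : ℝ) (i : ι) (j : κ) :
    matrixDeriv γ t i j = deriv (fun s => γ s i j) t := rfl

lemma matrixDeriv_mul [Fintype κ] {A : ℝ → Matrix ι κ 𝕜} {B : ℝ → Matrix κ μ 𝕜} {t : ℝ}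
    (hA : ∀ i j, DifferentiableAt ℝ (fun s => A s i j) t)
    (hB : ∀ i j, DifferentiableAt ℝ (fun s => B s i j) t) :
    matrixDeriv (fun s => A s * B s) t = matrixDeriv A t * B t + A t * matrixDeriv B t := by
  ext i j
  simp only [matrixDeriv_apply, Matrix.mul_apply, Matrix.add_apply]
  have h : HasDerivAt (fun s => ∑ k, A s i k * B s k j)
      (∑ k, (deriv (fun s => A s i k) t * B t k j + A t i k * deriv (fun s => B s k j) t)) t :=
    HasDerivAt.fun_sum fun k _ => (hA i k).hasDerivAt.mul (hB k j).hasDerivAt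
  rw [h.deriv, Finset.sum_add_distrib]

lemma matrixDeriv_conjTranspose {A : ℝ → Matrix ι κ 𝕜} {t : ℝ}
    (hA : ∀ i j, DifferentiableAt ℝ (fun s => A s i j) t) :
    matrixDeriv (fun s => (A s)ᴴ) t = (matrixDeriv A t)ᴴ := by
  ext i j
  simp only [matrixDeriv_apply, Matrix.conjTranspose_apply]
  exact (hA j i).hasDerivAt.star.deriv

lemma matrixDeriv_linearMap {ι' κ' 𝕜' : Type*} [RCLike 𝕜'] [Finite ι] [Finite κ]
    (L : Matrix ι κ 𝕜 →ₗ[ℝ] Matrix ι' κ' 𝕜') {A : ℝ → Matrix ι κ 𝕜} {t : ℝ}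
    (hA : ∀ i j, DifferentiableAt ℝ (fun s => A s i j) t) :
    matrixDeriv (fun s => L (A s)) t = L (matrixDeriv A t) := by
  have := Fintype.ofFinite ι
  have := Fintype.ofFinite κ
  ext i j
  let ℓ : (ι → κ → 𝕜) →L[ℝ] 𝕜' := LinearMap.toContinuousLinearMap
    ((Matrix.entryLinearMap ℝ 𝕜' i j).comp (L.comp (Matrix.ofLinearEquiv ℝ).toLinearMap))
  have h : HasDerivAt (fun s => (A s : ι → κ → 𝕜)) (matrixDeriv A t) t :=
    hasDerivAt_pi.2 fun a => hasDerivAt_pi.2 fun b => (hA a b).hasDerivAt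
  exact (ℓ.hasFDerivAt.comp_hasDerivAt t h).deriv

lemma contDiff_linearMap {ι' κ' 𝕜' E : Type*} [RCLike 𝕜'] [Finite ι] [Finite κ]
    [NormedAddCommGroup E] [NormedSpace ℝ E]
    (L : Matrix ι κ 𝕜 →ₗ[ℝ] Matrix ι' κ' 𝕜') {A : E → Matrix ι κ 𝕜}
    (hA : ∀ i j, ContDiff ℝ ∞ (fun s => A s i j)) (i : ι') (j : κ') :
    ContDiff ℝ ∞ (fun s => L (A s) i j) := by
  have := Fintype.ofFinite ι
  have := Fintype.ofFinite κ
  let ℓ : (ι → κ → 𝕜) →L[ℝ] 𝕜' := LinearMap.toContinuousLinearMap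
    ((Matrix.entryLinearMap ℝ 𝕜' i j).comp (L.comp (Matrix.ofLinearEquiv ℝ).toLinearMap))
  have h : ContDiff ℝ ∞ (fun s a b => A s a b) :=
    contDiff_pi.2 fun a => contDiff_pi.2 fun b => hA a b
  exact ℓ.contDiff.comp h

lemma contDiff_matrix_mul {E : Type*} [Fintype κ] [NormedAddCommGroup E] [NormedSpace ℝ E]
    {A : E → Matrix ι κ 𝕜} {B : E → Matrix κ μ 𝕜}
    (hA : ∀ i j, ContDiff ℝ ∞ (fun s => A s i j)) (hB : ∀ i j, ContDiff ℝ ∞ (fun s => B s i j))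
    (i : ι) (j : μ) : ContDiff ℝ ∞ (fun s => (A s * B s) i j) := by
  simp only [Matrix.mul_apply]
  exact ContDiff.sum fun k _ => (hA i k).mul (hB k j)

lemma contDiff_matrix_conjTranspose {E : Type*} [NormedAddCommGroup E] [NormedSpace ℝ E]
    {A : E → Matrix ι κ 𝕜} (hA : ∀ i j, ContDiff ℝ ∞ (fun s => A s i j)) (i : κ) (j : ι) :
    ContDiff ℝ ∞ (fun s => (A s)ᴴ i j) :=
  (starL' ℝ (A := 𝕜)).contDiff.comp (hA j i)

end Calculus

/-! ### Smoothness of the square root of positive definite matrices -/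

section Sqrt

open scoped MatrixOrder ComplexOrder

variable {κ 𝕜 : Type*} [Fintype κ] [RCLike 𝕜]

lemma isClosed_posSemidef : IsClosed {X : Matrix κ κ 𝕜 | X.PosSemidef} := by
  simp only [Matrix.posSemidef_iff_dotProduct_mulVec, Set.ofPred_and, Set.ofPred_forall]
  refine IsClosed.inter ?_ (isClosed_iInter fun x => ?_)
  · exact isClosed_eq continuous_id.matrix_conjTranspose continuous_id
  · refine isClosed_Ici.preimage (f := fun X : Matrix κ κ 𝕜 => star x ⬝ᵥ X *ᵥ x) ?_
    exact continuous_const.dotProduct (continuous_id.matrix_mulVec continuous_const)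

/-- The trace of `X² = X X*` is the sum of all `‖X a b‖²`. Thus a bound on the square of a Hermitian
matrix confines the matrix to a compact set. -/
lemma norm_apply_le_of_isHermitian {X : Matrix κ κ 𝕜} (hX : X.IsHermitian) (i j : κ) :
    ‖X i j‖ ^ 2 ≤ RCLike.re (X * X).trace := by
  have h : RCLike.re (X * X).trace = ∑ a, ∑ b, ‖X a b‖ ^ 2 := by
    simp only [Matrix.trace, Matrix.diag, Matrix.mul_apply, map_sum]
    refine Finset.sum_congr rfl fun a _ => Finset.sum_congr rfl fun b _ => ?_
    rw [← hX.apply b a, RCLike.star_def, RCLike.mul_conj]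
    norm_cast
  rw [h]
  calc ‖X i j‖ ^ 2 ≤ ∑ b, ‖X i b‖ ^ 2 :=
        Finset.single_le_sum (f := fun b => ‖X i b‖ ^ 2) (fun _ _ => by positivity)
          (Finset.mem_univ j)
    _ ≤ _ := Finset.single_le_sum (f := fun a => ∑ b, ‖X a b‖ ^ 2) (fun _ _ => by positivity)
          (Finset.mem_univ i)

variable [DecidableEq κ]

lemma sqrt_posDef {B : Matrix κ κ 𝕜} (hB : B.PosDef) : (CFC.sqrt B).PosDef := by
  have h := Matrix.nonneg_iff_posSemidef.1 (CFC.sqrt_nonneg B)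
  rw [h.posDef_iff_isUnit]
  have h2 : CFC.sqrt B * CFC.sqrt B = B := CFC.sqrt_mul_sqrt_self B hB.posSemidef.nonneg
  have h3 : IsUnit (CFC.sqrt B * CFC.sqrt B) := by rw [h2]; exact hB.isUnit
  rw [Matrix.isUnit_iff_isUnit_det] at h3 ⊢
  rw [Matrix.det_mul] at h3
  exact isUnit_of_mul_isUnit_left h3

lemma sqrt_mul_self {B : Matrix κ κ 𝕜} (hB : B.PosDef) : CFC.sqrt B * CFC.sqrt B = B :=
  CFC.sqrt_mul_sqrt_self B hB.posSemidef.nonneg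

/-- Uniqueness of positive square roots. -/
lemma posDef_eq_of_mul_self_eq {B C : Matrix κ κ 𝕜} (hB : B.PosDef) (hC : C.PosDef)
    (h : B * B = C * C) : B = C := by
  rw [← CFC.sqrt_mul_self B hB.posSemidef.nonneg, h, CFC.sqrt_mul_self C hC.posSemidef.nonneg]

/-- A family of positive definite matrices with continuous square is continuous. -/
lemma continuous_of_mul_self {E : Type*} [TopologicalSpace E] {q : E → Matrix κ κ 𝕜}
    (hq : ∀ u, (q u).PosDef) (h : Continuous fun u => q u * q u) : Continuous q := by
  refine continuous_iff_continuousAt.2 fun u => ?_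
  set T : ℝ := RCLike.re (q u * q u).trace + 1
  let K : Set (Matrix κ κ 𝕜) :=
    Set.univ.pi fun _ => Set.univ.pi fun _ => Metric.closedBall (0 : 𝕜) (√T)
  have hK : IsCompact K :=
    isCompact_univ_pi fun _ => isCompact_univ_pi fun _ => isCompact_closedBall _ _
  have htr : Continuous fun u => RCLike.re (q u * q u).trace :=
    RCLike.continuous_re.comp h.matrix_trace
  have hev : ∀ᶠ v in nhds u, q v ∈ K := by
    have : ∀ᶠ v in nhds u, RCLike.re (q v * q v).trace < T :=
      htr.continuousAt.eventually_lt continuousAt_const (lt_add_one _)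
    filter_upwards [this] with v hv
    intro i _ j _
    rw [mem_closedBall_zero_iff]
    exact Real.le_sqrt_of_sq_le
      ((norm_apply_le_of_isHermitian (hq v).isHermitian i j).trans hv.le)
  -- Near `u` the values stay in a compact set, and any cluster point is a positive semidefinite
  -- square root of `q u * q u`. Such a root is unique, so the limit is `q u`.
  refine hK.tendsto_nhds_of_unique_mapClusterPt hev fun X _ hX => ?_
  have h1 : X.PosSemidef := by
    by_contra hn
    have h2 := (mapClusterPt_iff_frequently.1 hX) _ (isClosed_posSemidef.isOpen_compl.mem_nhds hn)
    obtain ⟨v, hv⟩ := h2.exists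
    exact hv (hq v).posSemidef
  have h2 : X * X = q u * q u := by
    by_contra hne
    obtain ⟨U, V, hU, hV, hXU, hBV, hUV⟩ := t2_separation hne
    have hc : Continuous fun Y : Matrix κ κ 𝕜 => Y * Y := continuous_id.mul continuous_id
    have h3 := mapClusterPt_iff_frequently.1 hX _ ((hU.preimage hc).mem_nhds hXU)
    obtain ⟨v, hv, hv'⟩ := (h3.and_eventually (h.continuousAt (hV.mem_nhds hBV))).exists
    exact Set.disjoint_left.1 hUV hv hv'
  rw [← CFC.sqrt_mul_self X h1.nonneg, h2, CFC.sqrt_mul_self (q u) (hq u).posSemidef.nonneg]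

/-- The Lyapunov operator `X ↦ C X + X C` of a positive definite matrix is injective. -/
lemma eq_zero_of_lyapunov {C X : Matrix κ κ 𝕜} (hC : C.PosDef) (h : C * X + X * C = 0) :
    X = 0 := by
  have hs := sqrt_mul_self hC
  have hh : (CFC.sqrt C)ᴴ = CFC.sqrt C := (sqrt_posDef hC).isHermitian
  set D := CFC.sqrt C
  have e1 : Xᴴ * (C * X) = (D * X)ᴴ * (D * X) := by
    rw [Matrix.conjTranspose_mul, hh, ← hs]; simp only [Matrix.mul_assoc]
  have e2 : (Xᴴ * (X * C)).trace = ((X * D)ᴴ * (X * D)).trace := by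
    rw [Matrix.conjTranspose_mul, hh, Matrix.mul_assoc, Matrix.trace_mul_comm D, ← hs]
    simp only [Matrix.mul_assoc]
  -- Pairing `C X + X C` with `X` under the trace gives the squared norms of `D X` and `X D`, where
  -- `D = √C`. Both must vanish.
  have e3 : ((D * X)ᴴ * (D * X)).trace + ((X * D)ᴴ * (X * D)).trace = 0 := by
    rw [← e1, ← e2, ← Matrix.trace_add, ← Matrix.mul_add, h, Matrix.mul_zero, Matrix.trace_zero]
  have p1 := (Matrix.posSemidef_conjTranspose_mul_self (D * X)).trace_nonneg
  have p2 := (Matrix.posSemidef_conjTranspose_mul_self (X * D)).trace_nonneg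
  have e4 := ((add_eq_zero_iff_of_nonneg p1 p2).1 e3).1
  rw [Matrix.trace_conjTranspose_mul_self_eq_zero_iff] at e4
  have hu := (sqrt_posDef hC).isUnit
  exact hu.mul_right_eq_zero.1 e4

section
attribute [local instance] Matrix.linftyOpNormedRing Matrix.linftyOpNormedAlgebra

/-- The differential of squaring at `C` is the Lyapunov operator, which is invertible, so squaring
has a smooth local inverse. Continuity of `q` keeps it on the branch through `C`, where it is this
inverse applied to `q²`. -/
lemma contDiffAt_of_mul_self {E : Type*} [NormedAddCommGroup E] [NormedSpace ℝ E]
    {q : E → Matrix κ κ 𝕜} {u : E} (hq : ContinuousAt q u) (hpos : (q u).PosDef)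
    (h : ContDiffAt ℝ ∞ (fun x => q x * q x) u) : ContDiffAt ℝ ∞ q u := by
  set C := q u
  let L : Matrix κ κ 𝕜 →ₗ[ℝ] Matrix κ κ 𝕜 := LinearMap.mulLeft ℝ C + LinearMap.mulRight ℝ C
  have hL : Function.Injective L := by
    refine (injective_iff_map_eq_zero L).2 fun X hX => eq_zero_of_lyapunov hpos ?_
    simpa [L] using hX
  let e : Matrix κ κ 𝕜 ≃L[ℝ] Matrix κ κ 𝕜 :=
    (LinearEquiv.ofInjectiveEndo L hL).toContinuousLinearEquiv
  have hsq : ContDiffAt ℝ ∞ (fun X : Matrix κ κ 𝕜 => X * X) C :=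
    contDiffAt_id.mul contDiffAt_id
  have hd : HasFDerivAt (fun X : Matrix κ κ 𝕜 => X * X)
      (e : Matrix κ κ 𝕜 →L[ℝ] Matrix κ κ 𝕜) C := by
    refine ((hasFDerivAt_id (𝕜 := ℝ) C).mul' (hasFDerivAt_id C)).congr_fderiv ?_
    ext1 X
    change C * X + X * C = _
    rfl
  have h1 : (∞ : WithTop ℕ∞) ≠ 0 := by simp
  have hloc := hsq.to_localInverse hd h1
  have hcomp : ContDiffAt ℝ ∞ (fun x => hsq.localInverse hd h1 (q x * q x)) u :=
    ContDiffAt.comp u hloc h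
  refine hcomp.congr_of_eventuallyEq ?_
  have hleft := (hsq.hasStrictFDerivAt' hd h1).eventually_left_inverse
  filter_upwards [hq.eventually hleft] with x hx
  exact hx.symm

lemma contDiff_sqrt {E : Type*} [NormedAddCommGroup E] [NormedSpace ℝ E]
    {p : E → Matrix κ κ 𝕜} (hp : ∀ u, (p u).PosDef)
    (h : ∀ i j, ContDiff ℝ ∞ (fun u => p u i j)) (i j : κ) :
    ContDiff ℝ ∞ (fun u => CFC.sqrt (p u) i j) := by
  have hp' : ContDiff ℝ ∞ p := by
    have : p = fun u => ∑ i, ∑ j, Matrix.single i j (p u i j) := by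
      ext1 u; exact Matrix.matrix_eq_sum_single _
    rw [this]
    refine ContDiff.sum fun i _ => ContDiff.sum fun j _ => ?_
    exact (LinearMap.toContinuousLinearMap (Matrix.singleLinearMap ℝ i j)).contDiff.comp (h i j)
  have hc : Continuous fun u => CFC.sqrt (p u) :=
    continuous_of_mul_self (fun u => sqrt_posDef (hp u))
      (by
        simp only [sqrt_mul_self (hp _)]
        exact continuous_matrix fun i j => (h i j).continuous)
  have hs : ContDiff ℝ ∞ fun u => CFC.sqrt (p u) := by
    refine contDiff_iff_contDiffAt.2 fun u => contDiffAt_of_mul_self hc.continuousAt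
      (sqrt_posDef (hp u)) ?_
    simp only [sqrt_mul_self (hp _)]
    exact hp'.contDiffAt
  exact (LinearMap.toContinuousLinearMap (Matrix.entryLinearMap ℝ 𝕜 i j)).contDiff.comp hs

end

/-- If `N` is unitary, `C` is positive definite and `C² N C² = N`, then `C N C = N`. -/
lemma PosDef.mul_mul_eq_of_sq {C N : Matrix κ κ 𝕜} (hC : C.PosDef) (hN : Nᴴ * N = 1)
    (h : C * C * N * (C * C) = N) : C * N * C = N := by
  have hN' : N * Nᴴ = 1 := mul_eq_one_comm.1 hN
  have hdet : IsUnit C.det := (Matrix.isUnit_iff_isUnit_det _).1 hC.isUnit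
  have h1 : (Nᴴ * C * N).PosDef := by
    refine hC.conjTranspose_mul_mul_same (Matrix.mulVec_injective_iff_isUnit.2 ?_)
    exact IsUnit.of_mul_eq_one_right _ hN
  -- The square of `N* C N` is `N* C² N`, which the hypothesis identifies with the inverse of `C²`;
  -- uniqueness of positive roots does the rest.
  have h2 : Nᴴ * C * N = C⁻¹ := by
    refine posDef_eq_of_mul_self_eq h1 hC.inv ?_
    have e1 : Nᴴ * C * N * (Nᴴ * C * N) = Nᴴ * (C * C) * N := by
      calc _ = Nᴴ * C * (N * Nᴴ) * C * N := by simp only [Matrix.mul_assoc]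
        _ = Nᴴ * (C * C) * N := by rw [hN']; simp only [Matrix.mul_assoc, Matrix.mul_one]
    rw [e1, ← Matrix.mul_inv_rev]
    refine (Matrix.inv_eq_left_inv ?_).symm
    rw [Matrix.mul_assoc, Matrix.mul_assoc, ← Matrix.mul_assoc (C * C), h, hN]
  calc C * N * C = N * (Nᴴ * C * N) * C := by
        simp only [← Matrix.mul_assoc]; rw [hN', Matrix.one_mul]
    _ = N := by rw [h2, Matrix.mul_assoc, Matrix.nonsing_inv_mul _ hdet, Matrix.mul_one]

end Sqrt

/-! ### Riemannian isometries -/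

section Isometry

variable {X Y Z : Type*} [DiffeologicalSpace X] [HasSpeed X] [DiffeologicalSpace Y] [HasSpeed Y]
  [DiffeologicalSpace Z] [HasSpeed Z]

lemma IsRiemannianIsometry.trans {e : X ≃ Y} {f : Y ≃ Z} (he : IsRiemannianIsometry e)
    (hf : IsRiemannianIsometry f) : IsRiemannianIsometry (e.trans f) :=
  ⟨hf.1.comp he.1, he.2.1.comp hf.2.1, fun γ hγ t v =>
    (he.2.2 γ hγ t v).trans (hf.2.2 _ (he.1.comp hγ) t v)⟩

lemma IsRiemannianIsometry.symm {e : X ≃ Y} (he : IsRiemannianIsometry e) :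
    IsRiemannianIsometry e.symm := by
  refine ⟨he.2.1, he.1, fun γ hγ t v => ?_⟩
  have := he.2.2 _ (he.2.1.comp hγ) t v
  simp only [Function.comp_apply, Equiv.apply_symm_apply] at this
  exact this.symm

end Isometry

/-! ### Symmetric spaces as loci of positive definite matrices -/

section CosetIsometry

open scoped ComplexOrder MatrixOrder

variable {ι κ 𝕜 : Type*} [Fintype ι] [DecidableEq ι] [Fintype κ] [DecidableEq κ] [RCLike 𝕜]

lemma contDiff_locus_curve {F : Matrix ι ι ℝ} {γ : ℝ → locus F} (hγ : DSmooth γ) (i j : ι) :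
    ContDiff ℝ ∞ (fun s => (γ s : Matrix ι ι ℝ) i j) :=
  contDiff_entries_of_dSmooth hγ i j

lemma contDiff_subgroup_curve {G : Subgroup (GL κ 𝕜)} {γ : ℝ → G} (hγ : DSmooth γ) (i j : κ) :
    ContDiff ℝ ∞ (fun s => ((γ s : GL κ 𝕜) : Matrix κ κ 𝕜) i j) :=
  contDiff_entries_of_dSmooth hγ i j

lemma conjTranspose_mul_inv_mul (g : GL κ 𝕜) : (g.1 * g.1ᴴ)⁻¹ = (g⁻¹).1ᴴ * (g⁻¹).1 := by
  refine Matrix.inv_eq_right_inv ?_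
  have h1 : g.1 * (g⁻¹).1 = 1 := g.mul_inv
  have h2 : g.1ᴴ * (g⁻¹).1ᴴ = 1 := by
    rw [← Matrix.conjTranspose_mul, g.inv_mul, Matrix.conjTranspose_one]
  calc g.1 * g.1ᴴ * ((g⁻¹).1ᴴ * (g⁻¹).1) = g.1 * (g.1ᴴ * (g⁻¹).1ᴴ) * (g⁻¹).1 := by
        simp only [Matrix.mul_assoc]
    _ = 1 := by rw [h2, Matrix.mul_one, h1]

/-- The squared speed of `g g*` in terms of the `𝔭`-component of `g⁻¹ g'`. -/
lemma trace_speed_mul_conjTranspose (g : GL κ 𝕜) (D ξ X : Matrix κ κ 𝕜)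
    (hξ : ξ = (g⁻¹).1 * D) (hX : X = (2⁻¹ : 𝕜) • (ξ + ξᴴ)) :
    (((g.1 * g.1ᴴ)⁻¹ * (D * g.1ᴴ + g.1 * Dᴴ)) ^ 2).trace = 4 * (X ^ 2).trace := by
  have h1 : g.1 * (g⁻¹).1 = 1 := g.mul_inv
  have h1' : (g⁻¹).1 * g.1 = 1 := g.inv_mul
  have h2 : g.1ᴴ * (g⁻¹).1ᴴ = 1 := by
    rw [← Matrix.conjTranspose_mul, h1', Matrix.conjTranspose_one]
  have hD : D = g.1 * ξ := by rw [hξ, ← Matrix.mul_assoc, h1, Matrix.one_mul]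
  -- With `D = g ξ`, the logarithmic derivative of `g g*` is conjugate, through `g*`, to `ξ + ξ* =
  -- 2X`. Squaring produces the factor `4`.
  have h3 : (g.1 * g.1ᴴ)⁻¹ * (D * g.1ᴴ + g.1 * Dᴴ) = (g⁻¹).1ᴴ * (ξ + ξᴴ) * g.1ᴴ := by
    rw [conjTranspose_mul_inv_mul, hD, Matrix.conjTranspose_mul]
    calc (g⁻¹).1ᴴ * (g⁻¹).1 * (g.1 * ξ * g.1ᴴ + g.1 * (ξᴴ * g.1ᴴ))
        = (g⁻¹).1ᴴ * ((g⁻¹).1 * g.1) * (ξ + ξᴴ) * g.1ᴴ := by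
          simp only [Matrix.mul_add, Matrix.add_mul, Matrix.mul_assoc]
      _ = _ := by rw [h1', Matrix.mul_one]
  have h4 : ξ + ξᴴ = (2 : 𝕜) • X := by rw [hX, smul_smul]; norm_num
  rw [h3, h4, pow_two]
  calc ((g⁻¹).1ᴴ * (2 : 𝕜) • X * g.1ᴴ * ((g⁻¹).1ᴴ * (2 : 𝕜) • X * g.1ᴴ)).trace
      = ((g⁻¹).1ᴴ * ((2 : 𝕜) • X * (g.1ᴴ * (g⁻¹).1ᴴ) * (2 : 𝕜) • X * g.1ᴴ)).trace := by
        simp only [Matrix.mul_assoc]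
    _ = ((2 : 𝕜) • X * (2 : 𝕜) • X * (g.1ᴴ * (g⁻¹).1ᴴ)).trace := by
        rw [h2, Matrix.mul_one, Matrix.trace_mul_comm, Matrix.mul_assoc, h2]
    _ = 4 * (X ^ 2).trace := by
        rw [h2, Matrix.mul_one, Matrix.smul_mul, Matrix.mul_smul, smul_smul, Matrix.trace_smul,
          pow_two, smul_eq_mul]
        norm_num

/-- A symmetric space `G / K` is isometric to a locus, through `g ↦ ρ (g g*)`. -/
theorem exists_isometry_coset_locus (G K : Subgroup (GL κ 𝕜)) (c : ℝ)
    (ρ : Matrix κ κ 𝕜 →ₐ[ℝ] Matrix ι ι ℝ) (hinj : Function.Injective ρ)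
    (htr : ∀ B, 4 * (ρ B).trace = c * RCLike.re B.trace) (D : Matrix ι ι ℝ)
    (hK : ∀ g ∈ G, g ∈ K ↔ g.1 * g.1ᴴ = 1)
    (hG : ∀ g ∈ G, ρ (g.1 * g.1ᴴ) ∈ locus D)
    (hlocus : ∀ A ∈ locus D, ∃ B : Matrix κ κ 𝕜, B.PosDef ∧ ρ B = A)
    (hsqrt : ∀ (B : Matrix κ κ 𝕜) (g : GL κ 𝕜), B.PosDef → ρ B ∈ locus D → g.1.PosDef →
      g.1 * g.1 = B → g ∈ G) :
    ∃ e : Coset c G K ≃ locus D, IsRiemannianIsometry e := by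
  let f : G → locus D := fun g => ⟨ρ (g.1.1 * g.1.1ᴴ), hG g.1 g.2⟩
  -- The equality `g g* = h h*` means that `k = g⁻¹ h` satisfies `k k* = 1`, which is membership in
  -- `K`.
  have hfib : ∀ g h : G, f g = f h ↔ Coset.proj c K g = Coset.proj c K h := by
    intro g h
    have h1 : Coset.proj c K g = Coset.proj c K h ↔ (g.1⁻¹ * h.1) ∈ K := by
      refine QuotientGroup.eq.trans ?_
      rw [Subgroup.mem_subgroupOf]
      rfl
    rw [h1, hK _ (G.mul_mem (G.inv_mem g.2) h.2), Subtype.mk.injEq, hinj.eq_iff]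
    have e1 : (g.1⁻¹ * h.1).1 * (g.1⁻¹ * h.1).1ᴴ = (g.1⁻¹).1 * (h.1.1 * h.1.1ᴴ) * (g.1⁻¹).1ᴴ := by
      rw [Units.val_mul, Matrix.conjTranspose_mul]; simp only [Matrix.mul_assoc]
    have e2 : (g.1⁻¹).1 * g.1.1 = 1 := g.1.inv_mul
    have e2' : g.1.1 * (g.1⁻¹).1 = 1 := g.1.mul_inv
    have e3 : g.1.1ᴴ * (g.1⁻¹).1ᴴ = 1 := by
      rw [← Matrix.conjTranspose_mul, e2, Matrix.conjTranspose_one]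
    have e3' : (g.1⁻¹).1ᴴ * g.1.1ᴴ = 1 := by
      rw [← Matrix.conjTranspose_mul, e2', Matrix.conjTranspose_one]
    rw [e1]
    constructor
    · intro H
      rw [← H]
      calc _ = ((g.1⁻¹).1 * g.1.1) * (g.1.1ᴴ * (g.1⁻¹).1ᴴ) := by simp only [Matrix.mul_assoc]
        _ = 1 := by rw [e2, e3, Matrix.one_mul]
    · intro H
      calc g.1.1 * g.1.1ᴴ = g.1.1 * ((g.1⁻¹).1 * (h.1.1 * h.1.1ᴴ) * (g.1⁻¹).1ᴴ) * g.1.1ᴴ := by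
            rw [H, Matrix.mul_one]
        _ = (g.1.1 * (g.1⁻¹).1) * (h.1.1 * h.1.1ᴴ) * ((g.1⁻¹).1ᴴ * g.1.1ᴴ) := by
            simp only [Matrix.mul_assoc]
        _ = _ := by rw [e2', e3', Matrix.one_mul, Matrix.mul_one]
  let φ : Coset c G K → locus D := Quotient.lift f fun a b hab =>
    (hfib a b).2 (Quotient.sound hab)
  have hφ : ∀ g, φ (Coset.proj c K g) = f g := fun _ => rfl
  -- the section `A ↦ √(ρ⁻¹ A)`
  choose β hβpos hβ using fun A : locus D => hlocus A.1 A.2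
  have hunit : ∀ A, IsUnit (CFC.sqrt (β A)) := fun A => (sqrt_posDef (hβpos A)).isUnit
  let σ : locus D → G := fun A => ⟨(hunit A).unit, hsqrt (β A) _ (hβpos A) (by rw [hβ]; exact A.2)
    (sqrt_posDef (hβpos A)) (sqrt_mul_self (hβpos A))⟩
  have hσval : ∀ A, (σ A).1.1 = CFC.sqrt (β A) := fun _ => rfl
  have hfσ : ∀ A, f (σ A) = A := by
    intro A
    refine Subtype.ext ?_
    change ρ ((σ A).1.1 * (σ A).1.1ᴴ) = A
    rw [hσval, (sqrt_posDef (hβpos A)).isHermitian, sqrt_mul_self (hβpos A), hβ]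
  have hbij : Function.Bijective φ := by
    constructor
    · rintro ⟨a⟩ ⟨b⟩ hab
      exact (hfib a b).1 hab
    · intro A
      exact ⟨Coset.proj c K (σ A), hfσ A⟩
  let e : Coset c G K ≃ locus D := Equiv.ofBijective φ hbij
  have he : ∀ g, e (Coset.proj c K g) = f g := hφ
  have hsymm : ∀ A, e.symm A = Coset.proj c K (σ A) := fun A => by
    rw [Equiv.symm_apply_eq, he, hfσ]
  -- A linear left inverse of `ρ` expresses the chosen preimages `β A` as `L A`, so that they depend
  -- smoothly on `A`.
  obtain ⟨L, hL⟩ := ρ.toLinearMap.exists_leftInverse_of_injective (LinearMap.ker_eq_bot.2 hinj)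
  have hβL : ∀ A : locus D, β A = L A.1 := fun A => by
    rw [← hβ A]; exact (LinearMap.congr_fun hL (β A)).symm
  have hσplot : ∀ {E : Type} [NormedAddCommGroup E] [NormedSpace ℝ E] (p : E → locus D),
      (∀ i j, ContDiff ℝ ∞ fun u => (p u).1 i j) →
      ∀ i j, ContDiff ℝ ∞ fun u => (σ (p u)).1.1 i j := by
    intro E _ _ p hp i j
    simp only [hσval]
    refine contDiff_sqrt (fun u => hβpos _) (fun i j => ?_) i j
    simp only [hβL]
    exact contDiff_linearMap L hp i j
  have hfplot : ∀ {E : Type} [NormedAddCommGroup E] [NormedSpace ℝ E] (q : E → G),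
      (∀ i j, ContDiff ℝ ∞ fun u => (q u).1.1 i j) →
      ∀ i j, ContDiff ℝ ∞ fun u => (f (q u)).1 i j := by
    intro E _ _ q hq i j
    exact contDiff_linearMap ρ.toLinearMap
      (contDiff_matrix_mul hq (contDiff_matrix_conjTranspose hq)) i j
  have hspeed : ∀ g : ℝ → G, DSmooth g → ∀ (t : ℝ) (ξ X : Matrix κ κ 𝕜),
      ξ = (((g t)⁻¹ : G) : GL κ 𝕜).1 * matrixDeriv (fun s => ((g s : G) : GL κ 𝕜).1) t →
      X = (2⁻¹ : 𝕜) • (ξ + ξᴴ) →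
      (((f (g t)).1⁻¹ * matrixDeriv (fun s => (f (g s)).1) t) ^ 2).trace
        = c * RCLike.re (X ^ 2).trace := by
    intro g hg t ξ X hξ hX
    have hd : ∀ i j, Differentiable ℝ fun s => (g s).1.1 i j := fun i j =>
      (contDiff_subgroup_curve hg i j).differentiable (by simp)
    have hd' : ∀ i j, Differentiable ℝ fun s => ((g s).1.1)ᴴ i j := fun i j =>
      (contDiff_matrix_conjTranspose (contDiff_subgroup_curve hg) i j).differentiable (by simp)
    have hdd : ∀ i j, Differentiable ℝ fun s => ((g s).1.1 * ((g s).1.1)ᴴ) i j := fun i j =>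
      (contDiff_matrix_mul (contDiff_subgroup_curve hg)
        (contDiff_matrix_conjTranspose (contDiff_subgroup_curve hg)) i j).differentiable (by simp)
    set D' := matrixDeriv (fun s => ((g s : G) : GL κ 𝕜).1) t with hD'
    have h1 : matrixDeriv (fun s => (f (g s)).1) t
        = ρ (D' * ((g t).1.1)ᴴ + (g t).1.1 * D'ᴴ) := by
      have := matrixDeriv_linearMap (t := t) ρ.toLinearMap fun i j => (hdd i j) t
      refine this.trans ?_
      rw [matrixDeriv_mul (fun i j => (hd i j) t) (fun i j => (hd' i j) t),
        matrixDeriv_conjTranspose fun i j => (hd i j) t]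
      rfl
    have h2 : (f (g t)).1⁻¹ = ρ (((g t).1.1 * ((g t).1.1)ᴴ)⁻¹) := by
      refine Matrix.inv_eq_left_inv ?_
      change ρ _ * ρ _ = 1
      rw [← map_mul, Matrix.nonsing_inv_mul, map_one]
      rw [← Matrix.isUnit_iff_isUnit_det]
      exact (g t).1.isUnit.mul ((Matrix.isUnit_conjTranspose _).2 (g t).1.isUnit)
    rw [h1, h2, ← map_mul, ← map_pow]
    have h3 := trace_speed_mul_conjTranspose (g t).1 D' ξ X hξ hX
    have h4 := htr (((((g t).1.1 * ((g t).1.1)ᴴ)⁻¹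
      * (D' * ((g t).1.1)ᴴ + (g t).1.1 * D'ᴴ))) ^ 2)
    rw [h3] at h4
    have h5 : RCLike.re (4 * (X ^ 2).trace) = 4 * RCLike.re (X ^ 2).trace := by
      rw [show (4 : 𝕜) = ((4 : ℝ) : 𝕜) from (RCLike.ofReal_ofNat 4).symm, RCLike.re_ofReal_mul]
    rw [h5] at h4
    linarith
  have he1 : DSmooth e := by
    intro n p hp
    -- A plot of a generated diffeology is a plot of every diffeology that contains the generators.
    -- It is tested here on the one that makes `e` smooth by definition.
    refine hp (diffeologyOfMatrix fun x => (e x : Matrix ι ι ℝ)) ?_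
    rintro ⟨m, q⟩ ⟨r, hr, hq⟩
    intro i j
    simp only at hq
    rw [hq]
    exact hfplot r hr i j
  have hσsmooth : DSmooth σ := fun n p hp => hσplot p hp
  refine ⟨e, he1, ?_, ?_⟩
  · intro n p hp
    refine DiffeologicalSpace.isPlot_generatedFrom_of_mem ⟨fun u => σ (p u), ?_, ?_⟩
    · exact hσplot p hp
    · funext u; exact hsymm _
  · intro γ hγ t v
    constructor
    · rintro ⟨g, hg, hev, ξ, X, hξ, hX, hv⟩
      change v = ((((e (γ t)).1)⁻¹ * matrixDeriv (fun s => (e (γ s)).1) t) ^ 2).trace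
      have h1 : matrixDeriv (fun s => (e (γ s)).1) t = matrixDeriv (fun s => (f (g s)).1) t := by
        ext i j
        refine Filter.EventuallyEq.deriv_eq ?_
        filter_upwards [hev] with s hs
        rw [hs, he]
      rw [h1, hev.self_of_nhds, he, hspeed g hg t ξ X hξ hX, hv]
    · intro hv
      -- The speed on `G / K` is defined through some smooth lift; the section `σ` provides one. By
      -- `hspeed` the resulting value depends only on the image curve.
      have hg : DSmooth fun s => σ (e (γ s)) := hσsmooth.comp (he1.comp hγ)
      refine ⟨_, hg, Filter.Eventually.of_forall fun s => ?_, _, _, rfl, rfl, ?_⟩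
      · rw [← hsymm, Equiv.symm_apply_apply]
      · refine Eq.trans hv ?_
        rw [← hspeed _ hg t _ _ rfl rfl]
        simp only [hfσ]

end CosetIsometry

/-! ### Congruences and block decompositions of the loci -/

section Locus

variable {ι κ : Type*} [Fintype ι] [Fintype κ]

lemma congr_cancel [DecidableEq κ] {P : Matrix ι κ ℝ} {Y : Matrix κ ι ℝ} (hYP : Y * P = 1)
    (B : Matrix κ κ ℝ) : Y * (P * B * Pᵀ) * Yᵀ = B := by
  have h1 : Pᵀ * Yᵀ = 1 := by rw [← Matrix.transpose_mul, hYP, Matrix.transpose_one]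
  calc Y * (P * B * Pᵀ) * Yᵀ = (Y * P) * B * (Pᵀ * Yᵀ) := by simp only [Matrix.mul_assoc]
    _ = B := by rw [hYP, h1, Matrix.one_mul, Matrix.mul_one]

variable [DecidableEq ι]

lemma posDef_congr {P : Matrix ι κ ℝ} {Y : Matrix κ ι ℝ} (hPY : P * Y = 1) {B : Matrix κ κ ℝ}
    (hB : B.PosDef) : (P * B * Pᵀ).PosDef := by
  have := hB.mul_mul_conjTranspose_same (B := P) fun x y hxy => by
    have := congrArg (fun z => z ᵥ* Y) hxy
    simpa [Matrix.vecMul_vecMul, hPY] using this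
  simpa using this

variable [DecidableEq κ]

lemma isUnit_det_of_abs_eq_one {F : Matrix ι ι ℝ} (hF : |F.det| = 1) : IsUnit F.det := by
  rw [isUnit_iff_ne_zero]; rintro h; simp [h] at hF

lemma transpose_mul_dual {F : Matrix ι ι ℝ} (hF : IsUnit F.det) : Fᵀ * dual F = 1 :=
  Matrix.mul_nonsing_inv _ (Matrix.isUnit_det_transpose F hF)

lemma dual_mul_transpose {F : Matrix ι ι ℝ} (hF : IsUnit F.det) : dual F * Fᵀ = 1 :=
  Matrix.nonsing_inv_mul _ (Matrix.isUnit_det_transpose F hF)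

/-- The condition `det A = 1` is automatic. Taking determinants in `A F^∨ A = F` gives `(det A)² =
(det F)² = 1`, and `det A > 0`. -/
lemma mem_locus_iff {F : Matrix ι ι ℝ} (hF : |F.det| = 1) {A : Matrix ι ι ℝ} :
    A ∈ locus F ↔ A.PosDef ∧ A * dual F * A = F := by
  refine ⟨fun h => ⟨h.1.1, h.2⟩, fun h => ⟨⟨h.1, ?_⟩, h.2⟩⟩
  have h1 := congrArg Matrix.det (transpose_mul_dual (isUnit_det_of_abs_eq_one hF))
  have h2 := congrArg Matrix.det h.2
  rw [Matrix.det_mul, Matrix.det_transpose, Matrix.det_one] at h1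
  rw [Matrix.det_mul, Matrix.det_mul] at h2
  have h3 : F.det ^ 2 = 1 := by rw [← sq_abs, hF, one_pow]
  have h4 : A.det ^ 2 = 1 := by
    calc A.det ^ 2 = A.det ^ 2 * (F.det * (dual F).det) := by rw [h1, mul_one]
      _ = A.det * (dual F).det * A.det * F.det := by ring
      _ = 1 := by rw [h2, ← sq, h3]
  have h5 := h.1.det_pos
  nlinarith

/-- The matrix `F^∨` transforms contragrediently to `F`. Base changes are pairs `P`, `Y` of mutually
inverse matrices because the two index types may differ. -/
lemma dual_congr {F : Matrix ι ι ℝ} {D : Matrix κ κ ℝ} {P : Matrix ι κ ℝ} {Y : Matrix κ ι ℝ}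
    (hYP : Y * P = 1) (hPY : P * Y = 1) (hD : IsUnit D.det) (h : F = P * D * Pᵀ) :
    dual F = Yᵀ * dual D * Y := by
  refine Matrix.inv_eq_left_inv ?_
  have h1 : Yᵀ * Pᵀ = 1 := by rw [← Matrix.transpose_mul, hPY, Matrix.transpose_one]
  rw [h]
  simp only [Matrix.transpose_mul, Matrix.transpose_transpose]
  calc Yᵀ * dual D * Y * (P * (Dᵀ * Pᵀ)) = Yᵀ * (dual D * ((Y * P) * Dᵀ)) * Pᵀ := by
        simp only [Matrix.mul_assoc]
    _ = 1 := by rw [hYP, Matrix.one_mul, dual_mul_transpose hD, Matrix.mul_one, h1]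

lemma locus_equation_congr {F : Matrix ι ι ℝ} {D B : Matrix κ κ ℝ} {P : Matrix ι κ ℝ}
    {Y : Matrix κ ι ℝ} (hYP : Y * P = 1) (hPY : P * Y = 1) (hD : IsUnit D.det)
    (h : F = P * D * Pᵀ) :
    (P * B * Pᵀ) * dual F * (P * B * Pᵀ) = F ↔ B * dual D * B = D := by
  have h1 : Pᵀ * Yᵀ = 1 := by rw [← Matrix.transpose_mul, hYP, Matrix.transpose_one]
  have h2 : (P * B * Pᵀ) * dual F * (P * B * Pᵀ) = P * (B * dual D * B) * Pᵀ := by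
    rw [dual_congr hYP hPY hD h]
    calc P * B * Pᵀ * (Yᵀ * dual D * Y) * (P * B * Pᵀ)
        = P * B * (Pᵀ * Yᵀ) * dual D * (Y * P) * B * Pᵀ := by simp only [Matrix.mul_assoc]
      _ = _ := by rw [h1, hYP]; simp only [Matrix.mul_assoc, Matrix.mul_one]
  rw [h2, h]
  constructor
  · intro h3
    rw [← congr_cancel hYP (B * dual D * B), h3, congr_cancel hYP]
  · intro h3; rw [h3]

lemma mem_locus_congr_iff {F : Matrix ι ι ℝ} {D B : Matrix κ κ ℝ} {P : Matrix ι κ ℝ}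
    {Y : Matrix κ ι ℝ} (hYP : Y * P = 1) (hPY : P * Y = 1) (hF : |F.det| = 1)
    (hD : |D.det| = 1) (h : F = P * D * Pᵀ) : P * B * Pᵀ ∈ locus F ↔ B ∈ locus D := by
  rw [mem_locus_iff hF, mem_locus_iff hD,
    locus_equation_congr hYP hPY (isUnit_det_of_abs_eq_one hD) h]
  refine and_congr_left fun _ => ⟨fun h1 => ?_, posDef_congr hPY⟩
  rw [← congr_cancel hYP B]
  exact posDef_congr hYP h1

/-- The squared speed of a curve `P B P'`. -/
lemma trace_speed_congr {P : Matrix ι κ ℝ} {Y : Matrix κ ι ℝ} (hYP : Y * P = 1) (hPY : P * Y = 1)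
    {γ : ℝ → Matrix κ κ ℝ} {t : ℝ} (hγ : ∀ i j, DifferentiableAt ℝ (fun s => γ s i j) t)
    (hu : IsUnit (γ t).det) :
    (((P * γ t * Pᵀ)⁻¹ * matrixDeriv (fun s => P * γ s * Pᵀ) t) ^ 2).trace
      = (((γ t)⁻¹ * matrixDeriv γ t) ^ 2).trace := by
  have h0 : Yᵀ * Pᵀ = 1 := by rw [← Matrix.transpose_mul, hPY, Matrix.transpose_one]
  have h0' : Pᵀ * Yᵀ = 1 := by rw [← Matrix.transpose_mul, hYP, Matrix.transpose_one]
  have h1 : matrixDeriv (fun s => P * γ s * Pᵀ) t = P * matrixDeriv γ t * Pᵀ :=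
    matrixDeriv_linearMap
      ({ toFun := fun X => P * X * Pᵀ
         map_add' := fun X Z => by rw [Matrix.mul_add, Matrix.add_mul]
         map_smul' := fun c X => by simp } : Matrix κ κ ℝ →ₗ[ℝ] Matrix ι ι ℝ) hγ
  have h2 : (P * γ t * Pᵀ)⁻¹ = Yᵀ * (γ t)⁻¹ * Y := by
    refine Matrix.inv_eq_left_inv ?_
    calc Yᵀ * (γ t)⁻¹ * Y * (P * γ t * Pᵀ) = Yᵀ * ((γ t)⁻¹ * ((Y * P) * γ t)) * Pᵀ := by
          simp only [Matrix.mul_assoc]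
      _ = 1 := by rw [hYP, Matrix.one_mul, Matrix.nonsing_inv_mul _ hu, Matrix.mul_one, h0]
  rw [h1, h2]
  set Z := matrixDeriv γ t
  set W := (γ t)⁻¹
  have h3 : Yᵀ * W * Y * (P * Z * Pᵀ) = Yᵀ * (W * Z) * Pᵀ := by
    calc Yᵀ * W * Y * (P * Z * Pᵀ) = Yᵀ * W * (Y * P) * Z * Pᵀ := by simp only [Matrix.mul_assoc]
      _ = _ := by rw [hYP]; simp only [Matrix.mul_assoc, Matrix.one_mul]
  rw [h3, sq, sq]
  calc (Yᵀ * (W * Z) * Pᵀ * (Yᵀ * (W * Z) * Pᵀ)).trace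
      = (Yᵀ * ((W * Z) * (Pᵀ * Yᵀ) * (W * Z) * Pᵀ)).trace := by simp only [Matrix.mul_assoc]
    _ = _ := by
      rw [h0', Matrix.mul_one, Matrix.trace_mul_comm, Matrix.mul_assoc, h0', Matrix.mul_one]

lemma isUnit_det_of_mem_locus {F A : Matrix ι ι ℝ} (hA : A ∈ locus F) : IsUnit A.det := by
  rw [hA.1.2]; exact isUnit_one

lemma differentiableAt_locus_curve {F : Matrix ι ι ℝ} {γ : ℝ → locus F} (hγ : DSmooth γ) (t : ℝ)
    (i j : ι) : DifferentiableAt ℝ (fun s => (γ s : Matrix ι ι ℝ) i j) t :=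
  (contDiff_locus_curve hγ i j).differentiable (by simp) t

/-- Under `A = P B P'` the matrix `A⁻¹ dA` is a conjugate of `B⁻¹ dB`, so the metric is unchanged.
This permits replacing a form by its normal form. -/
theorem exists_isometry_locus_congr {F : Matrix ι ι ℝ} {D : Matrix κ κ ℝ} {P : Matrix ι κ ℝ}
    {Y : Matrix κ ι ℝ} (hYP : Y * P = 1) (hPY : P * Y = 1) (hF : |F.det| = 1)
    (hD : |D.det| = 1) (h : F = P * D * Pᵀ) :
    ∃ e : locus D ≃ locus F, IsRiemannianIsometry e := by
  let e : locus D ≃ locus F :=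
    { toFun := fun B => ⟨P * B.1 * Pᵀ, (mem_locus_congr_iff hYP hPY hF hD h).2 B.2⟩
      invFun := fun A => ⟨Y * A.1 * Yᵀ, by
        rw [← mem_locus_congr_iff hYP hPY hF hD h, congr_cancel hPY]; exact A.2⟩
      left_inv := fun B => Subtype.ext (congr_cancel hYP _)
      right_inv := fun A => Subtype.ext (congr_cancel hPY _) }
  refine ⟨e, fun n p hp => ?_, fun n p hp => ?_, fun γ hγ t v => ?_⟩
  · exact contDiff_matrix_mul (contDiff_matrix_mul (fun _ _ => contDiff_const) hp)
      (fun _ _ => contDiff_const)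
  · exact contDiff_matrix_mul (contDiff_matrix_mul (fun _ _ => contDiff_const) hp)
      (fun _ _ => contDiff_const)
  · have := trace_speed_congr hYP hPY (differentiableAt_locus_curve hγ t)
      (isUnit_det_of_mem_locus (γ t).2)
    exact ⟨fun hv => Eq.trans hv this.symm, fun hv => Eq.trans hv this⟩

end Locus

/-! ### Block diagonal forms and Riemannian products of loci -/

section Blocks

variable {o : Type*} [Fintype o] [DecidableEq o] {m : o → Type*} [∀ k, Fintype (m k)]

lemma blockDiagonal'_posDef_iff {M : ∀ k, Matrix (m k) (m k) ℝ} :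
    (Matrix.blockDiagonal' M).PosDef ↔ ∀ k, (M k).PosDef := by
  constructor
  · intro h k
    have := h.submatrix (e := fun i : m k => (⟨k, i⟩ : Σ k, m k)) fun i j hij => by simpa using hij
    convert! this using 1
    ext i j
    simp [Matrix.blockDiagonal'_apply_eq]
  · intro h
    refine Matrix.PosDef.of_dotProduct_mulVec_pos ?_ fun x hx => ?_
    · exact Matrix.isHermitian_blockDiagonal'_iff.2 fun k => (h k).isHermitian
    · have e : star x ⬝ᵥ (Matrix.blockDiagonal' M *ᵥ x)
          = ∑ k, star (fun i => x ⟨k, i⟩) ⬝ᵥ (M k *ᵥ fun i => x ⟨k, i⟩) := by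
        simp only [dotProduct, Fintype.sum_sigma]
        refine Finset.sum_congr rfl fun k _ => Finset.sum_congr rfl fun i _ => ?_
        congr 1
        simp only [Matrix.mulVec, dotProduct, Fintype.sum_sigma]
        rw [Finset.sum_eq_single k]
        · simp [Matrix.blockDiagonal'_apply_eq]
        · intro l _ hl
          exact Finset.sum_eq_zero fun j _ => by
            rw [Matrix.blockDiagonal'_apply_ne _ _ _ hl.symm, zero_mul]
        · simp
      rw [e]
      obtain ⟨⟨k, i⟩, hki⟩ := Function.ne_iff.1 hx
      refine Finset.sum_pos' (fun l _ => (h l).posSemidef.dotProduct_mulVec_nonneg _)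
        ⟨k, Finset.mem_univ _, (h k).dotProduct_mulVec_pos ?_⟩
      intro h0
      exact hki (congrFun h0 i)

variable [∀ k, DecidableEq (m k)]

lemma det_blockDiagonal' {R : Type*} [CommRing R] (M : ∀ k, Matrix (m k) (m k) R) :
    (Matrix.blockDiagonal' M).det = ∏ k, (M k).det := by
  classical
  -- An arbitrary linear order on the set of blocks turns block diagonal into block triangular.
  obtain ⟨f⟩ := Fintype.truncEquivFin o |>.nonempty
  let : LinearOrder o := LinearOrder.lift' f f.injective
  have h : (Matrix.blockDiagonal' M).BlockTriangular Sigma.fst := by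
    intro i j hij
    obtain ⟨i1, i2⟩ := i
    obtain ⟨j1, j2⟩ := j
    exact Matrix.blockDiagonal'_apply_ne M i2 j2 (ne_of_gt hij)
  rw [h.det_fintype]
  refine Finset.prod_congr rfl fun k _ => ?_
  let e : m k ≃ {x : Σ k, m k // x.1 = k} :=
    { toFun := fun i => ⟨⟨k, i⟩, rfl⟩
      invFun := fun x => x.2 ▸ x.1.2
      left_inv := fun i => rfl
      right_inv := by rintro ⟨⟨k', i⟩, rfl⟩; rfl }
  rw [← Matrix.det_submatrix_equiv_self e]
  congr 1
  ext i j
  simp [Matrix.toSquareBlock_def, e, Matrix.blockDiagonal'_apply_eq]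

lemma charpoly_blockDiagonal' {R : Type*} [CommRing R] (M : ∀ k, Matrix (m k) (m k) R) :
    (Matrix.blockDiagonal' M).charpoly = ∏ k, (M k).charpoly := by
  have : (Matrix.blockDiagonal' M).charmatrix =
      Matrix.blockDiagonal' fun k => (M k).charmatrix := by
    ext ⟨k, i⟩ ⟨l, j⟩
    by_cases h : k = l
    · subst h
      by_cases hij : i = j
      · subst hij; simp [Matrix.charmatrix_apply_eq, Matrix.blockDiagonal'_apply_eq]
      · rw [Matrix.charmatrix_apply_ne _ _ _ (by simpa using hij)]
        simp [Matrix.charmatrix_apply_ne _ _ _ hij, Matrix.blockDiagonal'_apply_eq]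
    · rw [Matrix.charmatrix_apply_ne _ _ _ (by simp [h]), Matrix.blockDiagonal'_apply_ne _ _ _ h,
        Matrix.blockDiagonal'_apply_ne _ _ _ h]
      simp
  rw [Matrix.charpoly, this, det_blockDiagonal']
  rfl

lemma isUnit_det_blockDiagonal' {M : ∀ k, Matrix (m k) (m k) ℝ} (h : ∀ k, IsUnit (M k).det) :
    IsUnit (Matrix.blockDiagonal' M).det := by
  rw [det_blockDiagonal', isUnit_iff_ne_zero]
  exact Finset.prod_ne_zero_iff.2 fun k _ => (h k).ne_zero

lemma inv_blockDiagonal' {M : ∀ k, Matrix (m k) (m k) ℝ} (h : ∀ k, IsUnit (M k).det) :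
    (Matrix.blockDiagonal' M)⁻¹ = Matrix.blockDiagonal' fun k => (M k)⁻¹ := by
  refine Matrix.inv_eq_left_inv ?_
  rw [← Matrix.blockDiagonal'_mul, ← Matrix.blockDiagonal'_one]
  congr 1
  funext k
  exact Matrix.nonsing_inv_mul _ (h k)

lemma dual_blockDiagonal' {M : ∀ k, Matrix (m k) (m k) ℝ} (h : ∀ k, IsUnit (M k).det) :
    dual (Matrix.blockDiagonal' M) = Matrix.blockDiagonal' fun k => dual (M k) := by
  rw [dual, Matrix.blockDiagonal'_transpose,
    inv_blockDiagonal' fun k => Matrix.isUnit_det_transpose _ (h k)]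
  rfl

lemma trace_speed_blockDiagonal' {γ : ∀ k, ℝ → Matrix (m k) (m k) ℝ} {t : ℝ}
    (hu : ∀ k, IsUnit (γ k t).det) :
    (((Matrix.blockDiagonal' fun k => γ k t)⁻¹
      * matrixDeriv (fun s => Matrix.blockDiagonal' fun k => γ k s) t) ^ 2).trace
      = ∑ k, (((γ k t)⁻¹ * matrixDeriv (γ k) t) ^ 2).trace := by
  have h1 : matrixDeriv (fun s => Matrix.blockDiagonal' fun k => γ k s) t
      = Matrix.blockDiagonal' fun k => matrixDeriv (γ k) t := by
    ext ⟨k, i⟩ ⟨l, j⟩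
    rw [matrixDeriv_apply]
    by_cases h : k = l
    · subst h
      simp [Matrix.blockDiagonal'_apply_eq, matrixDeriv_apply]
    · simp [Matrix.blockDiagonal'_apply_ne _ _ _ h]
  rw [h1, inv_blockDiagonal' hu, ← Matrix.blockDiagonal'_mul, sq, ← Matrix.blockDiagonal'_mul,
    Matrix.trace_blockDiagonal']
  simp only [sq]

/-- If `F` is congruent to a block diagonal matrix and the elements of `V_F` respect the blocks,
then `V_F` is the Riemannian product of the loci of the blocks. -/
theorem exists_isometry_locus_blocks {ι : Type*} [Fintype ι] [DecidableEq ι] {F : Matrix ι ι ℝ}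
    {G : ∀ k, Matrix (m k) (m k) ℝ} {P : Matrix ι (Σ k, m k) ℝ} {Y : Matrix (Σ k, m k) ι ℝ}
    (hYP : Y * P = 1) (hPY : P * Y = 1) (hF : |F.det| = 1) (hG : ∀ k, |(G k).det| = 1)
    (h : F = P * Matrix.blockDiagonal' G * Pᵀ)
    (hblock : ∀ A ∈ locus F, ∃ B : ∀ k, Matrix (m k) (m k) ℝ,
      A = P * Matrix.blockDiagonal' B * Pᵀ) :
    ∃ e : locus F ≃ ∀ k, locus (G k),
      (∀ A : locus F, (A : Matrix ι ι ℝ) =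
        P * Matrix.blockDiagonal' (fun k => (e A k : Matrix (m k) (m k) ℝ)) * Pᵀ) ∧
      IsRiemannianIsometry e := by
  have hGu : ∀ k, IsUnit (G k).det := fun k => isUnit_det_of_abs_eq_one (hG k)
  have hmem : ∀ B : ∀ k, Matrix (m k) (m k) ℝ,
      P * Matrix.blockDiagonal' B * Pᵀ ∈ locus F ↔ ∀ k, B k ∈ locus (G k) := by
    intro B
    simp only [mem_locus_iff hF, mem_locus_iff (hG _)]
    rw [locus_equation_congr hYP hPY (isUnit_det_blockDiagonal' hGu) h, dual_blockDiagonal' hGu,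
      ← Matrix.blockDiagonal'_mul, ← Matrix.blockDiagonal'_mul, Matrix.blockDiagonal'_inj,
      forall_and, funext_iff, ← blockDiagonal'_posDef_iff]
    refine and_congr_left fun _ => ⟨fun h1 => ?_, posDef_congr hPY⟩
    rw [← congr_cancel hYP (Matrix.blockDiagonal' B)]
    exact posDef_congr hYP h1
  -- Reading off diagonal blocks loses nothing on `V_F`: by `hblock` the off-diagonal ones vanish.
  let blk : Matrix ι ι ℝ → ∀ k, Matrix (m k) (m k) ℝ := fun A k =>
    Matrix.blockDiag' (Y * A * Yᵀ) k
  have hblk : ∀ A ∈ locus F, P * Matrix.blockDiagonal' (blk A) * Pᵀ = A := by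
    intro A hA
    obtain ⟨B, hB⟩ := hblock A hA
    have : blk A = B := by
      funext k
      simp only [blk]
      rw [hB, congr_cancel hYP, Matrix.blockDiag'_blockDiagonal']
    rw [this, ← hB]
  have hblk' : ∀ B, blk (P * Matrix.blockDiagonal' B * Pᵀ) = B := by
    intro B
    funext k
    simp only [blk]
    rw [congr_cancel hYP, Matrix.blockDiag'_blockDiagonal']
  let e : locus F ≃ ∀ k, locus (G k) :=
    { toFun := fun A k => ⟨blk A k, (hmem (blk A)).1 (by rw [hblk A A.2]; exact A.2) k⟩
      invFun := fun B => ⟨P * Matrix.blockDiagonal' (fun k => (B k).1) * Pᵀ,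
        (hmem _).2 fun k => (B k).2⟩
      left_inv := fun A => Subtype.ext (hblk A A.2)
      right_inv := fun B => funext fun k => Subtype.ext (congrFun (hblk' _) k) }
  have he : IsRiemannianIsometry e.symm := by
    have h1 : DSmooth e.symm := by
      intro n p hp
      refine contDiff_matrix_mul (contDiff_matrix_mul (fun _ _ => contDiff_const) ?_)
        (fun _ _ => contDiff_const)
      rintro ⟨k, i⟩ ⟨l, j⟩
      by_cases hkl : k = l
      · subst hkl
        simp only [Matrix.blockDiagonal'_apply_eq]
        exact hp k i j
      · simp only [Matrix.blockDiagonal'_apply_ne _ _ _ hkl]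
        exact contDiff_const
    refine ⟨h1, ?_, ?_⟩
    · intro n p hp k i j
      have h1 : ∀ a b, ContDiff ℝ ∞ fun u => (Y * (p u).1 * Yᵀ) a b :=
        contDiff_matrix_mul (contDiff_matrix_mul (fun _ _ => contDiff_const) hp)
          (fun _ _ => contDiff_const)
      exact h1 ⟨k, i⟩ ⟨k, j⟩
    · intro γ hγ t v
      have hk : ∀ k, DSmooth fun s => γ s k := fun k n p hp => hγ n p hp k
      have hdiff : ∀ i j, DifferentiableAt ℝ
          (fun s => Matrix.blockDiagonal' (fun k => (γ s k).1) i j) t := by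
        rintro ⟨k, i⟩ ⟨l, j⟩
        by_cases hkl : k = l
        · subst hkl
          simp only [Matrix.blockDiagonal'_apply_eq]
          exact differentiableAt_locus_curve (hk k) t i j
        · simp only [Matrix.blockDiagonal'_apply_ne _ _ _ hkl]
          exact differentiableAt_const _
      have hu : ∀ k, IsUnit (γ t k).1.det := fun k => isUnit_det_of_mem_locus (γ t k).2
      have key := (trace_speed_congr hYP hPY hdiff (isUnit_det_blockDiagonal' hu)).trans
        (trace_speed_blockDiagonal' (γ := fun k s => (γ s k).1) hu)
      constructor
      · rintro ⟨w, hw, rfl⟩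
        refine Eq.trans ?_ key.symm
        exact Finset.sum_congr rfl fun k _ => hw k
      · intro hv
        exact ⟨_, fun k => rfl, Eq.trans hv key⟩
  exact ⟨e, fun A => (hblk A A.2).symm, he.symm⟩

end Blocks

/-! ### Normal forms -/

section NormalForms

variable {ι κ μ ν : Type*}

lemma diagI_eq (𝕜 : Type*) [RCLike 𝕜] (p q : ℕ) :
    diagI 𝕜 p q = Matrix.diagonal (Sum.elim (fun _ => 1) fun _ => -1) := rfl

lemma diagI_mul_self (𝕜 : Type*) [RCLike 𝕜] (p q : ℕ) : diagI 𝕜 p q * diagI 𝕜 p q = 1 := by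
  rw [diagI_eq, Matrix.diagonal_mul_diagonal,
    ← Matrix.diagonal_one]
  congr 1
  funext i
  cases i <;> simp

lemma diagI_conjTranspose (𝕜 : Type*) [RCLike 𝕜] (p q : ℕ) : (diagI 𝕜 p q)ᴴ = diagI 𝕜 p q := by
  rw [diagI_eq, Matrix.diagonal_conjTranspose]
  congr 1
  funext i
  cases i <;> simp

/-- Sylvester's law of inertia (existence) for Hermitian matrices. -/
lemma exists_congr_diagI {𝕜 : Type*} [RCLike 𝕜] [Fintype ι] [DecidableEq ι] {H : Matrix ι ι 𝕜}
    (hH : H.IsHermitian) (hu : IsUnit H.det) :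
    ∃ p q : ℕ, p + q = Fintype.card ι ∧ ∃ (M : Matrix ι (Fin p ⊕ Fin q) 𝕜)
      (Y : Matrix (Fin p ⊕ Fin q) ι 𝕜), Y * M = 1 ∧ M * Y = 1 ∧ H = M * diagI 𝕜 p q * Mᴴ := by
  set l := hH.eigenvalues with hl
  have hl0 : ∀ i, l i ≠ 0 := by
    intro i hi
    rw [hH.det_eq_prod_eigenvalues] at hu
    refine hu.ne_zero (Finset.prod_eq_zero (Finset.mem_univ i) ?_)
    rw [← hl, hi, RCLike.ofReal_zero]
  let p := Fintype.card {i // 0 < l i}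
  let q := Fintype.card {i // ¬ 0 < l i}
  let e : Fin p ⊕ Fin q ≃ ι :=
    (Equiv.sumCongr (Fintype.equivFin {i // 0 < l i}).symm
      (Fintype.equivFin {i // ¬ 0 < l i}).symm).trans (Equiv.sumCompl fun i => 0 < l i)
  -- Rescaling the eigenvectors by `√|l i|` reduces each eigenvalue to its sign, and `e` puts the
  -- positive ones first.
  let r : Matrix ι ι 𝕜 := Matrix.diagonal fun i => ((√|l i| : ℝ) : 𝕜)
  let r' : Matrix ι ι 𝕜 := Matrix.diagonal fun i => (((√|l i|)⁻¹ : ℝ) : 𝕜)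
  have hr0 : ∀ i, √|l i| ≠ 0 := fun i => (Real.sqrt_pos.2 (abs_pos.2 (hl0 i))).ne'
  have hr : r * r' = 1 := by
    rw [Matrix.diagonal_mul_diagonal, ← Matrix.diagonal_one]
    congr 1; funext i
    rw [← RCLike.ofReal_mul, mul_inv_cancel₀ (hr0 i), RCLike.ofReal_one]
  let U : Matrix ι ι 𝕜 := hH.eigenvectorUnitary
  have hU : U * Uᴴ = 1 := Unitary.coe_mul_star_self hH.eigenvectorUnitary
  have hD : (diagI 𝕜 p q).submatrix e.symm e.symm
      = Matrix.diagonal fun i => ((SignType.sign (l i) : ℝ) : 𝕜) := by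
    rw [diagI_eq, Matrix.submatrix_diagonal_equiv]
    congr 1; funext i
    obtain ⟨x, rfl⟩ := e.surjective i
    rw [Function.comp_apply, Equiv.symm_apply_apply]
    cases x with
    | inl x =>
      have : 0 < l (e (Sum.inl x)) := ((Fintype.equivFin {i // 0 < l i}).symm x).2
      simp [sign_pos this]
    | inr x =>
      have : ¬ 0 < l (e (Sum.inr x)) := ((Fintype.equivFin {i // ¬ 0 < l i}).symm x).2
      have : l (e (Sum.inr x)) < 0 := lt_of_le_of_ne (not_lt.1 this) (hl0 _)
      simp [sign_neg this]
  have hrh : rᴴ = r := by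
    rw [Matrix.diagonal_conjTranspose]; congr 1; funext i; simp
  have hsplit : Matrix.diagonal (RCLike.ofReal ∘ l : ι → 𝕜)
      = r * (diagI 𝕜 p q).submatrix e.symm e.symm * r := by
    rw [hD, Matrix.diagonal_mul_diagonal, Matrix.diagonal_mul_diagonal]
    congr 1; funext i
    simp only [Function.comp_apply, ← RCLike.ofReal_mul]
    congr 1
    rw [mul_right_comm, Real.mul_self_sqrt (abs_nonneg _), abs_mul_sign]
  have hspec : H = U * Matrix.diagonal (RCLike.ofReal ∘ l : ι → 𝕜) * Uᴴ := by
    conv_lhs => rw [hH.spectral_theorem, Unitary.conjStarAlgAut_apply]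
    rfl
  have hcard : p + q = Fintype.card ι := by
    rw [← Fintype.card_congr e, Fintype.card_sum, Fintype.card_fin, Fintype.card_fin]
  have hU' : Uᴴ * U = 1 := mul_eq_one_comm.1 hU
  have hr' : r' * r = 1 := mul_eq_one_comm.1 hr
  refine ⟨p, q, hcard, (U * r).submatrix id e, (r' * Uᴴ).submatrix e id, ?_, ?_, ?_⟩
  · rw [← Matrix.submatrix_mul _ _ _ _ _ Function.bijective_id,
      Matrix.mul_assoc, ← Matrix.mul_assoc Uᴴ, hU', Matrix.one_mul, hr', Matrix.submatrix_one_equiv]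
  · rw [← Matrix.submatrix_mul _ _ _ _ _ e.bijective, Matrix.mul_assoc, ← Matrix.mul_assoc r,
      hr, Matrix.one_mul, hU, Matrix.submatrix_id_id]
  · have h1 : diagI 𝕜 p q = ((diagI 𝕜 p q).submatrix e.symm e.symm).submatrix e e := by
      simp
    rw [h1, Matrix.conjTranspose_submatrix, ← Matrix.submatrix_mul _ _ _ _ _ e.bijective,
      ← Matrix.submatrix_mul _ _ _ _ _ e.bijective, Matrix.submatrix_id_id,
      Matrix.conjTranspose_mul, hrh, hspec, hsplit]
    simp only [Matrix.mul_assoc]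

/-- The real matrix of a complex matrix. -/
def toReal (B : Matrix ι κ ℂ) : Matrix (ι ⊕ ι) (κ ⊕ κ) ℝ :=
  Matrix.fromBlocks (B.map Complex.re) (-B.map Complex.im) (B.map Complex.im) (B.map Complex.re)

lemma toReal_mul [Fintype κ] (A : Matrix ι κ ℂ) (B : Matrix κ μ ℂ) :
    toReal (A * B) = toReal A * toReal B := by
  ext (i | i) (j | j) <;>
    simp [toReal, Matrix.mul_apply, Fintype.sum_sum_type, Finset.sum_add_distrib,
      sub_eq_add_neg, add_comm]

lemma toReal_one [DecidableEq ι] : toReal (1 : Matrix ι ι ℂ) = 1 := by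
  ext (i | i) (j | j) <;> by_cases h : i = j <;> simp [toReal, Matrix.one_apply, h]

lemma toReal_conjTranspose (B : Matrix ι κ ℂ) : toReal Bᴴ = (toReal B)ᵀ := by
  ext (i | i) (j | j) <;> simp [toReal]

lemma toReal_add (A B : Matrix ι κ ℂ) : toReal (A + B) = toReal A + toReal B := by
  ext (i | i) (j | j) <;> simp [toReal, add_comm]

lemma toReal_smul (c : ℝ) (A : Matrix ι κ ℂ) : toReal ((c : ℂ) • A) = c • toReal A := by
  ext (i | i) (j | j) <;> simp [toReal]

lemma toReal_injective : Function.Injective (toReal : Matrix ι κ ℂ → _) := by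
  intro A B h
  ext i j
  refine Complex.ext ?_ ?_
  · simpa [toReal] using congrFun (congrFun h (Sum.inl i)) (Sum.inl j)
  · simpa [toReal] using congrFun (congrFun h (Sum.inr i)) (Sum.inl j)

variable (ι) in
/-- `toReal` as a homomorphism of real algebras. -/
def toRealHom [Fintype ι] [DecidableEq ι] : Matrix ι ι ℂ →ₐ[ℝ] Matrix (ι ⊕ ι) (ι ⊕ ι) ℝ :=
  AlgHom.ofLinearMap
    { toFun := toReal
      map_add' := toReal_add
      map_smul' := fun c A => by
        rw [RingHom.id_apply, ← toReal_smul]; congr 1 }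
    toReal_one toReal_mul

lemma toReal_I_smul [DecidableEq ι] : toReal (Complex.I • (1 : Matrix ι ι ℂ)) = Matrix.J ι ℝ := by
  ext (i | i) (j | j) <;> by_cases h : i = j <;> simp [toReal, Matrix.J, h]

/-- The matrices that commute with the complex structure are complex matrices. -/
lemma exists_toReal_of_commute [Fintype ι] [DecidableEq ι] {A : Matrix (ι ⊕ ι) (ι ⊕ ι) ℝ}
    (h : A * Matrix.J ι ℝ = Matrix.J ι ℝ * A) : ∃ B, A = toReal B := by
  obtain ⟨a, b, c, d, rfl⟩ : ∃ a b c d, A = Matrix.fromBlocks a b c d :=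
    ⟨_, _, _, _, (Matrix.fromBlocks_toBlocks A).symm⟩
  simp only [Matrix.J, Matrix.fromBlocks_multiply, Matrix.fromBlocks_inj, Matrix.mul_zero,
    Matrix.zero_mul, Matrix.mul_one, Matrix.one_mul, Matrix.mul_neg, Matrix.neg_mul,
    zero_add, add_zero] at h
  obtain ⟨h1, h2, h3, h4⟩ := h
  refine ⟨Matrix.of fun i j => ⟨a i j, c i j⟩, ?_⟩
  ext (i | i) (j | j) <;> simp [toReal, h1, h3]

lemma trace_toReal [Fintype ι] (B : Matrix ι ι ℂ) : (toReal B).trace = 2 * B.trace.re := by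
  simp [toReal, Matrix.trace, Fintype.sum_sum_type, two_mul]

/-- A complex structure has a matrix `J` in some basis. -/
lemma exists_basis_complexStructure [Fintype ι] [DecidableEq ι] {j : Matrix ι ι ℝ}
    (hj : j * j = -1) :
    ∃ (m : ℕ) (Q : Matrix ι (Fin m ⊕ Fin m) ℝ) (Z : Matrix (Fin m ⊕ Fin m) ι ℝ),
      2 * m = Fintype.card ι ∧ Q * Z = 1 ∧ Z * Q = 1 ∧ j * Q = Q * Matrix.J (Fin m) ℝ := by
  have hJ : Matrix.toLin' j * Matrix.toLin' j = -1 := by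
    rw [Module.End.mul_eq_comp, ← Matrix.toLin'_mul, hj, map_neg, Matrix.toLin'_one]
    rfl
  -- The algebra map sending `i` to `j` makes `ℝ^ι` a complex vector space. A complex basis `b`
  -- yields the real basis consisting of the `b k` followed by the `j b k`, in which `j` has matrix
  -- `J`.
  let φ : ℂ →ₐ[ℝ] Module.End ℝ (ι → ℝ) := Complex.liftAux (Matrix.toLin' j) hJ
  let _ : Module ℂ (ι → ℝ) := Module.compHom _ φ.toRingHom
  have hsmul : ∀ (z : ℂ) (v : ι → ℝ), z • v = φ z v := fun _ _ => rfl
  have : IsScalarTower ℝ ℂ (ι → ℝ) := ⟨fun r z v => by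
    rw [hsmul, hsmul, map_smul, LinearMap.smul_apply]⟩
  have : Module.Finite ℂ (ι → ℝ) := Module.Finite.of_restrictScalars_finite ℝ ℂ (ι → ℝ)
  let b := Module.finBasis ℂ (ι → ℝ)
  set m := Module.finrank ℂ (ι → ℝ)
  let c : Module.Basis (Fin m ⊕ Fin m) ℝ (ι → ℝ) :=
    (Complex.basisOneI.smulTower b).reindex
      ((finTwoEquiv.prodCongr (Equiv.refl (Fin m))).trans (Equiv.boolProdEquivSum (Fin m)))
  have hcl : ∀ k, c (Sum.inl k) = b k := by
    intro k
    simp [c, Module.Basis.smulTower_apply, finTwoEquiv]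
  have hcr : ∀ k, c (Sum.inr k) = j *ᵥ b k := by
    intro k
    simp [c, Module.Basis.smulTower_apply, hsmul, φ, finTwoEquiv]
  let Q : Matrix ι (Fin m ⊕ Fin m) ℝ := (Pi.basisFun ℝ ι).toMatrix c
  have hQ : ∀ i k, Q i k = c k i := fun i k => by simp [Q, Module.Basis.toMatrix_apply]
  refine ⟨m, Q, c.toMatrix (Pi.basisFun ℝ ι), ?_, ?_, ?_, ?_⟩
  · rw [← Complex.finrank_real_complex, Module.finrank_mul_finrank ℝ ℂ (ι → ℝ),
      Module.finrank_fintype_fun_eq_card]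
  · exact Module.Basis.toMatrix_mul_toMatrix_flip _ _
  · exact Module.Basis.toMatrix_mul_toMatrix_flip _ _
  · have h1 : ∀ k, Q *ᵥ (Pi.single k 1) = c k := fun k => by
      ext i; simp [hQ]
    have hQl : ∀ i k, (j * Q) i k = (j *ᵥ c k) i := fun i k => by
      simp [Matrix.mul_apply, Matrix.mulVec, dotProduct, hQ]
    ext i (k | k)
    · rw [hQl, hcl]
      simp [Matrix.mul_apply, Matrix.J, Fintype.sum_sum_type, hQ, hcr, Matrix.one_apply]
    · rw [hQl, hcr, Matrix.mulVec_mulVec, hj, Matrix.neg_mulVec, Matrix.one_mulVec]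
      simp [Matrix.mul_apply, Matrix.J, Fintype.sum_sum_type, hQ, hcl, Matrix.one_apply]

/-- Normal form of a symmetric bilinear form that is preserved by a complex structure. -/
lemma exists_congr_toReal_diagI [Fintype ι] [DecidableEq ι] {j H : Matrix ι ι ℝ}
    (hj : j * j = -1) (hH : Hᵀ = H) (hu : IsUnit H.det) (hjH : jᵀ * H * j = H) :
    ∃ p q : ℕ, 2 * (p + q) = Fintype.card ι ∧
      ∃ (M : Matrix ι ((Fin p ⊕ Fin q) ⊕ (Fin p ⊕ Fin q)) ℝ)
        (Y : Matrix ((Fin p ⊕ Fin q) ⊕ (Fin p ⊕ Fin q)) ι ℝ), Y * M = 1 ∧ M * Y = 1 ∧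
        H = M * toReal (diagI ℂ p q) * Mᵀ ∧ Mᵀ * j = Matrix.J (Fin p ⊕ Fin q) ℝ * Mᵀ := by
  obtain ⟨m, Q, Z, hm, hQZ, hZQ, hjQ⟩ := exists_basis_complexStructure hj
  have hQZt : Zᵀ * Qᵀ = 1 := by rw [← Matrix.transpose_mul, hQZ, Matrix.transpose_one]
  have hZQt : Qᵀ * Zᵀ = 1 := by rw [← Matrix.transpose_mul, hZQ, Matrix.transpose_one]
  set H₀ := Qᵀ * H * Q with hH₀
  have hback : H = Zᵀ * H₀ * Z := by
    calc H = (Zᵀ * Qᵀ) * H * (Q * Z) := by rw [hQZt, hQZ, Matrix.one_mul, Matrix.mul_one]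
      _ = _ := by rw [hH₀]; simp only [Matrix.mul_assoc]
  have hJJ : (Matrix.J (Fin m) ℝ)ᵀ * H₀ * Matrix.J (Fin m) ℝ = H₀ := by
    calc _ = (Q * Matrix.J (Fin m) ℝ)ᵀ * H * (Q * Matrix.J (Fin m) ℝ) := by
          rw [hH₀, Matrix.transpose_mul]; simp only [Matrix.mul_assoc]
      _ = Qᵀ * (jᵀ * H * j) * Q := by
          rw [← hjQ, Matrix.transpose_mul]; simp only [Matrix.mul_assoc]
      _ = H₀ := by rw [hjH]
  -- Since `J' = -J` and `J² = -1`, preserving the form `H₀` is the same as commuting with it. Hence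
  -- `H₀` is the real matrix of a complex one, and its symmetry makes that one Hermitian.
  have hcomm : H₀ * Matrix.J (Fin m) ℝ = Matrix.J (Fin m) ℝ * H₀ := by
    rw [Matrix.J_transpose] at hJJ
    calc H₀ * Matrix.J (Fin m) ℝ
        = -(Matrix.J (Fin m) ℝ * Matrix.J (Fin m) ℝ) * (H₀ * Matrix.J (Fin m) ℝ) := by
          rw [Matrix.J_squared, neg_neg, Matrix.one_mul]
      _ = Matrix.J (Fin m) ℝ * (-Matrix.J (Fin m) ℝ * H₀ * Matrix.J (Fin m) ℝ) := by
          simp only [Matrix.mul_assoc, Matrix.neg_mul, Matrix.mul_neg]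
      _ = _ := by rw [hJJ]
  obtain ⟨h, hh⟩ := exists_toReal_of_commute hcomm
  have hherm : h.IsHermitian := by
    refine toReal_injective ?_
    rw [toReal_conjTranspose, ← hh, hH₀]
    simp only [Matrix.transpose_mul, Matrix.transpose_transpose, hH, Matrix.mul_assoc]
  have hunit : IsUnit h.det := by
    let L := toReal h
    have hHi : H * H⁻¹ = 1 := Matrix.mul_nonsing_inv _ hu
    have h1 : H₀ * (Z * H⁻¹ * Zᵀ) = 1 := by
      calc H₀ * (Z * H⁻¹ * Zᵀ) = Qᵀ * (H * ((Q * Z) * H⁻¹)) * Zᵀ := by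
            rw [hH₀]; simp only [Matrix.mul_assoc]
        _ = 1 := by rw [hQZ, Matrix.one_mul, hHi, Matrix.mul_one, hZQt]
    by_contra hn
    rw [isUnit_iff_ne_zero, not_not] at hn
    -- A kernel vector of `h`, viewed as a one-column matrix, would give real columns annihilated by
    -- the invertible `H₀`.
    obtain ⟨w, hw, hw0⟩ := Matrix.exists_mulVec_eq_zero_iff.2 hn
    let W : Matrix (Fin m) Unit ℂ := Matrix.of fun i _ => w i
    have hW : h * W = 0 := by
      ext i _
      exact congrFun hw0 i
    have hW2 : H₀ * toReal W = 0 := by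
      rw [hh, ← toReal_mul, hW]
      ext (i | i) (k | k) <;> simp [toReal]
    have hW3 : toReal W = 0 := by
      rw [← Matrix.one_mul (toReal W), ← mul_eq_one_comm.1 h1, Matrix.mul_assoc, hW2,
        Matrix.mul_zero]
    refine hw (funext fun i => ?_)
    have : W = 0 := toReal_injective (by
      rw [hW3]; ext (i | i) (k | k) <;> simp [toReal])
    exact congrFun (congrFun this i) ()
  obtain ⟨p, q, hpq, M, Y, hYM, hMY, hM⟩ := exists_congr_diagI hherm hunit
  rw [Fintype.card_fin] at hpq
  refine ⟨p, q, by rw [hpq, hm], Zᵀ * toReal M, toReal Y * Qᵀ, ?_, ?_, ?_, ?_⟩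
  · rw [Matrix.mul_assoc, ← Matrix.mul_assoc Qᵀ, hZQt, Matrix.one_mul, ← toReal_mul, hYM,
      toReal_one]
  · rw [Matrix.mul_assoc, ← Matrix.mul_assoc (toReal M), ← toReal_mul, hMY, toReal_one,
      Matrix.one_mul, hQZt]
  · rw [hback, hh, hM, toReal_mul, toReal_mul, toReal_conjTranspose, Matrix.transpose_mul,
      Matrix.transpose_transpose]
    simp only [Matrix.mul_assoc]
  · have hZj : Z * j = Matrix.J (Fin m) ℝ * Z := by
      calc Z * j = Z * (j * Q) * Z := by
            rw [Matrix.mul_assoc, Matrix.mul_assoc, hQZ, Matrix.mul_one]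
        _ = (Z * Q) * Matrix.J (Fin m) ℝ * Z := by rw [hjQ]; simp only [Matrix.mul_assoc]
        _ = _ := by rw [hZQ, Matrix.one_mul]
    rw [Matrix.transpose_mul, Matrix.transpose_transpose, Matrix.mul_assoc, hZj,
      ← Matrix.mul_assoc, ← Matrix.mul_assoc, ← toReal_conjTranspose, ← toReal_I_smul,
      ← toReal_I_smul, ← toReal_mul, ← toReal_mul]
    simp

/-- Normal form of alternating forms. -/
lemma exists_congr_J [Fintype ι] [DecidableEq ι] {G : Matrix ι ι ℝ} (hG : Gᵀ = -G)
    (hu : IsUnit G.det) :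
    ∃ g : ℕ, 2 * g = Fintype.card ι ∧ ∃ (M : Matrix ι (Fin g ⊕ Fin g) ℝ)
      (Y : Matrix (Fin g ⊕ Fin g) ι ℝ), Y * M = 1 ∧ M * Y = 1 ∧
        G = M * Matrix.J (Fin g) ℝ * Mᵀ := by
  have hGG : (Gᵀ * G).PosDef := by
    have := Matrix.PosDef.conjTranspose_mul_self G
      (Matrix.mulVec_injective_iff_isUnit.2 ((Matrix.isUnit_iff_isUnit_det G).2 hu))
    simpa using this
  -- Polar decomposition `G = D O`. As `G' G = -G²` commutes with `G`, the orthogonal factor `O`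
  -- commutes with `D`; then `G' = -G` forces `O' = -O`, so `O` is a complex structure that
  -- preserves `D`.
  obtain ⟨D, hD, hDD⟩ : ∃ D : Matrix ι ι ℝ, D.PosDef ∧ D * D = Gᵀ * G :=
    ⟨_, sqrt_posDef hGG, sqrt_mul_self hGG⟩
  have hDt : Dᵀ = D := by simpa using hD.isHermitian.eq
  have hDu : IsUnit D.det := (Matrix.isUnit_iff_isUnit_det _).1 hD.isUnit
  have hD1 : D * D⁻¹ = 1 := Matrix.mul_nonsing_inv _ hDu
  have hD2 : D⁻¹ * D = 1 := Matrix.nonsing_inv_mul _ hDu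
  have hDit : (D⁻¹)ᵀ = D⁻¹ := by rw [Matrix.transpose_nonsing_inv, hDt]
  have hDDG : D * D * G = G * (D * D) := by rw [hDD, hG]; simp [Matrix.mul_assoc]
  set O := D⁻¹ * G with hO
  have hDO : D * O = G := by rw [hO, ← Matrix.mul_assoc, hD1, Matrix.one_mul]
  have hOt : Oᵀ = -(G * D⁻¹) := by rw [hO, Matrix.transpose_mul, hDit, hG, Matrix.neg_mul]
  have hOO : Oᵀ * O = 1 := by
    have h1 : D⁻¹ * D⁻¹ * (D * D) = 1 := by
      rw [Matrix.mul_assoc, ← Matrix.mul_assoc D⁻¹ D D, hD2, Matrix.one_mul, hD2]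
    have h1' : D * D * (D⁻¹ * D⁻¹) = 1 := mul_eq_one_comm.1 h1
    have h2 : D⁻¹ * D⁻¹ * G = G * (D⁻¹ * D⁻¹) := by
      calc D⁻¹ * D⁻¹ * G = D⁻¹ * D⁻¹ * (G * (D * D)) * (D⁻¹ * D⁻¹) := by
            rw [Matrix.mul_assoc _ _ (D⁻¹ * D⁻¹), Matrix.mul_assoc G, h1', Matrix.mul_one]
        _ = (D⁻¹ * D⁻¹ * (D * D)) * G * (D⁻¹ * D⁻¹) := by
            rw [← hDDG]; simp only [Matrix.mul_assoc]
        _ = _ := by rw [h1, Matrix.one_mul]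
    calc Oᵀ * O = -(G * (D⁻¹ * D⁻¹ * G)) := by
          rw [hOt, hO]; simp only [Matrix.mul_assoc, Matrix.neg_mul]
      _ = (Gᵀ * G) * (D⁻¹ * D⁻¹) := by
          rw [h2, hG]; simp only [Matrix.mul_assoc, Matrix.neg_mul]
      _ = 1 := by rw [← hDD, h1']
  have hOO' : O * Oᵀ = 1 := mul_eq_one_comm.1 hOO
  -- Both sides are positive definite with the same square, because `O` commutes with `D²`.
  have hODO : Oᵀ * D * O = D := by
    refine posDef_eq_of_mul_self_eq ?_ hD ?_
    · have := hD.conjTranspose_mul_mul_same (B := O)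
        (Matrix.mulVec_injective_iff_isUnit.2 (IsUnit.of_mul_eq_one_right _ hOO))
      simpa using this
    · have h3 : D * D * O = O * (D * D) := by
        calc D * D * O = D * G := by rw [Matrix.mul_assoc, hDO]
          _ = (D⁻¹ * D) * D * G := by rw [hD2, Matrix.one_mul]
          _ = D⁻¹ * (D * D * G) := by simp only [Matrix.mul_assoc]
          _ = O * (D * D) := by rw [hDDG, hO, Matrix.mul_assoc]
      calc Oᵀ * D * O * (Oᵀ * D * O) = Oᵀ * D * (O * Oᵀ) * D * O := by
            simp only [Matrix.mul_assoc]
        _ = Oᵀ * (D * D * O) := by rw [hOO', Matrix.mul_one]; simp only [Matrix.mul_assoc]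
        _ = D * D := by rw [h3, ← Matrix.mul_assoc, hOO, Matrix.one_mul]
  have hcomm : D * O = O * D := by
    calc D * O = (O * Oᵀ) * (D * O) := by rw [hOO', Matrix.one_mul]
      _ = O * (Oᵀ * D * O) := by simp only [Matrix.mul_assoc]
      _ = _ := by rw [hODO]
  have hOt' : Oᵀ = -O := by
    rw [hOt, ← hDO, hcomm, Matrix.mul_assoc, hD1, Matrix.mul_one]
  have hO2 : O * O = -1 := by
    rw [← hOO, hOt', Matrix.neg_mul, neg_neg]
  obtain ⟨p, q, hpq, M, Y, hYM, hMY, hM, hMO⟩ := exists_congr_toReal_diagI hO2 hDt hDu hODO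
  have hGM : G = M * (toReal (diagI ℂ p q) * Matrix.J _ ℝ) * Mᵀ := by
    rw [← hDO, hM, Matrix.mul_assoc _ Mᵀ, hMO]; simp only [Matrix.mul_assoc]
  let E := diagI ℝ p q
  have hEE : E * E = 1 := diagI_mul_self ℝ p q
  have hEt : Eᵀ = E := by simpa using diagI_conjTranspose ℝ p q
  -- The signature of `D` need not be computed: `diag (E, E) J = T J T'` with `T = diag (E, 1)`, so
  -- the signs disappear in the alternating form.
  let T : Matrix ((Fin p ⊕ Fin q) ⊕ (Fin p ⊕ Fin q)) ((Fin p ⊕ Fin q) ⊕ (Fin p ⊕ Fin q)) ℝ :=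
    Matrix.fromBlocks E 0 0 1
  have hTT : T * T = 1 := by simp [T, Matrix.fromBlocks_multiply, hEE, Matrix.fromBlocks_one]
  have hE : toReal (diagI ℂ p q) = Matrix.fromBlocks E 0 0 E := by
    ext (i | i) (k | k) <;> by_cases h : i = k <;>
      simp [toReal, E, LieAlgebra.Orthogonal.indefiniteDiagonal, h] <;>
      rcases k with k | k <;> simp
  have hTJ : toReal (diagI ℂ p q) * Matrix.J _ ℝ = T * Matrix.J _ ℝ * Tᵀ := by
    rw [hE]
    simp [T, Matrix.J, Matrix.fromBlocks_multiply, Matrix.fromBlocks_transpose, hEt]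
  let e : Fin (p + q) ⊕ Fin (p + q) ≃ (Fin p ⊕ Fin q) ⊕ (Fin p ⊕ Fin q) :=
    Equiv.sumCongr finSumFinEquiv.symm finSumFinEquiv.symm
  have hJe : Matrix.J (Fin (p + q)) ℝ = (Matrix.J (Fin p ⊕ Fin q) ℝ).submatrix e e := by
    ext (i | i) (k | k) <;> simp [e, Matrix.J, Matrix.one_apply]
  refine ⟨p + q, hpq, (M * T).submatrix id e, (T * Y).submatrix e id, ?_, ?_, ?_⟩
  · rw [← Matrix.submatrix_mul _ _ _ _ _ Function.bijective_id, Matrix.mul_assoc,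
      ← Matrix.mul_assoc Y, hYM, Matrix.one_mul, hTT, Matrix.submatrix_one_equiv]
  · rw [← Matrix.submatrix_mul _ _ _ _ _ e.bijective, Matrix.mul_assoc, ← Matrix.mul_assoc T,
      hTT, Matrix.one_mul, hMY, Matrix.submatrix_id_id]
  · rw [hJe, Matrix.transpose_submatrix, ← Matrix.submatrix_mul _ _ _ _ _ e.bijective,
      ← Matrix.submatrix_mul _ _ _ _ _ e.bijective, Matrix.submatrix_id_id,
      Matrix.transpose_mul, hGM, hTJ]
    simp only [Matrix.mul_assoc]

end NormalForms

/-! ### The three families of symmetric spaces -/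

section SymmetricSpaces

variable {ι : Type*} [Fintype ι] [DecidableEq ι]

lemma abs_det_eq_one_of_orthogonal {D : Matrix ι ι ℝ} (h : Dᵀ * D = 1) : |D.det| = 1 := by
  have h1 := congrArg Matrix.det h
  rw [Matrix.det_mul, Matrix.det_transpose, Matrix.det_one] at h1
  exact (abs_eq zero_le_one).2 (mul_self_eq_one_iff.1 h1)

/-- An orthogonal `D` equals `D^∨`, and since `A` is symmetric the equation `A D A = D` says that
`A` preserves the form `D`. The locus is thus the positive definite part of an isometry group. -/
lemma mem_locus_orthogonal_iff {D A : Matrix ι ι ℝ} (h : Dᵀ * D = 1) :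
    A ∈ locus D ↔ A.PosDef ∧ A * D * A = D := by
  have : dual D = D := Matrix.inv_eq_left_inv (mul_eq_one_comm.1 h)
  rw [mem_locus_iff (abs_det_eq_one_of_orthogonal h), this]

/-- The isometry group of an involution `E` is stable under `g ↦ g*`; this is what puts `g g*` in
the locus. -/
lemma mul_mul_conjTranspose_comm {𝕜 : Type*} [RCLike 𝕜] {E g : Matrix ι ι 𝕜} (hE : E * E = 1)
    (h : g * E * gᴴ = E) : gᴴ * E * g = E := by
  have h1 : (E * gᴴ) * (E * g) = 1 := by
    refine mul_eq_one_comm.1 ?_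
    calc E * g * (E * gᴴ) = E * (g * E * gᴴ) := by simp only [Matrix.mul_assoc]
      _ = 1 := by rw [h, hE]
  calc gᴴ * E * g = (E * E) * (gᴴ * E * g) := by rw [hE, Matrix.one_mul]
    _ = E * ((E * gᴴ) * (E * g)) := by simp only [Matrix.mul_assoc]
    _ = E := by rw [h1, Matrix.mul_one]

lemma continuous_matrix_inv {T : Type*} [TopologicalSpace T] {f : T → Matrix ι ι ℝ}
    (hf : Continuous f) (hu : ∀ t, IsUnit (f t).det) : Continuous fun t => (f t)⁻¹ := by
  simp only [Matrix.inv_def, Ring.inverse_eq_inv']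
  exact (hf.matrix_det.inv₀ fun t => (hu t).ne_zero).smul hf.matrix_adjugate

lemma mem_identitySO_iff {p q : ℕ} {g : GL (Fin p ⊕ Fin q) ℝ} :
    g ∈ identitySO p q ↔ ∃ h : g ∈ indefiniteSU ℝ p q,
      (⟨g, h⟩ : indefiniteSU ℝ p q) ∈ connectedComponent (1 : indefiniteSU ℝ p q) := by
  constructor
  · rintro ⟨x, hx, rfl⟩
    exact ⟨x.2, hx⟩
  · rintro ⟨h, hx⟩
    exact ⟨⟨g, h⟩, hx, rfl⟩

/-- The positive definite elements of `O(p, q)` belong to `SO_0(p, q)`. -/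
lemma mem_identitySO_of_posDef {p q : ℕ} {c : GL (Fin p ⊕ Fin q) ℝ} (hc : c.1.PosDef)
    (h : c.1 * diagI ℝ p q * c.1 = diagI ℝ p q) : c ∈ identitySO p q := by
  set C := c.1 with hC
  set E := diagI ℝ p q with hE
  have hEE : E * E = 1 := diagI_mul_self ℝ p q
  have hCt : Cᵀ = C := by simpa using hc.isHermitian.eq
  -- The path `X t = A t (B t)⁻¹` from `1` to `C` applies to `C` the function `x ↦ ((1+t)x + (1-t))
  -- / ((1-t)x + (1+t))`, which commutes with `x ↦ 1/x`. The relation `C E C = E` says that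
  -- conjugation by `E` inverts `C`; hence it also inverts `X t`, and the path stays in the group.
  -- For `t` in `[0, 1]` both `A t` and `B t` are positive definite.
  let A : unitInterval → Matrix (Fin p ⊕ Fin q) (Fin p ⊕ Fin q) ℝ := fun t =>
    (1 + (t : ℝ)) • C + (1 - (t : ℝ)) • (1 : Matrix _ _ ℝ)
  let B : unitInterval → Matrix (Fin p ⊕ Fin q) (Fin p ⊕ Fin q) ℝ := fun t =>
    (1 - (t : ℝ)) • C + (1 + (t : ℝ)) • (1 : Matrix _ _ ℝ)
  have ht1 : ∀ t : unitInterval, 0 < 1 + (t : ℝ) := fun t => by linarith [t.2.1]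
  have ht2 : ∀ t : unitInterval, 0 ≤ 1 - (t : ℝ) := fun t => by linarith [t.2.2]
  have hA : ∀ t, (A t).PosDef := fun t =>
    (hc.smul (ht1 t)).add_posSemidef (Matrix.PosSemidef.one.smul (ht2 t))
  have hB : ∀ t, (B t).PosDef := fun t =>
    Matrix.PosDef.posSemidef_add (hc.posSemidef.smul (ht2 t)) (Matrix.PosDef.one.smul (ht1 t))
  have hAu : ∀ t, IsUnit (A t).det := fun t => isUnit_iff_ne_zero.2 (hA t).det_pos.ne'
  have hBu : ∀ t, IsUnit (B t).det := fun t => isUnit_iff_ne_zero.2 (hB t).det_pos.ne'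
  have hAt : ∀ t, (A t)ᵀ = A t := fun t => by simpa using (hA t).isHermitian.eq
  have hBt : ∀ t, ((B t)⁻¹)ᵀ = (B t)⁻¹ := fun t => by simpa using (hB t).inv.isHermitian.eq
  have hcomm : ∀ t, A t * B t = B t * A t := fun t => by
    simp only [A, B, Matrix.mul_add, Matrix.add_mul, Matrix.smul_mul, Matrix.mul_smul,
      Matrix.one_mul, Matrix.mul_one]
    module
  have hcomm' : ∀ t, (B t)⁻¹ * A t = A t * (B t)⁻¹ := fun t => by
    calc (B t)⁻¹ * A t = (B t)⁻¹ * (A t * B t) * (B t)⁻¹ := by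
          rw [Matrix.mul_assoc, Matrix.mul_assoc, Matrix.mul_nonsing_inv _ (hBu t), Matrix.mul_one]
      _ = _ := by rw [hcomm, ← Matrix.mul_assoc, Matrix.nonsing_inv_mul _ (hBu t), Matrix.one_mul]
  have hAEC : ∀ t, A t * E * C = E * B t := fun t => by
    simp only [A, B, Matrix.mul_add, Matrix.add_mul, Matrix.smul_mul, Matrix.mul_smul,
      Matrix.one_mul, Matrix.mul_one, h]
    module
  have hBEC : ∀ t, B t * E * C = E * A t := fun t => by
    simp only [A, B, Matrix.mul_add, Matrix.add_mul, Matrix.smul_mul, Matrix.mul_smul,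
      Matrix.one_mul, Matrix.mul_one, h]
    module
  let X : unitInterval → GL (Fin p ⊕ Fin q) ℝ := fun t =>
    ⟨A t * (B t)⁻¹, B t * (A t)⁻¹, by
      rw [Matrix.mul_assoc, ← Matrix.mul_assoc _ (B t), Matrix.nonsing_inv_mul _ (hBu t),
        Matrix.one_mul, Matrix.mul_nonsing_inv _ (hAu t)], by
      rw [Matrix.mul_assoc, ← Matrix.mul_assoc _ (A t), Matrix.nonsing_inv_mul _ (hAu t),
        Matrix.one_mul, Matrix.mul_nonsing_inv _ (hBu t)]⟩
  have hXE : ∀ t, (X t).1 * E * (X t).1ᴴ = E := by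
    intro t
    have e1 : (B t)⁻¹ * (E * A t) = E * C := by
      rw [← hBEC, Matrix.mul_assoc, ← Matrix.mul_assoc _ (B t),
        Matrix.nonsing_inv_mul _ (hBu t), Matrix.one_mul]
    calc (X t).1 * E * (X t).1ᴴ = A t * (B t)⁻¹ * E * ((B t)⁻¹ * A t) := by
          change A t * (B t)⁻¹ * E * (A t * (B t)⁻¹)ᴴ = _
          rw [Matrix.conjTranspose_eq_transpose_of_trivial, Matrix.transpose_mul, hAt, hBt]
      _ = A t * ((B t)⁻¹ * (E * A t)) * (B t)⁻¹ := by
          rw [hcomm']; simp only [Matrix.mul_assoc]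
      _ = (A t * E * C) * (B t)⁻¹ := by rw [e1]; simp only [Matrix.mul_assoc]
      _ = E := by rw [hAEC, Matrix.mul_assoc, Matrix.mul_nonsing_inv _ (hBu t), Matrix.mul_one]
  have hXdet : ∀ t, (X t).1.det = 1 := by
    intro t
    have h1 := congrArg Matrix.det (hXE t)
    have h2 := congrArg Matrix.det hEE
    have h3 : 0 < (X t).1.det := by
      change 0 < (A t * (B t)⁻¹).det
      rw [Matrix.det_mul]
      exact mul_pos (hA t).det_pos (hB t).inv.det_pos
    rw [Matrix.det_mul, Matrix.det_one] at h2
    rw [Matrix.conjTranspose_eq_transpose_of_trivial, Matrix.det_mul, Matrix.det_mul,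
      Matrix.det_transpose] at h1
    have h4 : (X t).1.det ^ 2 = 1 := by
      calc (X t).1.det ^ 2 = (X t).1.det * E.det * (X t).1.det * E.det := by
            linear_combination (-(X t).1.det ^ 2) * h2
        _ = 1 := by rw [h1, h2]
    nlinarith
  let Z : unitInterval → indefiniteSU ℝ p q := fun t => ⟨X t, hXE t, hXdet t⟩
  have hAc : Continuous A :=
    ((continuous_const.add continuous_subtype_val).smul continuous_const).add
      ((continuous_const.sub continuous_subtype_val).smul continuous_const)
  have hBc : Continuous B :=
    ((continuous_const.sub continuous_subtype_val).smul continuous_const).add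
      ((continuous_const.add continuous_subtype_val).smul continuous_const)
  have hXc : Continuous X := by
    refine Units.continuous_iff.2 ⟨?_, ?_⟩
    · exact hAc.matrix_mul (continuous_matrix_inv hBc hBu)
    · exact hBc.matrix_mul (continuous_matrix_inv hAc hAu)
  have hZc : Continuous Z := hXc.subtype_mk _
  have hZ0 : Z 0 = 1 := by
    refine Subtype.ext (Units.ext ?_)
    change A 0 * (B 0)⁻¹ = 1
    have : A 0 = B 0 := by simp [A, B]
    rw [this, Matrix.mul_nonsing_inv _ (hBu 0)]
  have hZ1 : (Z 1).1 = c := by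
    refine Units.ext ?_
    change A 1 * (B 1)⁻¹ = C
    have : A 1 = C * B 1 := by simp [A, B]
    rw [this, Matrix.mul_assoc, Matrix.mul_nonsing_inv _ (hBu 1), Matrix.mul_one]
  have hmem : Z 1 ∈ connectedComponent (1 : indefiniteSU ℝ p q) := by
    have := (isPreconnected_range hZc).subset_connectedComponent (x := 1) ⟨0, hZ0⟩
    exact this ⟨1, rfl⟩
  rw [← hZ1]
  exact mem_identitySO_iff.2 ⟨(Z 1).2, hmem⟩

/-- The upper left block of an element of `SO_0(p, q)` has positive determinant. -/
lemma det_toBlocks₁₁_pos {p q : ℕ} {g : GL (Fin p ⊕ Fin q) ℝ} (hg : g ∈ identitySO p q) :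
    0 < g.1.toBlocks₁₁.det := by
  obtain ⟨h, hx⟩ := mem_identitySO_iff.1 hg
  let f : indefiniteSU ℝ p q → ℝ := fun x => x.1.1.toBlocks₁₁.det
  have hf : Continuous f := by
    have h1 : Continuous fun x : indefiniteSU ℝ p q => x.1.1 :=
      Units.continuous_val.comp continuous_subtype_val
    exact (continuous_matrix fun i j => h1.matrix_elem _ _).matrix_det
  -- The upper left block of `x E x* = E` reads `a a* = 1 + b b*`, a positive definite matrix, so
  -- `det a` never vanishes on `SO(p, q)`. On the component of `1` it keeps the sign it has at `1`.
  have hne : ∀ x, f x ≠ 0 := by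
    rintro ⟨x, hx, hx'⟩
    obtain ⟨a, b, c, d, hxx⟩ : ∃ a b c d, x.1 = Matrix.fromBlocks a b c d :=
      ⟨_, _, _, _, (Matrix.fromBlocks_toBlocks x.1).symm⟩
    have hE : diagI ℝ p q = Matrix.fromBlocks 1 0 0 (-1) := by
      rw [diagI_eq, ← Matrix.fromBlocks_diagonal]; simp [← Matrix.diagonal_neg]
    have hx'' := hx
    rw [hxx, hE, Matrix.fromBlocks_conjTranspose, Matrix.fromBlocks_multiply,
      Matrix.fromBlocks_multiply, Matrix.fromBlocks_inj] at hx
    have h1 : a * aᴴ = 1 + b * bᴴ := by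
      have := hx.1
      simp only [Matrix.mul_one, Matrix.mul_zero, add_zero, zero_add, Matrix.mul_neg,
        Matrix.neg_mul] at this
      rw [← this]; abel
    have h2 : (a * aᴴ).PosDef := by
      rw [h1]
      exact Matrix.PosDef.one.add_posSemidef (Matrix.posSemidef_self_mul_conjTranspose b)
    intro h0
    have h3 : a.det = 0 := by
      have : f ⟨x, hx'', hx'⟩ = a.det := by simp only [f]; rw [hxx, Matrix.toBlocks_fromBlocks₁₁]
      rw [← this]; exact h0
    have := h2.det_pos
    rw [Matrix.det_mul, h3, zero_mul] at this
    exact lt_irrefl _ this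
  have h1 : f 1 = 1 := by
    simp only [f]
    change (1 : Matrix (Fin p ⊕ Fin q) (Fin p ⊕ Fin q) ℝ).toBlocks₁₁.det = 1
    rw [← Matrix.fromBlocks_one, Matrix.toBlocks_fromBlocks₁₁, Matrix.det_one]
  by_contra hn
  obtain ⟨y, -, hy⟩ := (isPreconnected_connectedComponent (x := (1 : indefiniteSU ℝ p q)))
    |>.intermediate_value hx mem_connectedComponent hf.continuousOn
    (show (0 : ℝ) ∈ Set.Icc (f ⟨g, h⟩) (f 1) from ⟨not_lt.1 hn, by rw [h1]; exact zero_le_one⟩)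
  exact hne y hy

/-- The matrices that commute with `I_{p,q}` are block diagonal. -/
lemma exists_fromBlocks_of_commute {𝕜 : Type*} [RCLike 𝕜] {p q : ℕ}
    {g : Matrix (Fin p ⊕ Fin q) (Fin p ⊕ Fin q) 𝕜} (h : g * diagI 𝕜 p q = diagI 𝕜 p q * g) :
    ∃ a d, g = Matrix.fromBlocks a 0 0 d := by
  obtain ⟨a, b, c, d, rfl⟩ : ∃ a b c d, g = Matrix.fromBlocks a b c d :=
    ⟨_, _, _, _, (Matrix.fromBlocks_toBlocks g).symm⟩
  have hE : diagI 𝕜 p q = Matrix.fromBlocks 1 0 0 (-1) := by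
    rw [diagI_eq, ← Matrix.fromBlocks_diagonal]; simp [← Matrix.diagonal_neg]
  rw [hE, Matrix.fromBlocks_multiply, Matrix.fromBlocks_multiply, Matrix.fromBlocks_inj] at h
  simp only [Matrix.mul_one, Matrix.mul_zero, add_zero, zero_add, Matrix.mul_neg,
    Matrix.neg_mul, Matrix.one_mul, Matrix.zero_mul] at h
  have hb : b = 0 := by
    ext i j
    have := congrFun (congrFun h.2.1 i) j
    rw [Matrix.neg_apply] at this
    rw [Matrix.zero_apply]
    linear_combination (-1 / 2) * this
  have hc : c = 0 := by
    ext i j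
    have := congrFun (congrFun h.2.2.1 i) j
    rw [Matrix.neg_apply] at this
    rw [Matrix.zero_apply]
    linear_combination (1 / 2) * this
  exact ⟨a, d, by rw [hb, hc]⟩

lemma commute_diagI_of_unitary {𝕜 : Type*} [RCLike 𝕜] {E g : Matrix ι ι 𝕜}
    (h : g * E * gᴴ = E) (hg : g * gᴴ = 1) : g * E = E * g := by
  calc g * E = g * E * (gᴴ * g) := by rw [mul_eq_one_comm.1 hg, Matrix.mul_one]
    _ = (g * E * gᴴ) * g := by simp only [Matrix.mul_assoc]
    _ = E * g := by rw [h]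

/-- An orthogonal element commutes with `I_{p,q}`, hence is block diagonal with orthogonal blocks
whose determinants have product `1`. On the identity component the first determinant is positive, so
both are `1`. -/
lemma mem_blockSO_iff {p q : ℕ} {g : GL (Fin p ⊕ Fin q) ℝ} (hg : g ∈ identitySO p q) :
    g ∈ blockSO p q ↔ g.1 * g.1ᴴ = 1 := by
  constructor
  · rintro ⟨A, hA, B, hB, h⟩
    rw [h, Matrix.fromBlocks_conjTranspose, Matrix.fromBlocks_multiply]
    have h1 := Matrix.mem_unitaryGroup_iff.1 (Matrix.mem_specialOrthogonalGroup_iff.1 hA).1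
    have h2 := Matrix.mem_unitaryGroup_iff.1 (Matrix.mem_specialOrthogonalGroup_iff.1 hB).1
    rw [Matrix.star_eq_conjTranspose] at h1 h2
    simp [-Matrix.conjTranspose_eq_transpose_of_trivial, h1, h2]
  · intro h
    obtain ⟨hSU, -⟩ := mem_identitySO_iff.1 hg
    obtain ⟨a, d, had⟩ := exists_fromBlocks_of_commute (commute_diagI_of_unitary hSU.1 h)
    have hpos := det_toBlocks₁₁_pos hg
    have hdet := hSU.2
    rw [had, Matrix.toBlocks_fromBlocks₁₁] at hpos
    rw [had, Matrix.det_fromBlocks_zero₂₁] at hdet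
    rw [had, Matrix.fromBlocks_conjTranspose, Matrix.fromBlocks_multiply, ← Matrix.fromBlocks_one,
      Matrix.fromBlocks_inj] at h
    simp only [Matrix.mul_zero, Matrix.zero_mul, add_zero, zero_add,
      Matrix.conjTranspose_zero] at h
    have ha : a.det = 1 := by
      have := congrArg Matrix.det h.1
      rw [Matrix.det_mul, Matrix.conjTranspose_eq_transpose_of_trivial, Matrix.det_transpose,
        Matrix.det_one] at this
      nlinarith
    rw [ha, one_mul] at hdet
    exact ⟨a, Matrix.mem_specialOrthogonalGroup_iff.2 ⟨Matrix.mem_unitaryGroup_iff.2 h.1, ha⟩,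
      d, Matrix.mem_specialOrthogonalGroup_iff.2 ⟨Matrix.mem_unitaryGroup_iff.2 h.2.2.2, hdet⟩,
      had⟩

lemma mem_blockSU_iff {p q : ℕ} {g : GL (Fin p ⊕ Fin q) ℂ} (hg : g ∈ indefiniteSU ℂ p q) :
    g ∈ blockSU p q ↔ g.1 * g.1ᴴ = 1 := by
  constructor
  · rintro ⟨A, hA, B, hB, -, h⟩
    rw [h, Matrix.fromBlocks_conjTranspose, Matrix.fromBlocks_multiply]
    have h1 := Matrix.mem_unitaryGroup_iff.1 hA
    have h2 := Matrix.mem_unitaryGroup_iff.1 hB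
    rw [Matrix.star_eq_conjTranspose] at h1 h2
    simp [h1, h2]
  · intro h
    obtain ⟨a, d, had⟩ := exists_fromBlocks_of_commute (commute_diagI_of_unitary hg.1 h)
    have hdet := hg.2
    rw [had, Matrix.det_fromBlocks_zero₂₁] at hdet
    rw [had, Matrix.fromBlocks_conjTranspose, Matrix.fromBlocks_multiply, ← Matrix.fromBlocks_one,
      Matrix.fromBlocks_inj] at h
    simp only [Matrix.mul_zero, Matrix.zero_mul, add_zero, zero_add,
      Matrix.conjTranspose_zero] at h
    exact ⟨a, Matrix.mem_unitaryGroup_iff.2 h.1, d, Matrix.mem_unitaryGroup_iff.2 h.2.2.2,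
      hdet, had⟩

lemma realify_eq_toReal {g : ℕ} (U : Matrix (Fin g) (Fin g) ℂ) : realify U = toReal U := rfl

/-- An orthogonal symplectic matrix commutes with `J`, hence comes from a complex matrix, which is
then unitary. -/
lemma mem_realU_iff {g : ℕ} {a : GL (Fin g ⊕ Fin g) ℝ} (ha : a ∈ Sp g) :
    a ∈ realU g ↔ a.1 * a.1ᴴ = 1 := by
  constructor
  · rintro ⟨U, hU, h⟩
    have h1 := Matrix.mem_unitaryGroup_iff.1 hU
    rw [Matrix.star_eq_conjTranspose] at h1
    rw [h, realify_eq_toReal, Matrix.conjTranspose_eq_transpose_of_trivial,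
      ← toReal_conjTranspose, ← toReal_mul, h1, toReal_one]
  · intro h
    have h1 : a.1 * Matrix.J (Fin g) ℝ * a.1ᴴ = Matrix.J (Fin g) ℝ := by
      simpa using SymplecticGroup.mem_iff.1 ha
    obtain ⟨U, hU⟩ := exists_toReal_of_commute (commute_diagI_of_unitary h1 h)
    refine ⟨U, Matrix.mem_unitaryGroup_iff.2 (toReal_injective ?_), hU⟩
    rw [Matrix.star_eq_conjTranspose, toReal_mul, toReal_conjTranspose, toReal_one, ← hU,
      ← Matrix.conjTranspose_eq_transpose_of_trivial, h]

open scoped ComplexOrder in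
lemma posDef_mul_conjTranspose {𝕜 : Type*} [RCLike 𝕜] (g : GL ι 𝕜) : (g.1 * g.1ᴴ).PosDef :=
  Matrix.PosDef.mul_conjTranspose_self _
    (Matrix.vecMul_injective_iff_isUnit.2 g.isUnit)

theorem exists_isometry_of_symmetric {G : Matrix ι ι ℝ} (hdet : |G.det| = 1) (hG : Gᵀ = G) :
    ∃ p q : ℕ, p + q = Fintype.card ι ∧
      ∃ e : Coset 4 (identitySO p q) (blockSO p q) ≃ locus G, IsRiemannianIsometry e := by
  obtain ⟨p, q, hpq, M, Y, hYM, hMY, hM⟩ := exists_congr_diagI (𝕜 := ℝ) (H := G)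
    (by rw [Matrix.IsHermitian]; simpa using hG) (isUnit_det_of_abs_eq_one hdet)
  have hEE := diagI_mul_self ℝ p q
  have hEh := diagI_conjTranspose ℝ p q
  have hEt : (diagI ℝ p q)ᵀ = diagI ℝ p q := by simpa using hEh
  have horth : (diagI ℝ p q)ᵀ * diagI ℝ p q = 1 := by rw [hEt, hEE]
  rw [Matrix.conjTranspose_eq_transpose_of_trivial] at hM
  obtain ⟨e₁, he₁⟩ := exists_isometry_locus_congr hYM hMY hdet
    (abs_det_eq_one_of_orthogonal horth) hM
  obtain ⟨e₂, he₂⟩ := exists_isometry_coset_locus (identitySO p q) (blockSO p q) 4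
    (AlgHom.id ℝ _) Function.injective_id (fun B => by simp) (diagI ℝ p q)
    (fun g hg => mem_blockSO_iff hg)
    (fun g hg => by
      obtain ⟨hSU, -⟩ := mem_identitySO_iff.1 hg
      rw [mem_locus_orthogonal_iff horth]
      refine ⟨posDef_mul_conjTranspose g, ?_⟩
      have h2 := mul_mul_conjTranspose_comm hEE hSU.1
      calc g.1 * g.1ᴴ * diagI ℝ p q * (g.1 * g.1ᴴ)
          = g.1 * (g.1ᴴ * diagI ℝ p q * g.1) * g.1ᴴ := by simp only [Matrix.mul_assoc]
        _ = diagI ℝ p q := by rw [h2, hSU.1])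
    (fun A hA => ⟨A, ((mem_locus_orthogonal_iff horth).1 hA).1, rfl⟩)
    -- The positive root of an element of the locus is again an isometry of `I_{p,q}`, by uniqueness
    -- of roots. Being positive definite, it lies in the identity component.
    (fun B g _ hB hg hgB => by
      refine mem_identitySO_of_posDef hg (PosDef.mul_mul_eq_of_sq hg (by rw [hEh, hEE]) ?_)
      rw [hgB]
      exact ((mem_locus_orthogonal_iff horth).1 hB).2)
  exact ⟨p, q, hpq, e₂.trans e₁, he₂.trans he₁⟩

theorem exists_isometry_of_alternating {G : Matrix ι ι ℝ} (hdet : |G.det| = 1) (hG : Gᵀ = -G) :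
    ∃ g : ℕ, 2 * g = Fintype.card ι ∧
      ∃ e : Coset 4 (Sp g) (realU g) ≃ locus G, IsRiemannianIsometry e := by
  obtain ⟨g, hg, M, Y, hYM, hMY, hM⟩ := exists_congr_J hG (isUnit_det_of_abs_eq_one hdet)
  have horth : (Matrix.J (Fin g) ℝ)ᵀ * Matrix.J (Fin g) ℝ = 1 := by
    rw [Matrix.J_transpose, Matrix.neg_mul, Matrix.J_squared, neg_neg]
  obtain ⟨e₁, he₁⟩ := exists_isometry_locus_congr hYM hMY hdet
    (abs_det_eq_one_of_orthogonal horth) hM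
  obtain ⟨e₂, he₂⟩ := exists_isometry_coset_locus (Sp g) (realU g) 4
    (AlgHom.id ℝ _) Function.injective_id (fun B => by simp) (Matrix.J (Fin g) ℝ)
    (fun a ha => mem_realU_iff ha)
    (fun a ha => by
      rw [mem_locus_orthogonal_iff horth]
      refine ⟨posDef_mul_conjTranspose a, ?_⟩
      have h1 := SymplecticGroup.mem_iff.1 ha
      have h2 := SymplecticGroup.mem_iff'.1 ha
      rw [Matrix.conjTranspose_eq_transpose_of_trivial]
      calc a.1 * a.1ᵀ * Matrix.J (Fin g) ℝ * (a.1 * a.1ᵀ)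
          = a.1 * (a.1ᵀ * Matrix.J (Fin g) ℝ * a.1) * a.1ᵀ := by simp only [Matrix.mul_assoc]
        _ = Matrix.J (Fin g) ℝ := by rw [h2, h1])
    (fun A hA => ⟨A, ((mem_locus_orthogonal_iff horth).1 hA).1, rfl⟩)
    (fun B a _ hB ha haB => by
      have h1 := PosDef.mul_mul_eq_of_sq ha (N := Matrix.J (Fin g) ℝ) (by simpa using horth)
        (by rw [haB]; exact ((mem_locus_orthogonal_iff horth).1 hB).2)
      have h2 : a.1ᵀ = a.1 := by simpa using ha.isHermitian.eq
      refine SymplecticGroup.mem_iff.2 ?_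
      rw [h2, h1])
  exact ⟨g, hg, e₂.trans e₁, he₂.trans he₁⟩

section
open scoped ComplexOrder

/-- The real quadratic form at `(Re x, Im x)` is the real part of `x* B x`, whose imaginary part
vanishes for Hermitian `B`. -/
lemma posDef_of_posDef_toReal {μ : Type*} [Fintype μ] {B : Matrix μ μ ℂ}
    (h : (toReal B).PosDef) : B.PosDef := by
  have hB : B.IsHermitian := by
    refine toReal_injective ?_
    rw [toReal_conjTranspose]
    simpa using h.isHermitian.eq
  refine Matrix.PosDef.of_dotProduct_mulVec_pos hB fun x hx => ?_
  let v : μ ⊕ μ → ℝ := Sum.elim (fun i => (x i).re) fun i => (x i).im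
  have hv : v ≠ 0 := by
    intro h0
    refine hx (funext fun i => Complex.ext ?_ ?_)
    · exact congrFun h0 (Sum.inl i)
    · exact congrFun h0 (Sum.inr i)
  have h1 := h.dotProduct_mulVec_pos hv
  have h2 : (star x ⬝ᵥ (B *ᵥ x)).re = star v ⬝ᵥ (toReal B *ᵥ v) := by
    simp only [v, toReal, dotProduct, Matrix.mulVec, Fintype.sum_sum_type, Complex.re_sum,
      Pi.star_apply, Sum.elim_inl, Sum.elim_inr, Matrix.fromBlocks_apply₁₁,
      Matrix.fromBlocks_apply₁₂, Matrix.fromBlocks_apply₂₁, Matrix.fromBlocks_apply₂₂,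
      Matrix.map_apply, Matrix.neg_apply, ← Finset.sum_add_distrib, star_trivial,
      Complex.star_def, Complex.mul_re, Complex.conj_re, Complex.conj_im, Complex.im_sum,
      Complex.mul_im]
    refine Finset.sum_congr rfl fun i _ => ?_
    rw [Finset.mul_sum, Finset.mul_sum, Finset.mul_sum, Finset.mul_sum, ← Finset.sum_sub_distrib,
      ← Finset.sum_add_distrib]
    exact Finset.sum_congr rfl fun j _ => by ring
  have h3 : (star x ⬝ᵥ (B *ᵥ x)).im = 0 := hB.im_star_dotProduct_mulVec_self x
  rw [Complex.pos_iff, h2, h3]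
  exact ⟨h1, rfl⟩

lemma det_eq_one_of_posDef {p q : ℕ} {C : Matrix (Fin p ⊕ Fin q) (Fin p ⊕ Fin q) ℂ}
    (hC : C.PosDef) (h : C * diagI ℂ p q * C = diagI ℂ p q) : C.det = 1 := by
  have h1 := congrArg Matrix.det h
  have h2 := congrArg Matrix.det (diagI_mul_self ℂ p q)
  rw [Matrix.det_mul, Matrix.det_one] at h2
  rw [Matrix.det_mul, Matrix.det_mul] at h1
  have h4 : C.det * C.det = 1 := by
    calc C.det * C.det = C.det * (diagI ℂ p q).det * C.det * (diagI ℂ p q).det := by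
          linear_combination (-C.det ^ 2) * h2
      _ = 1 := by rw [h1, h2]
  rcases mul_self_eq_one_iff.1 h4 with h5 | h5
  · exact h5
  · have := hC.det_pos
    rw [h5, Complex.pos_iff] at this
    norm_num at this

/-- Write `S = cos θ + sin θ j` with `j² = -1` and let `T = cos (θ/2) + sin (θ/2) j`, a square root
of `S`. Then `G = H T` where `H` is symmetric and preserved by `j`. The Hermitian normal form of `H`
makes `G` congruent to the real matrix of `w I_{p,q}` with `w = e^{iθ/2}`, and the scalar `w`
cancels from the locus equation for complex matrices. -/
theorem exists_isometry_of_rotation {G : Matrix ι ι ℝ} (hdet : |G.det| = 1) {θ : ℝ} (hθ : 0 < θ)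
    (hθ' : θ < Real.pi)
    (hS : (dual G * G) ^ 2 - (2 * Real.cos θ) • (dual G * G) + 1 = 0) :
    ∃ p q : ℕ, 2 * (p + q) = Fintype.card ι ∧
      ∃ e : Coset 8 (indefiniteSU ℂ p q) (blockSU p q) ≃ locus G, IsRiemannianIsometry e := by
  have hGu := isUnit_det_of_abs_eq_one hdet
  set S := dual G * G with hSdef
  set c := Real.cos (θ / 2) with hc
  set s := Real.sin (θ / 2) with hs
  set σ := Real.sin θ with hσ
  have hσ0 : σ ≠ 0 := (Real.sin_pos_of_pos_of_lt_pi hθ hθ').ne'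
  have hcs : c ^ 2 + s ^ 2 = 1 := by rw [add_comm]; exact Real.sin_sq_add_cos_sq _
  have hcosθ : Real.cos θ = c ^ 2 - s ^ 2 := by
    rw [show θ = 2 * (θ / 2) by ring, Real.cos_two_mul']
  have hsinθ : σ = 2 * s * c := by
    rw [hσ, show θ = 2 * (θ / 2) by ring, Real.sin_two_mul]
  have hpyth : Real.cos θ ^ 2 + σ ^ 2 = 1 := by rw [add_comm]; exact Real.sin_sq_add_cos_sq _
  set C := Real.cos θ with hC
  set j : Matrix ι ι ℝ := σ⁻¹ • (S - C • 1) with hj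
  have hSj : S = C • 1 + σ • j := by rw [hj, smul_smul, mul_inv_cancel₀ hσ0, one_smul]; abel
  have hS2 : S * S = (2 * C) • S - 1 := by
    rw [← sq, ← sub_eq_zero, ← hS]; abel
  have hjj : j * j = -1 := by
    have h1 : (S - C • 1) * (S - C • 1) = (-σ ^ 2) • (1 : Matrix ι ι ℝ) := by
      rw [show -σ ^ 2 = C ^ 2 - 1 by linarith]
      simp only [Matrix.mul_sub, Matrix.sub_mul, Matrix.smul_mul, Matrix.mul_smul,
        Matrix.one_mul, Matrix.mul_one, hS2]
      module
    rw [hj, Matrix.smul_mul, Matrix.mul_smul, h1, smul_smul, smul_smul,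
      show σ⁻¹ * σ⁻¹ * -σ ^ 2 = -1 by field_simp]
    simp
  clear_value j
  have hGS : Gᵀ * S = G := by
    rw [hSdef, ← Matrix.mul_assoc, transpose_mul_dual hGu, Matrix.one_mul]
  have hSGS : Sᵀ * G * S = G := by
    have h1 : (dual G)ᵀ * G = 1 := by
      have := congrArg Matrix.transpose (transpose_mul_dual hGu)
      simpa [Matrix.transpose_mul] using this
    rw [hSdef, Matrix.transpose_mul, Matrix.mul_assoc Gᵀ, h1, Matrix.mul_one, ← hSdef, hGS]
  have hSS' : S * (C • 1 - σ • j) = 1 := by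
    rw [hSj]
    simp only [Matrix.mul_sub, Matrix.add_mul, Matrix.smul_mul, Matrix.mul_smul,
      Matrix.one_mul, Matrix.mul_one, hjj]
    match_scalars
    · linear_combination hpyth
    · ring
  -- The form `G` is preserved by `S`, whose inverse is `C - σ j`. Comparing adjoints shows that `j`
  -- is skew for `G`.
  have hStG : Sᵀ * G = G * (C • 1 - σ • j) := by
    calc Sᵀ * G = Sᵀ * G * (S * (C • 1 - σ • j)) := by rw [hSS', Matrix.mul_one]
      _ = _ := by rw [← Matrix.mul_assoc, hSGS]
  have hjG : jᵀ * G = -(G * j) := by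
    rw [hSj] at hStG
    simp only [Matrix.transpose_add, Matrix.transpose_smul, Matrix.transpose_one, Matrix.add_mul,
      Matrix.mul_sub, Matrix.smul_mul, Matrix.mul_smul, Matrix.one_mul, Matrix.mul_one] at hStG
    have h1 : σ • (jᵀ * G) = σ • (-(G * j)) := by
      rw [smul_neg]
      have := congrArg (fun X => X - C • G) hStG
      simpa using this
    exact smul_right_injective _ hσ0 h1
  have hGt : Gᵀ = G * (C • 1 - σ • j) := by
    calc Gᵀ = Gᵀ * (S * (C • 1 - σ • j)) := by rw [hSS', Matrix.mul_one]
      _ = _ := by rw [← Matrix.mul_assoc, hGS]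
  set T : Matrix ι ι ℝ := c • 1 + s • j with hT
  set T' : Matrix ι ι ℝ := c • 1 - s • j with hT'
  have hTT' : T' * T = 1 := by
    rw [hT, hT']
    simp only [Matrix.mul_add, Matrix.sub_mul, Matrix.smul_mul, Matrix.mul_smul,
      Matrix.one_mul, Matrix.mul_one, hjj]
    match_scalars
    · linear_combination hcs
    · ring
  set H := G * T' with hH
  have hHT : H * T = G := by rw [hH, Matrix.mul_assoc, hTT', Matrix.mul_one]
  have hHu : IsUnit H.det := by
    have h1 := congrArg Matrix.det hHT
    rw [Matrix.det_mul] at h1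
    exact isUnit_of_mul_isUnit_left (h1 ▸ hGu)
  -- For `G` the adjoint of `T' = T⁻¹` is `T`, and `G' = G S⁻¹`. Hence `H' = G T S⁻¹ = G T⁻¹`, as
  -- `T² = S`.
  have hHt : Hᵀ = H := by
    have h1 : T * (C • 1 - σ • j) = T' := by
      rw [hT, hT', hcosθ, hsinθ]
      simp only [Matrix.mul_sub, Matrix.add_mul, Matrix.smul_mul, Matrix.mul_smul,
        Matrix.one_mul, Matrix.mul_one, hjj]
      match_scalars
      · linear_combination c * hcs
      · linear_combination (-s) * hcs
    have h2 : T'ᵀ * G = G * T := by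
      rw [hT, hT']
      simp only [Matrix.transpose_sub, Matrix.transpose_smul, Matrix.transpose_one,
        Matrix.sub_mul, Matrix.mul_add, Matrix.smul_mul, Matrix.mul_smul, Matrix.one_mul,
        Matrix.mul_one, hjG]
      module
    rw [hH, Matrix.transpose_mul, hGt, ← Matrix.mul_assoc, h2, Matrix.mul_assoc, h1]
  have hjHj : jᵀ * H * j = H := by
    have h1 : T' * j = j * T' := by
      rw [hT']
      simp only [Matrix.sub_mul, Matrix.mul_sub, Matrix.smul_mul, Matrix.mul_smul,
        Matrix.one_mul, Matrix.mul_one]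
    rw [hH, ← Matrix.mul_assoc, hjG, Matrix.neg_mul, Matrix.neg_mul, Matrix.mul_assoc _ T', h1,
      Matrix.mul_assoc, ← Matrix.mul_assoc j, hjj]
    simp
  obtain ⟨p, q, hpq, M, Y, hYM, hMY, hM, hMj⟩ := exists_congr_toReal_diagI hjj hHt hHu hjHj
  set w : ℂ := ⟨c, s⟩ with hw
  set N : Matrix (Fin p ⊕ Fin q) (Fin p ⊕ Fin q) ℂ := w • diagI ℂ p q with hN
  have hEE := diagI_mul_self ℂ p q
  have hEh := diagI_conjTranspose ℂ p q
  have hw0 : star w * w = 1 := by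
    refine Complex.ext ?_ ?_
    · simp [hw]; linarith
    · simp [hw]; ring
  have hw1 : w ≠ 0 := by rintro h0; rw [h0, mul_zero] at hw0; exact zero_ne_one hw0
  have hNN : Nᴴ * N = 1 := by
    rw [hN, Matrix.conjTranspose_smul, hEh, Matrix.smul_mul, Matrix.mul_smul, hEE, smul_smul,
      hw0, one_smul]
  have hwr : toReal (w • (1 : Matrix (Fin p ⊕ Fin q) (Fin p ⊕ Fin q) ℂ))
      = c • 1 + s • Matrix.J _ ℝ := by
    rw [← toReal_I_smul, ← toReal_smul, ← toReal_one, ← toReal_smul, ← toReal_add, smul_smul,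
      ← add_smul]
    congr 2
    refine Complex.ext ?_ ?_ <;> simp [hw]
  have hw2r : toReal ((w * w) • (1 : Matrix (Fin p ⊕ Fin q) (Fin p ⊕ Fin q) ℂ))
      = C • 1 + σ • Matrix.J _ ℝ := by
    rw [← toReal_I_smul, ← toReal_smul, ← toReal_one, ← toReal_smul, ← toReal_add, smul_smul,
      ← add_smul]
    congr 2
    refine Complex.ext ?_ ?_
    · simp [hw, hcosθ, -Complex.ofReal_pow]; ring
    · simp [hw, hsinθ]; ring
  have hGM : G = M * toReal N * Mᵀ := by
    have h1 : Mᵀ * T = (c • (1 : Matrix _ ((Fin p ⊕ Fin q) ⊕ (Fin p ⊕ Fin q)) ℝ)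
        + s • Matrix.J (Fin p ⊕ Fin q) ℝ) * Mᵀ := by
      rw [hT]
      simp only [Matrix.mul_add, Matrix.add_mul, Matrix.smul_mul, Matrix.mul_smul,
        Matrix.one_mul, Matrix.mul_one, hMj]
    calc G = M * toReal (diagI ℂ p q) * (Mᵀ * T) := by rw [← hHT, hM, Matrix.mul_assoc]
      _ = M * (toReal (diagI ℂ p q) *
          toReal (w • (1 : Matrix (Fin p ⊕ Fin q) (Fin p ⊕ Fin q) ℂ))) * Mᵀ := by
          rw [h1, ← hwr]; simp only [Matrix.mul_assoc]
      _ = _ := by rw [← toReal_mul, Matrix.mul_smul, Matrix.mul_one, ← hN]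
  have horth : (toReal N)ᵀ * toReal N = 1 := by
    rw [← toReal_conjTranspose, ← toReal_mul, hNN, toReal_one]
  have hmem : ∀ B : Matrix (Fin p ⊕ Fin q) (Fin p ⊕ Fin q) ℂ,
      toReal B * toReal N * toReal B = toReal N ↔ B * diagI ℂ p q * B = diagI ℂ p q := by
    intro B
    rw [← toReal_mul, ← toReal_mul, toReal_injective.eq_iff, hN, Matrix.mul_smul,
      Matrix.smul_mul]
    exact (smul_right_injective _ hw1).eq_iff
  obtain ⟨e₁, he₁⟩ := exists_isometry_locus_congr hYM hMY hdet
    (abs_det_eq_one_of_orthogonal horth) hGM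
  obtain ⟨e₂, he₂⟩ := exists_isometry_coset_locus (indefiniteSU ℂ p q) (blockSU p q) 8
    (toRealHom (Fin p ⊕ Fin q)) toReal_injective
    (fun B => by
      change 4 * (toReal B).trace = 8 * B.trace.re
      rw [trace_toReal]; ring) (toReal N)
    (fun g hg => mem_blockSU_iff hg)
    (fun g hg => by
      change toReal (g.1 * g.1ᴴ) ∈ locus (toReal N)
      rw [mem_locus_orthogonal_iff horth, hmem]
      constructor
      · let g' : GL ((Fin p ⊕ Fin q) ⊕ (Fin p ⊕ Fin q)) ℝ :=
          ⟨toReal g.1, toReal (g⁻¹).1, by rw [← toReal_mul, g.mul_inv, toReal_one],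
            by rw [← toReal_mul, g.inv_mul, toReal_one]⟩
        have := posDef_mul_conjTranspose g'
        rwa [Matrix.conjTranspose_eq_transpose_of_trivial, ← toReal_conjTranspose,
          ← toReal_mul] at this
      · have h2 := mul_mul_conjTranspose_comm hEE hg.1
        calc g.1 * g.1ᴴ * diagI ℂ p q * (g.1 * g.1ᴴ)
            = g.1 * (g.1ᴴ * diagI ℂ p q * g.1) * g.1ᴴ := by simp only [Matrix.mul_assoc]
          _ = diagI ℂ p q := by rw [h2, hg.1])
    -- From `A D A = D` it follows that `A` commutes with `D² = cos θ + sin θ J`. Since `sin θ ≠ 0`,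
    -- it commutes with `J` and is a complex matrix.
    (fun A hA => by
      obtain ⟨hA1, hA2⟩ := (mem_locus_orthogonal_iff horth).1 hA
      set D := toReal N
      have hD2 : D * D = C • 1 + σ • Matrix.J _ ℝ := by
        rw [← toReal_mul, hN, Matrix.smul_mul, Matrix.mul_smul, hEE, smul_smul, hw2r]
      have hcomm : A * (D * D) = D * D * A := by
        calc A * (D * D) = A * D * (A * D * A) := by rw [hA2, Matrix.mul_assoc]
          _ = (A * D * A) * D * A := by simp only [Matrix.mul_assoc]
          _ = D * D * A := by rw [hA2]
      have hJ : A * Matrix.J _ ℝ = Matrix.J _ ℝ * A := by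
        rw [hD2] at hcomm
        simp only [Matrix.mul_add, Matrix.add_mul, Matrix.smul_mul, Matrix.mul_smul,
          Matrix.one_mul, Matrix.mul_one] at hcomm
        exact smul_right_injective _ hσ0 (add_left_cancel hcomm)
      obtain ⟨B, rfl⟩ := exists_toReal_of_commute hJ
      exact ⟨B, posDef_of_posDef_toReal hA1, rfl⟩)
    (fun B g _ hB hg hgB => by
      have h1 := (hmem B).1 ((mem_locus_orthogonal_iff horth).1 hB).2
      have h2 := PosDef.mul_mul_eq_of_sq hg (N := diagI ℂ p q) (by rw [hEh, hEE])
        (by rw [hgB]; exact h1)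
      refine ⟨?_, det_eq_one_of_posDef hg h2⟩
      rw [hg.isHermitian.eq, h2])
  exact ⟨p, q, hpq, e₂.trans e₁, he₂.trans he₁⟩

end

end SymmetricSpaces

/-! ### The polynomials `Ψ_{k,l}` -/

section Psi

open Polynomial

/-- The angle `2 l π / k`. -/
def angle (kl : ℕ × ℕ) : ℝ := 2 * kl.2 * Real.pi / kl.1

lemma angle_pos (kl : pairs) : 0 < angle kl := by
  have h1 : (0 : ℝ) < kl.1.1 := by exact_mod_cast kl.2.1
  have h2 : (0 : ℝ) < kl.1.2 := by exact_mod_cast kl.2.2.1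
  have := Real.pi_pos
  unfold angle
  positivity

lemma angle_lt_pi {kl : pairs} (h : 3 ≤ kl.1.1) : angle kl < Real.pi := by
  have h1 : (0 : ℝ) < kl.1.1 := by exact_mod_cast kl.2.1
  have h2 : (2 : ℝ) * kl.1.2 < kl.1.1 := by
    have := kl.2.2.2.2
    rw [max_eq_right h] at this
    exact_mod_cast this
  have := Real.pi_pos
  unfold angle
  rw [div_lt_iff₀ h1]
  nlinarith

lemma Psi_pairSym : Psi pairSym = X - 1 := by simp [Psi, pairSym]

lemma Psi_pairAlt : Psi pairAlt = X + 1 := by simp [Psi, pairAlt]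

lemma Psi_of_three_le {kl : ℕ × ℕ} (h : 3 ≤ kl.1) :
    Psi kl = X ^ 2 - C (2 * Real.cos (angle kl)) * X + 1 := by
  rw [Psi, if_neg (by omega), if_neg (by omega), angle]

lemma pairs_cases (kl : pairs) : kl = pairSym ∨ kl = pairAlt ∨ 3 ≤ kl.1.1 := by
  obtain ⟨⟨k, l⟩, hk, hl, hc, hlt⟩ := kl
  simp only at hk hl hc hlt
  rcases Nat.lt_or_ge k 3 with h3 | h3
  · rw [max_eq_left h3.le] at hlt
    obtain rfl : l = 1 := by omega
    rcases (by omega : k = 1 ∨ k = 2) with rfl | rfl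
    · exact Or.inl rfl
    · exact Or.inr (Or.inl rfl)
  · exact Or.inr (Or.inr h3)

lemma Psi_monic (kl : pairs) : (Psi kl).Monic := by
  rcases pairs_cases kl with rfl | rfl | h
  · rw [Psi_pairSym]; exact monic_X_sub_C 1
  · rw [Psi_pairAlt]; exact monic_X_add_C 1
  · rw [Psi_of_three_le h]; monicity!

lemma natDegree_Psi_of_three_le {kl : ℕ × ℕ} (h : 3 ≤ kl.1) : (Psi kl).natDegree = 2 := by
  rw [Psi_of_three_le h]; compute_degree!

lemma natDegree_Psi_pairSym : (Psi pairSym).natDegree = 1 := by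
  rw [Psi_pairSym]; exact natDegree_X_sub_C 1

lemma natDegree_Psi_pairAlt : (Psi pairAlt).natDegree = 1 := by
  rw [Psi_pairAlt]; exact natDegree_X_add_C 1

lemma Psi_irreducible (kl : pairs) : Irreducible (Psi kl) := by
  rcases pairs_cases kl with rfl | rfl | h
  · rw [Psi_pairSym]; exact irreducible_X_sub_C 1
  · rw [Psi_pairAlt]
    have := irreducible_X_sub_C (-1 : ℝ)
    rwa [C_neg, sub_neg_eq_add] at this
  · have hd := natDegree_Psi_of_three_le h
    rw [(Psi_monic kl).irreducible_iff_roots_eq_zero_of_degree_le_three (by omega) (by omega),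
      Multiset.eq_zero_iff_forall_notMem]
    intro x hx
    have hx := (mem_roots'.1 hx).2
    rw [Psi_of_three_le h, IsRoot] at hx
    simp only [eval_add, eval_sub, eval_mul, eval_pow, eval_X, eval_C, eval_one] at hx
    have h1 := Real.sin_pos_of_pos_of_lt_pi (angle_pos kl) (angle_lt_pi h)
    have h2 := Real.sin_sq_add_cos_sq (angle kl)
    nlinarith [sq_nonneg (x - Real.cos (angle kl))]

lemma Psi_injective : Function.Injective fun kl : pairs => Psi kl := by
  have key : ∀ a b : pairs, 3 ≤ a.1.1 → Psi a = Psi b → a = b := by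
    intro a b ha h
    have hb : 3 ≤ b.1.1 := by
      have h2 := congrArg natDegree h
      rw [natDegree_Psi_of_three_le ha] at h2
      rcases pairs_cases b with rfl | rfl | hb
      · rw [natDegree_Psi_pairSym] at h2; omega
      · rw [natDegree_Psi_pairAlt] at h2; omega
      · exact hb
    rw [Psi_of_three_le ha, Psi_of_three_le hb] at h
    have h3 := congrArg (eval 1) h
    simp only [eval_add, eval_sub, eval_mul, eval_pow, eval_X, eval_C, eval_one] at h3
    -- The value at `1` determines the cosine, and the cosine determines the angle on `[0, π]`. The
    -- fraction `l / k` is in lowest terms, so it determines the pair.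
    have h4 : angle a = angle b := Real.injOn_cos ⟨(angle_pos a).le, (angle_lt_pi ha).le⟩
      ⟨(angle_pos b).le, (angle_lt_pi hb).le⟩ (by linarith)
    have hk := a.2.1
    have hk' := b.2.1
    have h5 : a.1.2 * b.1.1 = b.1.2 * a.1.1 := by
      have h6 : (a.1.1 : ℝ) ≠ 0 := by exact_mod_cast hk.ne'
      have h7 : (b.1.1 : ℝ) ≠ 0 := by exact_mod_cast hk'.ne'
      rw [angle, angle, div_eq_div_iff h6 h7] at h4
      have h8 : (a.1.2 : ℝ) * b.1.1 = b.1.2 * a.1.1 := by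
        apply mul_left_cancel₀ (mul_ne_zero two_ne_zero Real.pi_ne_zero)
        linear_combination h4
      exact_mod_cast h8
    have h6 : a.1.1 = b.1.1 := Nat.dvd_antisymm
      (a.2.2.2.1.dvd_of_dvd_mul_left (h5 ▸ dvd_mul_left a.1.1 b.1.2))
      (b.2.2.2.1.dvd_of_dvd_mul_left (h5 ▸ dvd_mul_left b.1.1 a.1.2))
    rw [h6] at h5
    exact Subtype.ext (Prod.ext h6 (Nat.eq_of_mul_eq_mul_right hk' h5))
  intro a b h
  simp only at h
  rcases pairs_cases a with ha | ha | ha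
  · rcases pairs_cases b with hb | hb | hb
    · rw [ha, hb]
    · rw [ha, hb, Psi_pairSym, Psi_pairAlt] at h
      have := congrArg (eval 1) h
      norm_num at this
    · exact (key b a hb h.symm).symm
  · rcases pairs_cases b with hb | hb | hb
    · rw [ha, hb, Psi_pairSym, Psi_pairAlt] at h
      have := congrArg (eval 1) h
      norm_num at this
    · rw [ha, hb]
    · exact (key b a hb h.symm).symm
  · exact key a b ha h

lemma isCoprime_Psi {a b : pairs} (h : a ≠ b) : IsCoprime (Psi a) (Psi b) := by
  rw [(Psi_irreducible a).coprime_iff_not_dvd]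
  intro h1
  exact h (Psi_injective (eq_of_monic_of_associated (Psi_monic a) (Psi_monic b)
    ((Psi_irreducible a).associated_of_dvd (Psi_irreducible b) h1)))

/-- Allowing any `w` with the right cosine covers both conjugate roots, of angles `2lπ/k` and `2π -
2lπ/k`. -/
lemma aeval_exp_Psi {kl : ℕ × ℕ} (h : 3 ≤ kl.1) {w : ℂ}
    (hw : Complex.cos w = Complex.cos (angle kl)) :
    aeval (Complex.exp (w * Complex.I)) (Psi kl) = 0 := by
  rw [Psi_of_three_le h]
  simp only [map_add, map_sub, map_mul, map_pow, aeval_X, aeval_C, map_one,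
    Complex.coe_algebraMap]
  push_cast
  rw [← hw]
  rw [Complex.exp_mul_I]
  linear_combination -Complex.sin_sq_add_cos_sq w + (Complex.sin w) ^ 2 * Complex.I_sq

/-- Every complex root of unity is a root of some `Ψ_{k,l}`. -/
lemma exists_Psi_root {z : ℂ} {N : ℕ} (hN : 0 < N) (hz : z ^ N = 1) :
    ∃ kl : pairs, aeval z (Psi kl) = 0 := by
  set k := orderOf z with hk
  have hk0 : 0 < k := (isOfFinOrder_iff_pow_eq_one.2 ⟨N, hN, hz⟩).orderOf_pos
  have hprim : IsPrimitiveRoot z k := IsPrimitiveRoot.orderOf z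
  clear_value k
  by_cases h1 : k = 1
  · subst h1
    exact ⟨pairSym, by rw [Psi_pairSym]; simpa [sub_eq_zero] using hprim.pow_eq_one⟩
  by_cases h2 : k = 2
  · subst h2
    exact ⟨pairAlt, by rw [Psi_pairAlt, hprim.eq_neg_one_of_two_right]; simp⟩
  obtain ⟨i, hik, hc, rfl⟩ := (Complex.isPrimitiveRoot_iff z k hk0.ne').1 hprim
  have hi0 : 0 < i := by
    rcases Nat.eq_zero_or_pos i with rfl | h
    · exact absurd ((Nat.coprime_zero_left k).1 hc) h1
    · exact h
  have hne : 2 * i ≠ k := by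
    rintro rfl
    have h3 : i = 1 := hc.eq_one_of_dvd (dvd_mul_left i 2)
    omega
  have hkC : (k : ℂ) ≠ 0 := by exact_mod_cast hk0.ne'
  have h3 : 2 * Real.pi * Complex.I * ((i : ℂ) / k) = (2 * i * Real.pi / k) * Complex.I := by ring
  rw [h3]
  -- Either `i < k/2`, or the conjugate root, of index `k - i`, is below `k/2`. The polynomial is
  -- the same for both.
  rcases lt_or_gt_of_ne hne with h | h
  · refine ⟨⟨(k, i), hk0, hi0, hc.symm, lt_max_of_lt_right h⟩, aeval_exp_Psi (by simp; omega) ?_⟩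
    simp [angle]
  · refine ⟨⟨(k, k - i), hk0, Nat.sub_pos_of_lt hik, ?_, lt_max_of_lt_right (by simp; omega)⟩,
      aeval_exp_Psi (by simp; omega) ?_⟩
    · exact (Nat.coprime_self_sub_right hik.le).2 hc.symm
    · have h4 : ((angle (k, k - i) : ℝ) : ℂ) = 2 * Real.pi - 2 * i * Real.pi / k := by
        simp only [angle]
        push_cast [Nat.cast_sub hik.le]
        field_simp
      rw [h4, Complex.cos_two_pi_sub]

end Psi

/-! ### Characteristic polynomials of annihilated matrices -/

section Charpoly

open Polynomial

variable {ι : Type*} [Fintype ι] [DecidableEq ι]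

/-- A complex root of `q` is an eigenvalue `z` of `T`, and `r z` is then an eigenvalue of `r(T) =
0`. -/
lemma exists_common_root {T : Matrix ι ι ℝ} {q r : ℝ[X]} (hq : Irreducible q)
    (hqT : q ∣ T.charpoly) (hr : aeval T r = 0) : ∃ z : ℂ, aeval z q = 0 ∧ aeval z r = 0 := by
  obtain ⟨z, hz⟩ := IsAlgClosed.exists_aeval_eq_zero ℂ q (degree_pos_of_irreducible hq).ne'
  refine ⟨z, hz, ?_⟩
  have h1 : (T.map (algebraMap ℝ ℂ)).charpoly.IsRoot z := by
    rw [IsRoot, Matrix.charpoly_map, eval_map_algebraMap]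
    obtain ⟨e, he⟩ := hqT
    rw [he, map_mul, hz, zero_mul]
  have h2 := spectrum.subset_polynomial_aeval (T.map (algebraMap ℝ ℂ)) (r.map (algebraMap ℝ ℂ))
    ⟨z, Matrix.mem_spectrum_iff_isRoot_charpoly.2 h1, rfl⟩
  have h3 : aeval (T.map (algebraMap ℝ ℂ)) (r.map (algebraMap ℝ ℂ)) = 0 := by
    have := Polynomial.aeval_algHom_apply (Algebra.ofId ℝ ℂ).mapMatrix T r
    rw [hr, map_zero] at this
    rw [aeval_map_algebraMap]
    exact this
  -- In size `0` the spectrum of the zero matrix would be empty; but then the characteristic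
  -- polynomial is `1` and has no irreducible factor.
  have : Nonempty ι := by
    by_contra h
    rw [not_nonempty_iff] at h
    rw [Matrix.charpoly_isEmpty] at hqT
    exact hq.not_isUnit (isUnit_of_dvd_one hqT)
  rw [h3, spectrum.zero_eq] at h2
  simpa using h2

lemma eq_pow_of_irreducible_dvd {p q : ℝ[X]} (hp : p.Monic) (hq : q.Monic) (hqi : Irreducible q)
    (h : ∀ r, Irreducible r → r ∣ p → Associated r q) : ∃ n, p = q ^ n := by
  obtain ⟨e, hpe, he⟩ := (FiniteMultiplicity.of_not_isUnit hqi.not_isUnit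
    hp.ne_zero).exists_eq_pow_mul_and_not_dvd
  generalize multiplicity q p = n at hpe
  refine ⟨n, eq_of_monic_of_associated hp (hq.pow n) ?_⟩
  have hu : IsUnit e := by
    by_contra hu
    have he0 : e ≠ 0 := by rintro rfl; exact hp.ne_zero (by simpa using hpe)
    obtain ⟨r, hr, hre⟩ := WfDvdMonoid.exists_irreducible_factor hu he0
    exact he ((h r hr (hpe ▸ hre.mul_left _)).symm.dvd.trans hre)
  rw [hpe]
  exact associated_mul_unit_left _ _ hu

lemma associated_of_common_root {q r : ℝ[X]} (hq : Irreducible q) (hr : Irreducible r) {z : ℂ}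
    (h : aeval z q = 0) (h' : aeval z r = 0) : Associated q r := by
  by_contra hn
  obtain ⟨a, b, hab⟩ := hq.coprime_iff_not_dvd.2 fun hd => hn (hq.associated_of_dvd hr hd)
  have := congrArg (aeval z) hab
  simp [h, h'] at this

lemma charpoly_eq_pow_Psi {T : Matrix ι ι ℝ} {kl : pairs} (h : aeval T (Psi kl) = 0) :
    ∃ n, T.charpoly = Psi kl ^ n := by
  refine eq_pow_of_irreducible_dvd (Matrix.charpoly_monic T) (Psi_monic kl) (Psi_irreducible kl)
    fun r hr hrT => ?_
  obtain ⟨z, hz, hz'⟩ := exists_common_root hr hrT h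
  exact associated_of_common_root hr (Psi_irreducible kl) hz hz'

lemma exists_associated_Psi {T : Matrix ι ι ℝ} {N : ℕ} (hN : 0 < N) (hT : T ^ N = 1) {q : ℝ[X]}
    (hq : Irreducible q) (hqT : q ∣ T.charpoly) : ∃ kl : pairs, Associated q (Psi kl) := by
  obtain ⟨z, hz, hz'⟩ := exists_common_root (r := X ^ N - 1) hq hqT (by simp [hT])
  obtain ⟨kl, hkl⟩ := exists_Psi_root hN (z := z) (by simpa [sub_eq_zero] using hz')
  exact ⟨kl, associated_of_common_root hq (Psi_irreducible kl) hz hkl⟩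

lemma dvd_of_squarefree {p r : ℝ[X]} (hp : Squarefree p)
    (h : ∀ q, Irreducible q → q ∣ p → q ∣ r) : p ∣ r := by
  induction p using WfDvdMonoid.induction_on_irreducible with
  | zero => exact absurd hp not_squarefree_zero
  | unit u hu => exact hu.dvd
  | mul a i ha hi IH =>
    refine IsCoprime.mul_dvd (hi.coprime_iff_not_dvd.2 fun hd => hi.not_isUnit
      (hp i (mul_dvd_mul_left i hd))) (h i hi (dvd_mul_right i a))
      (IH (hp.squarefree_of_dvd (dvd_mul_left a i)) fun q hq hqa => h q hq (hqa.mul_left i))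

/-- A matrix of finite order is annihilated by the product of the factors of its characteristic
polynomial. -/
lemma aeval_prod_Psi_eq_zero {T : Matrix ι ι ℝ} {N : ℕ} (hN : 0 < N) (hT : T ^ N = 1)
    {s : Finset pairs} (hs : ∀ kl : pairs, Psi kl ∣ T.charpoly → kl ∈ s) :
    aeval T (∏ kl ∈ s, Psi kl) = 0 := by
  -- The minimal polynomial divides the separable `X^N - 1`, so it is squarefree. It therefore
  -- suffices that each of its irreducible factors is one of the listed `Ψ_{k,l}`.
  have h0 : minpoly ℝ T ∣ X ^ N - 1 := minpoly.dvd ℝ T (by simp [hT])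
  have hsq : Squarefree (minpoly ℝ T) := by
    have h1 : (X ^ N - C (1 : ℝ)).Separable :=
      separable_X_pow_sub_C 1 (by exact_mod_cast hN.ne') one_ne_zero
    exact h1.squarefree.squarefree_of_dvd h0
  refine aeval_eq_zero_of_dvd_aeval_eq_zero ?_ (minpoly.aeval ℝ T)
  refine dvd_of_squarefree hsq fun q hq hqm => ?_
  obtain ⟨kl, hkl⟩ := exists_associated_Psi hN hT hq (hqm.trans (Matrix.minpoly_dvd_charpoly T))
  exact hkl.dvd.trans (Finset.dvd_prod_of_mem _
    (hs kl (hkl.symm.dvd.trans (hqm.trans (Matrix.minpoly_dvd_charpoly T)))))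

end Charpoly

/-! ### The cosquare of a bilinear form and its primary decomposition -/

section Cosquare

open Polynomial

variable {ι : Type*} [Fintype ι] [DecidableEq ι]

/-- The cosquare `F^∨ F` of a matrix `F`. -/
def cosquare (F : Matrix ι ι ℝ) : Matrix ι ι ℝ := dual F * F

lemma transpose_mul_cosquare {F : Matrix ι ι ℝ} (hF : IsUnit F.det) : Fᵀ * cosquare F = F := by
  rw [cosquare, ← Matrix.mul_assoc, transpose_mul_dual hF, Matrix.one_mul]

/-- The equation `F' C = F` characterises the cosquare; this identifies the restriction of `S` to a
component. -/
lemma eq_cosquare {F C : Matrix ι ι ℝ} (hF : IsUnit F.det) (h : Fᵀ * C = F) : C = cosquare F := by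
  rw [cosquare]
  nth_rewrite 2 [← h]
  rw [← Matrix.mul_assoc, dual_mul_transpose hF, Matrix.one_mul]

lemma dual_mul_dual {F : Matrix ι ι ℝ} (hF : IsUnit F.det) :
    dual (F * dual F) = cosquare F := by
  have h : (dual F)ᵀ * F = 1 := by
    have := congrArg Matrix.transpose (transpose_mul_dual hF)
    simpa using this
  rw [dual, Matrix.transpose_mul, Matrix.mul_inv_rev, Matrix.inv_eq_right_inv h]
  rfl

lemma cosquare_pow_eq_one_iff {F : Matrix ι ι ℝ} (hF : IsUnit F.det) (N : ℕ) :
    cosquare F ^ N = 1 ↔ (F * dual F) ^ N = 1 := by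
  have h := mul_pow_mul F (dual F) N
  rw [show dual F * F = cosquare F from rfl] at h
  have hu : IsUnit F := (Matrix.isUnit_iff_isUnit_det F).2 hF
  constructor
  · intro h1
    rw [h1, mul_one] at h
    exact hu.mul_right_cancel (h.trans (one_mul F).symm)
  · intro h1
    rw [h1, one_mul] at h
    exact hu.mul_left_cancel (h.symm.trans (mul_one F).symm)

lemma isRealType_iff {F : Matrix ι ι ℝ} :
    IsRealType F ↔ |F.det| = 1 ∧ ∃ N, 0 < N ∧ cosquare F ^ N = 1 := by
  refine and_congr_right fun h => ?_
  rw [isOfFinOrder_iff_pow_eq_one]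
  exact exists_congr fun N =>
    and_congr_right fun _ => (cosquare_pow_eq_one_iff (isUnit_det_of_abs_eq_one h) N).symm

lemma charpoly_cosquare (F : Matrix ι ι ℝ) : (F * dual F).charpoly = (cosquare F).charpoly :=
  Matrix.charpoly_mul_comm F (dual F)

lemma mem_eigenW_iff {F : Matrix ι ι ℝ} (hF : IsUnit F.det) {kl : pairs} {x : ι → ℝ} :
    x ∈ eigenW F kl ↔ aeval (cosquare F) (Psi kl) *ᵥ x = 0 := by
  rw [eigenW, LinearMap.mem_ker, dual_mul_dual hF, Matrix.toLin'_apply]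

/-- The forms `B` that are invariant under the cosquare of `F`. -/
def IsCosquareInvariant (F B : Matrix ι ι ℝ) : Prop := (cosquare F)ᵀ * B * cosquare F = B

lemma isCosquareInvariant_self {F : Matrix ι ι ℝ} (hF : IsUnit F.det) :
    IsCosquareInvariant F F := by
  have h : (dual F)ᵀ * F = 1 := by
    have := congrArg Matrix.transpose (transpose_mul_dual hF)
    simpa using this
  rw [IsCosquareInvariant, cosquare, Matrix.transpose_mul, Matrix.mul_assoc Fᵀ, h, Matrix.mul_one]
  exact transpose_mul_cosquare hF

/-- Put `T = F^∨ A`. The defining equation gives `S = T²`, and together with its transpose it gives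
`T' A T = A`. So `S` is an isometry of `A`. -/
lemma isCosquareInvariant_of_mem_locus {F A : Matrix ι ι ℝ} (hF : |F.det| = 1)
    (hA : A ∈ locus F) : IsCosquareInvariant F A := by
  obtain ⟨hpos, heq⟩ := (mem_locus_iff hF).1 hA
  have hsym : Aᵀ = A := by simpa using hpos.isHermitian.eq
  have heq' : A * (dual F)ᵀ * A = Fᵀ := by
    have := congrArg Matrix.transpose heq
    simpa [Matrix.transpose_mul, hsym, Matrix.mul_assoc] using this
  have hu : IsUnit A := (Matrix.isUnit_iff_isUnit_det A).2 (isUnit_iff_ne_zero.2 hpos.det_pos.ne')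
  have h1 : (dual F)ᵀ * A * (dual F * A) = 1 := by
    have h2 : A * ((dual F)ᵀ * A * (dual F * A)) = A * 1 := by
      calc A * ((dual F)ᵀ * A * (dual F * A)) = (A * (dual F)ᵀ * A) * dual F * A := by
            simp only [Matrix.mul_assoc]
        _ = A * 1 := by
            rw [heq', transpose_mul_dual (isUnit_det_of_abs_eq_one hF), Matrix.one_mul,
              Matrix.mul_one]
    exact hu.mul_left_cancel h2
  rw [IsCosquareInvariant, cosquare, Matrix.transpose_mul, ← heq']
  nth_rewrite 4 [← heq]
  calc A * (dual F)ᵀ * A * (dual F)ᵀ * A * (dual F * (A * dual F * A))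
      = A * (dual F)ᵀ * A * ((dual F)ᵀ * A * (dual F * A)) * (dual F * A) := by
        simp only [Matrix.mul_assoc]
    _ = A * ((dual F)ᵀ * A * (dual F * A)) := by
        rw [h1, Matrix.mul_one, ← h1]; simp only [Matrix.mul_assoc]
    _ = A := by rw [h1, Matrix.mul_one]

/-- For an invariant form the adjoint of `S` is `S⁻¹`, and `Ψ_{k,l}` is its own reciprocal
polynomial up to sign. Hence `U` is `± S` to the power the degree of `Ψ_{k,l}`, with a minus sign
only for `x - 1`. -/
lemma exists_transpose_aeval_Psi {F B : Matrix ι ι ℝ} (hB : IsCosquareInvariant F B) (kl : pairs) :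
    ∃ U, (aeval (cosquare F) (Psi kl))ᵀ * B * U = B * aeval (cosquare F) (Psi kl) := by
  unfold IsCosquareInvariant at hB
  generalize cosquare F = S at hB ⊢
  rcases pairs_cases kl with rfl | rfl | h
  · refine ⟨-S, ?_⟩
    rw [Psi_pairSym]
    simp only [map_sub, aeval_X, map_one, Matrix.transpose_sub, Matrix.transpose_one]
    rw [Matrix.mul_neg, Matrix.sub_mul, Matrix.sub_mul, hB, Matrix.one_mul, Matrix.mul_sub,
      Matrix.mul_one, neg_sub]
  · refine ⟨S, ?_⟩
    rw [Psi_pairAlt]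
    simp only [map_add, aeval_X, map_one, Matrix.transpose_add, Matrix.transpose_one]
    rw [Matrix.add_mul, Matrix.add_mul, hB, Matrix.one_mul, Matrix.mul_add, Matrix.mul_one,
      add_comm]
  · refine ⟨S ^ 2, ?_⟩
    rw [Psi_of_three_le h]
    have h2 : Sᵀ * B * S ^ 2 = B * S := by rw [sq, ← Matrix.mul_assoc, hB]
    have h3 : (S ^ 2)ᵀ * B * S ^ 2 = B := by
      rw [Matrix.transpose_pow, sq, Matrix.mul_assoc, Matrix.mul_assoc, ← Matrix.mul_assoc Sᵀ B,
        h2, ← Matrix.mul_assoc, hB]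
    simp only [map_add, map_sub, map_mul, map_pow, aeval_X, aeval_C, map_one,
      Algebra.algebraMap_eq_smul_one, smul_mul_assoc, one_mul, Matrix.transpose_add,
      Matrix.transpose_sub, Matrix.transpose_smul, Matrix.transpose_one, Matrix.add_mul,
      Matrix.sub_mul, Matrix.mul_add, Matrix.mul_sub, Matrix.mul_smul,
      Matrix.mul_one, h2, h3]
    abel

/-- By Bézout, `Ψ_a(S)` is invertible on `W_b`, so `y` can be written `Ψ_a(S) z`. Moving `Ψ_a(S)`
across the form by `exists_transpose_aeval_Psi` makes it act on `x`, which it kills. -/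
lemma dotProduct_eq_zero_of_ne {F B : Matrix ι ι ℝ} (hF : IsUnit F.det)
    (hB : IsCosquareInvariant F B) {a b : pairs} (hab : a ≠ b) {x y : ι → ℝ} (hx : x ∈ eigenW F a)
    (hy : y ∈ eigenW F b) : x ⬝ᵥ B *ᵥ y = 0 := by
  rw [mem_eigenW_iff hF] at hx hy
  obtain ⟨U, hU⟩ := exists_transpose_aeval_Psi hB a
  obtain ⟨u, v, huv⟩ := isCoprime_Psi hab
  have h1 := congrArg (fun p => aeval (cosquare F) p *ᵥ y) huv
  simp only [map_add, map_mul, map_one, Matrix.one_mulVec, Matrix.add_mulVec] at h1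
  rw [← Matrix.mulVec_mulVec y _ (aeval (cosquare F) (Psi b)), hy, Matrix.mulVec_zero, add_zero,
    ((Commute.all u (Psi a)).map (aeval (cosquare F))).eq, ← Matrix.mulVec_mulVec] at h1
  rw [← h1, Matrix.mulVec_mulVec, ← hU, Matrix.mul_assoc, ← Matrix.mulVec_mulVec,
    Matrix.dotProduct_mulVec, Matrix.vecMul_transpose, hx, zero_dotProduct]

lemma Psi_dvd_charpoly_iff {F : Matrix ι ι ℝ} {kl : pairs} :
    Psi kl ∣ (cosquare F).charpoly ↔ 0 < mult F kl := by
  rw [mult, charpoly_cosquare]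
  refine ⟨fun h => ?_, fun h => dvd_of_multiplicity_pos h⟩
  rw [Nat.pos_iff_ne_zero, Ne, multiplicity_eq_zero]
  exact not_not.2 h

lemma eigenW_eq_bot {F : Matrix ι ι ℝ} (hF : IsUnit F.det) {kl : pairs} (h : mult F kl = 0) :
    eigenW F kl = ⊥ := by
  have h1 : ¬ Psi kl ∣ (cosquare F).charpoly := by rw [Psi_dvd_charpoly_iff]; omega
  obtain ⟨u, v, huv⟩ := (Psi_irreducible kl).coprime_iff_not_dvd.2 h1
  rw [Submodule.eq_bot_iff]
  intro x hx
  rw [mem_eigenW_iff hF] at hx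
  have h2 := congrArg (fun p => aeval (cosquare F) p *ᵥ x) huv
  simp only [map_add, map_mul, map_one, Matrix.one_mulVec, Matrix.aeval_self_charpoly, mul_zero,
    add_zero] at h2
  rw [← h2, ← Matrix.mulVec_mulVec, hx, Matrix.mulVec_zero]

/-- The product of the occurring `Ψ_{k,l}` annihilates `S`, and a Bézout relation between its
cofactors splits the identity into maps with values in the `W_{k,l}`. -/
lemma exists_sum_eigenW {F : Matrix ι ι ℝ} (hF : IsRealType F) (x : ι → ℝ) :
    ∃ w : Factors F → ι → ℝ, (∀ kl, w kl ∈ eigenW F kl.1) ∧ ∑ kl, w kl = x := by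
  obtain ⟨hdet, N, hN, hS⟩ := isRealType_iff.1 hF
  have hu := isUnit_det_of_abs_eq_one hdet
  have h0 : aeval (cosquare F) (∏ kl : Factors F, Psi kl.1) = 0 := by
    have := aeval_prod_Psi_eq_zero hN hS (s := Finset.univ.map ⟨fun kl : Factors F => kl.1,
      Subtype.val_injective⟩) fun kl hkl => Finset.mem_map.2
        ⟨⟨kl, Psi_dvd_charpoly_iff.1 hkl⟩, Finset.mem_univ _, rfl⟩
    rwa [Finset.prod_map] at this
  -- With no factor the empty product `1` annihilates `S`, so the whole space is zero.
  rcases isEmpty_or_nonempty (Factors F) with he | he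
  · refine ⟨fun _ => 0, fun _ => zero_mem _, ?_⟩
    rw [Finset.univ_eq_empty, Finset.prod_empty, map_one] at h0
    rw [← Matrix.one_mulVec x, h0]
    simp
  · obtain ⟨c, hc⟩ := exists_sum_eq_one_iff_pairwise_coprime'.2
      (show Pairwise (Function.onFun IsCoprime fun kl : Factors F => Psi kl.1) from fun a b hab =>
        isCoprime_Psi fun h => hab (Subtype.ext h))
    refine ⟨fun kl => aeval (cosquare F) (c kl * ∏ j ∈ {kl}ᶜ, Psi j.1) *ᵥ x, fun kl => ?_, ?_⟩
    · rw [mem_eigenW_iff hu, Matrix.mulVec_mulVec, ← map_mul]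
      have : Psi kl.1 * (c kl * ∏ j ∈ {kl}ᶜ, Psi j.1) = c kl * ∏ j : Factors F, Psi j.1 := by
        rw [Fintype.prod_eq_mul_prod_compl kl fun j : Factors F => Psi j.1]; ring
      rw [this, map_mul, h0, mul_zero, Matrix.zero_mulVec]
    · rw [← Matrix.sum_mulVec, ← map_sum, hc, map_one, Matrix.one_mulVec]

lemma eq_zero_of_dotProduct_eigenW {F : Matrix ι ι ℝ} (hF : IsRealType F) {y : ι → ℝ}
    (h : ∀ (kl : pairs), ∀ x ∈ eigenW F kl, x ⬝ᵥ y = 0) : y = 0 := by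
  rw [← dotProduct_self_eq_zero]
  obtain ⟨w, hw, hy⟩ := exists_sum_eigenW hF y
  nth_rewrite 1 [← hy]
  rw [sum_dotProduct]
  exact Finset.sum_eq_zero fun kl _ => h kl.1 _ (hw kl)

end Cosquare

/-! ### Canonical components -/

section Canonical

open Polynomial

section Basis

variable {ι : Type*}

/-- The matrix whose columns are the vectors of a basis of a subspace. -/
def columnMatrix {d : ℕ} {W : Submodule ℝ (ι → ℝ)} (b : Module.Basis (Fin d) ℝ W) :
    Matrix ι (Fin d) ℝ :=
  Matrix.of fun i j => (b j : ι → ℝ) i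

variable {d : ℕ} {W : Submodule ℝ (ι → ℝ)} (b : Module.Basis (Fin d) ℝ W)

lemma columnMatrix_mulVec (c : Fin d → ℝ) :
    columnMatrix b *ᵥ c = ((∑ j, c j • b j : W) : ι → ℝ) := by
  ext i
  simp [columnMatrix, Matrix.mulVec, dotProduct, mul_comm]

lemma columnMatrix_mulVec_mem (c : Fin d → ℝ) : columnMatrix b *ᵥ c ∈ W := by
  rw [columnMatrix_mulVec]; exact Submodule.coe_mem _

lemma exists_columnMatrix_mulVec {x : ι → ℝ} (hx : x ∈ W) : ∃ c, columnMatrix b *ᵥ c = x :=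
  ⟨b.equivFun ⟨x, hx⟩, by rw [columnMatrix_mulVec, b.sum_equivFun]⟩

lemma columnMatrix_mulVec_injective {c : Fin d → ℝ} (h : columnMatrix b *ᵥ c = 0) : c = 0 := by
  rw [columnMatrix_mulVec, ZeroMemClass.coe_eq_zero] at h
  exact funext (Fintype.linearIndependent_iff.1 b.linearIndependent c h)

lemma transpose_columnMatrix_mul [Fintype ι] (B : Matrix ι ι ℝ) (i j : Fin d) :
    ((columnMatrix b)ᵀ * B * columnMatrix b) i j = (b i : ι → ℝ) ⬝ᵥ B *ᵥ (b j : ι → ℝ) := by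
  rw [Matrix.mul_assoc]
  rfl

end Basis

variable {ι : Type*} [Fintype ι] [DecidableEq ι]

/-- A vector of `W_{k,l}` orthogonal to `W_{k,l}` for `F` is also orthogonal to all other
components, hence to everything; but `F` is nondegenerate. -/
lemma det_transpose_columnMatrix_ne_zero {F : Matrix ι ι ℝ} (hF : IsRealType F) {kl : pairs}
    {d : ℕ} (b : Module.Basis (Fin d) ℝ (eigenW F kl)) :
    ((columnMatrix b)ᵀ * F * columnMatrix b).det ≠ 0 := by
  have hu := isUnit_det_of_abs_eq_one hF.1
  intro h
  obtain ⟨c, hc, hc0⟩ := Matrix.exists_mulVec_eq_zero_iff.2 h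
  refine hc (columnMatrix_mulVec_injective b ?_)
  set y := columnMatrix b *ᵥ c with hy
  have hyW : y ∈ eigenW F kl := columnMatrix_mulVec_mem b c
  have h1 : F *ᵥ y = 0 := by
    refine eq_zero_of_dotProduct_eigenW hF fun k x hx => ?_
    by_cases hk : k = kl
    · subst hk
      obtain ⟨a, rfl⟩ := exists_columnMatrix_mulVec b hx
      rw [← Matrix.vecMul_transpose, ← Matrix.dotProduct_mulVec, hy, Matrix.mulVec_mulVec,
        Matrix.mulVec_mulVec, hc0, dotProduct_zero]
    · exact dotProduct_eq_zero_of_ne hu (isCosquareInvariant_self hu) hk hx hyW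
  have h2 := congrArg (fun v => F⁻¹ *ᵥ v) h1
  simpa [Matrix.mulVec_mulVec, Matrix.nonsing_inv_mul F hu] using h2

theorem exists_isCanonicalFamily {F : Matrix ι ι ℝ} (hF : IsRealType F) :
    ∃ (d : pairs → ℕ) (G : ∀ kl : pairs, Matrix (Fin (d kl)) (Fin (d kl)) ℝ),
      IsCanonicalFamily F G := by
  have key : ∀ kl : pairs, ∃ b : Module.Basis (Fin (Module.finrank ℝ (eigenW F kl))) ℝ
      (eigenW F kl), |((columnMatrix b)ᵀ * F * columnMatrix b).det| = 1 := by
    intro kl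
    set d := Module.finrank ℝ (eigenW F kl)
    let b := Module.finBasis ℝ (eigenW F kl)
    rcases Nat.eq_zero_or_pos d with hd | hd
    · have : IsEmpty (Fin d) := by rw [hd]; infer_instance
      exact ⟨b, by rw [Matrix.det_isEmpty, abs_one]⟩
    have hdet := abs_pos.2 (det_transpose_columnMatrix_ne_zero hF b)
    set δ := |((columnMatrix b)ᵀ * F * columnMatrix b).det| with hδ
    -- Scaling the basis by `c` multiplies the determinant by `c ^ (2 * d)`, whence this choice when
    -- `d > 0`.
    set c : ℝ := δ⁻¹ ^ (((2 * d : ℕ) : ℝ)⁻¹) with hc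
    have hc0 : 0 < c := Real.rpow_pos_of_pos (inv_pos.2 hdet) _
    have hcd : c ^ (2 * d) = δ⁻¹ :=
      Real.rpow_inv_natCast_pow (inv_pos.2 hdet).le (by omega)
    let b' := b.unitsSMul fun _ => Units.mk0 c hc0.ne'
    have hQ : columnMatrix b' = c • columnMatrix b := by
      ext i j
      simp [columnMatrix, b', Module.Basis.unitsSMul_apply, Units.smul_def]
    refine ⟨b', ?_⟩
    rw [hQ, Matrix.transpose_smul, Matrix.smul_mul, Matrix.smul_mul, Matrix.mul_smul, smul_smul,
      Matrix.det_smul, Fintype.card_fin, ← sq, ← pow_mul, abs_mul, hcd, abs_of_pos (inv_pos.2 hdet),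
      ← hδ, inv_mul_cancel₀ hdet.ne']
  choose b hb using key
  exact ⟨_, fun kl => (columnMatrix (b kl))ᵀ * F * columnMatrix (b kl), fun kl =>
    ⟨hb kl, b kl, transpose_columnMatrix_mul (b kl) F⟩⟩

lemma aeval_mul_of_mul_eq {κ : Type*} [Fintype κ] [DecidableEq κ] {S : Matrix ι ι ℝ}
    {M : Matrix κ κ ℝ} {Q : Matrix ι κ ℝ} (h : S * Q = Q * M) (p : ℝ[X]) :
    aeval S p * Q = Q * aeval M p := by
  induction p using Polynomial.induction_on' with
  | add p q hp hq => rw [map_add, map_add, Matrix.add_mul, Matrix.mul_add, hp, hq]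
  | monomial n a =>
    have hn : S ^ n * Q = Q * M ^ n := by
      induction n with
      | zero => simp
      | succ n ih => rw [pow_succ, Matrix.mul_assoc, h, ← Matrix.mul_assoc, ih, Matrix.mul_assoc,
          pow_succ]
    rw [aeval_monomial, aeval_monomial, Algebra.algebraMap_eq_smul_one,
      Algebra.algebraMap_eq_smul_one, smul_mul_assoc, one_mul, smul_mul_assoc, one_mul,
      Matrix.smul_mul, Matrix.mul_smul, hn]

/-! ### The cosquare of a single component -/

section Component

variable {F : Matrix ι ι ℝ} {kl : pairs} {d : ℕ} {G : Matrix (Fin d) (Fin d) ℝ}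
  {b : Module.Basis (Fin d) ℝ (eigenW F kl)}

/-- The subspace is stable under `S`. The matrix `C` of the restriction satisfies `G' C = G`, as
seen by restricting `F' S = F`, and so is the cosquare of `G`. -/
lemma cosquare_mul_columnMatrix (hF : IsRealType F) (hdet : |G.det| = 1)
    (hG : (columnMatrix b)ᵀ * F * columnMatrix b = G) :
    cosquare F * columnMatrix b = columnMatrix b * cosquare G := by
  have hu := isUnit_det_of_abs_eq_one hF.1
  have hmem : ∀ x ∈ eigenW F kl, cosquare F *ᵥ x ∈ eigenW F kl := by
    intro x hx
    rw [mem_eigenW_iff hu] at hx ⊢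
    have h := ((Commute.all (Psi kl) X).map (aeval (cosquare F))).eq
    rw [aeval_X] at h
    rw [Matrix.mulVec_mulVec, h, ← Matrix.mulVec_mulVec, hx, Matrix.mulVec_zero]
  have hcol : ∀ j, ∃ c, columnMatrix b *ᵥ c = cosquare F *ᵥ (b j : ι → ℝ) := fun j =>
    exists_columnMatrix_mulVec b (hmem _ (Submodule.coe_mem _))
  choose c hc using hcol
  have h1 : cosquare F * columnMatrix b = columnMatrix b * (Matrix.of c)ᵀ := by
    ext i j
    exact (congrFun (hc j) i).symm
  have h2 : Gᵀ * (Matrix.of c)ᵀ = G := by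
    calc Gᵀ * (Matrix.of c)ᵀ
        = (columnMatrix b)ᵀ * (Fᵀ * (columnMatrix b * (Matrix.of c)ᵀ)) := by
          rw [← hG]; simp [Matrix.transpose_mul, Matrix.mul_assoc]
      _ = G := by
          rw [← h1, ← Matrix.mul_assoc Fᵀ, transpose_mul_cosquare hu, ← Matrix.mul_assoc, hG]
  rw [h1, eq_cosquare (isUnit_det_of_abs_eq_one hdet) h2]

lemma columnMatrix_mul_injective (hdet : |G.det| = 1)
    (hG : (columnMatrix b)ᵀ * F * columnMatrix b = G) {κ : Type*} {A B : Matrix (Fin d) κ ℝ}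
    (h : columnMatrix b * A = columnMatrix b * B) : A = B := by
  have h1 := congrArg (fun C => G⁻¹ * ((columnMatrix b)ᵀ * F * C)) h
  simp only [← Matrix.mul_assoc] at h1
  rw [Matrix.mul_assoc G⁻¹, Matrix.mul_assoc G⁻¹, hG,
    Matrix.nonsing_inv_mul _ (isUnit_det_of_abs_eq_one hdet), Matrix.one_mul, Matrix.one_mul] at h1
  exact h1

lemma aeval_cosquare_component (hF : IsRealType F) (hdet : |G.det| = 1)
    (hG : (columnMatrix b)ᵀ * F * columnMatrix b = G) : aeval (cosquare G) (Psi kl) = 0 := by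
  refine columnMatrix_mul_injective hdet hG ?_
  rw [← aeval_mul_of_mul_eq (cosquare_mul_columnMatrix hF hdet hG), Matrix.mul_zero]
  ext i j
  have := (mem_eigenW_iff (isUnit_det_of_abs_eq_one hF.1)).1 (Submodule.coe_mem (b j))
  exact congrFun this i

lemma isRealType_component (hF : IsRealType F) (hdet : |G.det| = 1)
    (hG : (columnMatrix b)ᵀ * F * columnMatrix b = G) : IsRealType G := by
  obtain ⟨-, N, hN, hS⟩ := isRealType_iff.1 hF
  refine isRealType_iff.2 ⟨hdet, N, hN, columnMatrix_mul_injective hdet hG ?_⟩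
  have h := aeval_mul_of_mul_eq (cosquare_mul_columnMatrix hF hdet hG) (X ^ N)
  simp only [map_pow, aeval_X] at h
  rw [← h, hS, Matrix.one_mul, Matrix.mul_one]

end Component

/-! ### Assembling the components in an adapted basis -/

section Family

variable {F : Matrix ι ι ℝ} {d : pairs → ℕ}
  (b : ∀ kl : pairs, Module.Basis (Fin (d kl)) ℝ (eigenW F kl))

/-- The matrix whose columns are the vectors of the bases of the subspaces `W_{k,l}`. -/
def adaptedMatrix : Matrix ι (Σ kl : Factors F, Fin (d kl.1)) ℝ :=
  Matrix.of fun i kj => columnMatrix (b kj.1.1) i kj.2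

lemma adaptedMatrix_mulVec (c : (Σ kl : Factors F, Fin (d kl.1)) → ℝ) :
    adaptedMatrix b *ᵥ c = ∑ kl : Factors F, columnMatrix (b kl.1) *ᵥ fun j => c ⟨kl, j⟩ := by
  ext i
  simp [adaptedMatrix, Matrix.mulVec, dotProduct, Fintype.sum_sigma, Finset.sum_apply]

lemma transpose_adaptedMatrix_mul (hF : IsUnit F.det) {B : Matrix ι ι ℝ}
    (hB : IsCosquareInvariant F B) :
    (adaptedMatrix b)ᵀ * B * adaptedMatrix b = Matrix.blockDiagonal' fun kl : Factors F =>
      (columnMatrix (b kl.1))ᵀ * B * columnMatrix (b kl.1) := by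
  ext ⟨k, i⟩ ⟨l, j⟩
  have h : ((adaptedMatrix b)ᵀ * B * adaptedMatrix b) ⟨k, i⟩ ⟨l, j⟩
      = (b k.1 i : ι → ℝ) ⬝ᵥ B *ᵥ (b l.1 j : ι → ℝ) := by
    rw [Matrix.mul_assoc]
    rfl
  rw [h]
  by_cases hkl : k = l
  · subst hkl
    rw [Matrix.blockDiagonal'_apply_eq, transpose_columnMatrix_mul]
  · rw [Matrix.blockDiagonal'_apply_ne _ _ _ hkl]
    exact dotProduct_eq_zero_of_ne hF hB (fun h => hkl (Subtype.ext h)) (Submodule.coe_mem _)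
      (Submodule.coe_mem _)

lemma adaptedMatrix_mul_blockDiagonal' {M : ∀ kl : pairs, Matrix (Fin (d kl)) (Fin (d kl)) ℝ}
    {S : Matrix ι ι ℝ} (h : ∀ kl, S * columnMatrix (b kl) = columnMatrix (b kl) * M kl) :
    S * adaptedMatrix b =
      adaptedMatrix b * Matrix.blockDiagonal' fun kl : Factors F => M kl.1 := by
  ext i ⟨k, j⟩
  have h1 : (S * adaptedMatrix b) i ⟨k, j⟩ = (S * columnMatrix (b k.1)) i j := rfl
  rw [h1, h, Matrix.mul_apply, Matrix.mul_apply, Fintype.sum_sigma, Finset.sum_eq_single k]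
  · simp [adaptedMatrix]
  · intro l _ hl
    simp [Matrix.blockDiagonal'_apply_ne _ _ _ hl]
  · simp

/-- The columns span because the `W_{k,l}` do, which gives a right inverse. They are independent
because `Q' F Q` is an invertible block diagonal matrix, so `(Q' F Q)⁻¹ Q' F` is a left inverse. -/
lemma exists_adaptedMatrix_inverse (hF : IsRealType F)
    {G : ∀ kl : pairs, Matrix (Fin (d kl)) (Fin (d kl)) ℝ} (hdet : ∀ kl, |(G kl).det| = 1)
    (hG : ∀ kl, (columnMatrix (b kl))ᵀ * F * columnMatrix (b kl) = G kl) :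
    ∃ Y : Matrix (Σ kl : Factors F, Fin (d kl.1)) ι ℝ,
      adaptedMatrix b * Y = 1 ∧ Y * adaptedMatrix b = 1 := by
  have hu := isUnit_det_of_abs_eq_one hF.1
  have hsurj : Function.Surjective (adaptedMatrix b).mulVec := by
    intro x
    obtain ⟨w, hw, hx⟩ := exists_sum_eigenW hF x
    choose c hc using fun kl : Factors F => exists_columnMatrix_mulVec (b kl.1) (hw kl)
    refine ⟨fun kj => c kj.1 kj.2, ?_⟩
    rw [adaptedMatrix_mulVec, ← hx]
    exact Finset.sum_congr rfl fun kl _ => hc kl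
  obtain ⟨Y, hY⟩ := Matrix.mulVec_surjective_iff_exists_right_inverse.1 hsurj
  refine ⟨Y, hY, ?_⟩
  have h1 := transpose_adaptedMatrix_mul b hu (isCosquareInvariant_self hu)
  simp only [hG] at h1
  set D := Matrix.blockDiagonal' fun kl : Factors F => G kl.1
  have hD : IsUnit D.det := by
    rw [det_blockDiagonal']
    exact isUnit_iff_ne_zero.2 (Finset.prod_ne_zero_iff.2 fun kl _ =>
      (isUnit_det_of_abs_eq_one (hdet kl.1)).ne_zero)
  have h2 : D⁻¹ * (adaptedMatrix b)ᵀ * F * adaptedMatrix b = 1 := by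
    rw [Matrix.mul_assoc, Matrix.mul_assoc, ← Matrix.mul_assoc _ F, h1, Matrix.nonsing_inv_mul _ hD]
  calc Y * adaptedMatrix b
      = D⁻¹ * (adaptedMatrix b)ᵀ * F * adaptedMatrix b * Y * adaptedMatrix b := by
        rw [h2, Matrix.one_mul]
    _ = D⁻¹ * (adaptedMatrix b)ᵀ * F * (adaptedMatrix b * Y) * adaptedMatrix b := by
        simp only [Matrix.mul_assoc]
    _ = 1 := by rw [hY, Matrix.mul_one, h2]

variable {b} {G : ∀ kl : pairs, Matrix (Fin (d kl)) (Fin (d kl)) ℝ}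

lemma charpoly_cosquare_eq_prod (hF : IsRealType F) (hdet : ∀ kl, |(G kl).det| = 1)
    (hG : ∀ kl, (columnMatrix (b kl))ᵀ * F * columnMatrix (b kl) = G kl) :
    (cosquare F).charpoly = ∏ kl : Factors F, (cosquare (G kl.1)).charpoly := by
  obtain ⟨Y, hQY, hYQ⟩ := exists_adaptedMatrix_inverse b hF hdet hG
  have h := adaptedMatrix_mul_blockDiagonal' b fun kl =>
    cosquare_mul_columnMatrix hF (hdet kl) (hG kl)
  have hcard := Matrix.square_of_invertible _ _ hQY hYQ
  rw [← charpoly_blockDiagonal']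
  set M := Matrix.blockDiagonal' fun kl : Factors F => cosquare (G kl.1)
  have h1 : cosquare F = adaptedMatrix b * (M * Y) := by
    rw [← Matrix.mul_assoc, ← h, Matrix.mul_assoc, hQY, Matrix.mul_one]
  -- Exchanging the factors `Q` and `M Y` turns the cosquare into `M`. The power of `X` that
  -- accounts for a difference of sizes is `X^0`, both sizes being equal.
  rw [h1, Matrix.charpoly_mul_comm_of_le _ _ hcard.ge, Matrix.mul_assoc, hYQ, Matrix.mul_one,
    hcard, Nat.sub_self, pow_zero, one_mul]

/-- Each component contributes a power of its own `Ψ_{k,l}` to the characteristic polynomial of `S`.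
These are pairwise coprime, so the exponent is the multiplicity in the whole; when it is `0` the
component has size `0`. -/
lemma charpoly_component (hF : IsRealType F) (hdet : ∀ kl, |(G kl).det| = 1)
    (hG : ∀ kl, (columnMatrix (b kl))ᵀ * F * columnMatrix (b kl) = G kl) (kl : pairs) :
    (cosquare (G kl)).charpoly = Psi kl ^ mult F kl := by
  rcases Nat.eq_zero_or_pos (mult F kl) with h0 | h0
  · have hbot := eigenW_eq_bot (isUnit_det_of_abs_eq_one hF.1) h0
    have : IsEmpty (Fin (d kl)) := ⟨fun i => (b kl).ne_zero i (Subtype.ext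
      ((Submodule.eq_bot_iff _).1 hbot _ (Submodule.coe_mem _)))⟩
    rw [Matrix.charpoly_isEmpty, h0, pow_zero]
  choose n hn using fun kl => charpoly_eq_pow_Psi (aeval_cosquare_component hF (hdet kl) (hG kl))
  rw [hn kl]
  congr 1
  have h1 := charpoly_cosquare_eq_prod hF hdet hG
  simp only [hn] at h1
  let k : Factors F := ⟨kl, h0⟩
  rw [Fintype.prod_eq_mul_prod_compl k fun j : Factors F => Psi j.1 ^ n j.1] at h1
  rw [mult, charpoly_cosquare, h1]
  refine (multiplicity_eq_of_dvd_of_not_dvd (dvd_mul_right _ _) ?_).symm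
  rw [pow_succ, mul_dvd_mul_iff_left (pow_ne_zero _ (Psi_irreducible kl).ne_zero),
    ← (Psi_irreducible kl).coprime_iff_not_dvd]
  refine IsCoprime.prod_right fun j hj => (isCoprime_Psi fun h => ?_).pow_right
  rw [Finset.mem_compl, Finset.mem_singleton] at hj
  exact hj (Subtype.ext h.symm)

lemma card_component (hF : IsRealType F) (hdet : ∀ kl, |(G kl).det| = 1)
    (hG : ∀ kl, (columnMatrix (b kl))ᵀ * F * columnMatrix (b kl) = G kl) (kl : pairs) :
    Fintype.card (Fin (d kl)) = mult F kl * (Psi kl).natDegree := by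
  rw [← Matrix.charpoly_natDegree_eq_dim (cosquare (G kl)), charpoly_component hF hdet hG,
    natDegree_pow]

/-- The matrix `P` is the inverse transpose of the adapted basis matrix. It makes every
cosquare-invariant form block diagonal, in particular `F` and all points of `V_F`. -/
lemma exists_isometry_canonicalFamily (hF : IsRealType F) (hdet : ∀ kl, |(G kl).det| = 1)
    (hG : ∀ kl, (columnMatrix (b kl))ᵀ * F * columnMatrix (b kl) = G kl) :
    ∃ (P : Matrix ι (Σ kl : Factors F, Fin (d kl.1)) ℝ)
      (e : locus F ≃ ∀ kl : Factors F, locus (G kl.1)),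
      F = P * directSum F (fun kl => G kl.1) * Pᵀ ∧
      (∀ A : locus F, (A : Matrix ι ι ℝ) = P * directSum F
        (fun kl => (e A kl : Matrix (Fin (d kl.1)) (Fin (d kl.1)) ℝ)) * Pᵀ) ∧
      IsRiemannianIsometry e := by
  obtain ⟨Y, hQY, hYQ⟩ := exists_adaptedMatrix_inverse b hF hdet hG
  have hu := isUnit_det_of_abs_eq_one hF.1
  have h1 : (adaptedMatrix b)ᵀ * Yᵀ = 1 := by
    rw [← Matrix.transpose_mul, hYQ, Matrix.transpose_one]
  have h2 : Yᵀ * (adaptedMatrix b)ᵀ = 1 := by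
    rw [← Matrix.transpose_mul, hQY, Matrix.transpose_one]
  have key : ∀ B, IsCosquareInvariant F B → B = Yᵀ * Matrix.blockDiagonal' (fun kl : Factors F =>
      (columnMatrix (b kl.1))ᵀ * B * columnMatrix (b kl.1)) * Yᵀᵀ := by
    intro B hB
    rw [← transpose_adaptedMatrix_mul b hu hB, Matrix.transpose_transpose]
    calc B = (Yᵀ * (adaptedMatrix b)ᵀ) * B * (adaptedMatrix b * Y) := by
          rw [hQY, h2, Matrix.one_mul, Matrix.mul_one]
      _ = _ := by simp only [Matrix.mul_assoc]
  have hFP := key F (isCosquareInvariant_self hu)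
  simp only [hG] at hFP
  obtain ⟨e, he, hiso⟩ := exists_isometry_locus_blocks h1 h2 hF.1 (fun kl => hdet kl.1) hFP
    fun A hA => ⟨_, key A (isCosquareInvariant_of_mem_locus hF.1 hA)⟩
  exact ⟨Yᵀ, e, hFP, he, hiso⟩

end Family

/-! ### From the annihilating polynomial to the type of the form -/

section Identification

variable {G : Matrix ι ι ℝ}

lemma transpose_eq_self_of_aeval (hG : IsUnit G.det)
    (h : aeval (cosquare G) (Psi pairSym) = 0) : Gᵀ = G := by
  rw [Psi_pairSym, map_sub, aeval_X, map_one, sub_eq_zero] at h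
  have := transpose_mul_cosquare hG
  rwa [h, Matrix.mul_one] at this

lemma transpose_eq_neg_of_aeval (hG : IsUnit G.det)
    (h : aeval (cosquare G) (Psi pairAlt) = 0) : Gᵀ = -G := by
  rw [Psi_pairAlt, map_add, aeval_X, map_one, add_eq_zero_iff_eq_neg] at h
  have := transpose_mul_cosquare hG
  rw [h, Matrix.mul_neg, Matrix.mul_one] at this
  rw [← neg_eq_iff_eq_neg]
  exact this

lemma cosquare_equation_of_aeval {kl : ℕ × ℕ} (hkl : 3 ≤ kl.1)
    (h : aeval (cosquare G) (Psi kl) = 0) :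
    (dual G * G) ^ 2 - (2 * Real.cos (angle kl)) • (dual G * G) + 1 = 0 := by
  rw [Psi_of_three_le hkl, ← smul_eq_C_mul] at h
  simp only [map_add, map_sub, map_smul, map_pow, aeval_X, map_one] at h
  exact h

end Identification

end Canonical

end

end Isodual

theorem mainTheorem2 {n : ℕ} (F : Matrix (Fin n) (Fin n) ℝ) (hF : Isodual.IsRealType F) :
    (∃ (d : Isodual.pairs → ℕ) (G : ∀ kl : Isodual.pairs, Matrix (Fin (d kl)) (Fin (d kl)) ℝ),
      Isodual.IsCanonicalFamily F G) ∧
    ∀ (d : Isodual.pairs → ℕ) (G : ∀ kl : Isodual.pairs, Matrix (Fin (d kl)) (Fin (d kl)) ℝ),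
      Isodual.IsCanonicalFamily F G →
      (∀ kl : Isodual.pairs, Isodual.IsRealType (G kl) ∧
        (G kl * Isodual.dual (G kl)).charpoly = Isodual.Psi kl ^ Isodual.mult F kl) ∧
      (∃ (P : Matrix (Fin n) (Σ kl : Isodual.Factors F, Fin (d kl.1)) ℝ)
        (e : Isodual.locus F ≃ ∀ kl : Isodual.Factors F, Isodual.locus (G kl.1)),
        F = P * Isodual.directSum F (fun kl => G kl.1) * Pᵀ ∧
        (∀ A : Isodual.locus F, (A : Matrix (Fin n) (Fin n) ℝ) =
          P * Isodual.directSum F (fun kl => (e A kl : Matrix (Fin (d kl.1)) (Fin (d kl.1)) ℝ))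
            * Pᵀ) ∧
        Isodual.IsRiemannianIsometry e) ∧
      (∃ p q : ℕ, p + q = Isodual.mult F Isodual.pairSym ∧
        ∃ e : Isodual.Coset 4 (Isodual.identitySO p q) (Isodual.blockSO p q) ≃
            Isodual.locus (G Isodual.pairSym),
          Isodual.IsRiemannianIsometry e) ∧
      (∃ g : ℕ, 2 * g = Isodual.mult F Isodual.pairAlt ∧
        ∃ e : Isodual.Coset 4 (Isodual.Sp g) (Isodual.realU g) ≃
            Isodual.locus (G Isodual.pairAlt),
          Isodual.IsRiemannianIsometry e) ∧
      (∀ kl : Isodual.pairs, 3 ≤ kl.1.1 →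
        ∃ p q : ℕ, p + q = Isodual.mult F kl ∧
          ∃ e : Isodual.Coset 8 (Isodual.indefiniteSU ℂ p q) (Isodual.blockSU p q) ≃
              Isodual.locus (G kl),
            Isodual.IsRiemannianIsometry e) := by
  refine ⟨Isodual.exists_isCanonicalFamily hF, fun d G hG => ?_⟩
  have hdet := fun kl => (hG kl).1
  choose b hb using fun kl => (hG kl).2
  have hb' : ∀ kl, (Isodual.columnMatrix (b kl))ᵀ * F * Isodual.columnMatrix (b kl) = G kl :=
    fun kl => Matrix.ext fun i j =>
      (Isodual.transpose_columnMatrix_mul (b kl) F i j).trans (hb kl i j).symm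
  have hann := fun kl => Isodual.aeval_cosquare_component hF (hdet kl) (hb' kl)
  have hu := fun kl => Isodual.isUnit_det_of_abs_eq_one (hdet kl)
  have hcard := Isodual.card_component hF hdet hb'
  refine ⟨fun kl => ⟨Isodual.isRealType_component hF (hdet kl) (hb' kl), ?_⟩,
    Isodual.exists_isometry_canonicalFamily hF hdet hb', ?_, ?_, fun kl hkl => ?_⟩
  · rw [Isodual.charpoly_cosquare, Isodual.charpoly_component hF hdet hb']
  · obtain ⟨p, q, hpq, e⟩ := Isodual.exists_isometry_of_symmetric (hdet _)
      (Isodual.transpose_eq_self_of_aeval (hu _) (hann Isodual.pairSym))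
    rw [hcard, Isodual.natDegree_Psi_pairSym, mul_one] at hpq
    exact ⟨p, q, hpq, e⟩
  · obtain ⟨g, hg, e⟩ := Isodual.exists_isometry_of_alternating (hdet _)
      (Isodual.transpose_eq_neg_of_aeval (hu _) (hann Isodual.pairAlt))
    rw [hcard, Isodual.natDegree_Psi_pairAlt, mul_one] at hg
    exact ⟨g, hg, e⟩
  · obtain ⟨p, q, hpq, e⟩ := Isodual.exists_isometry_of_rotation (hdet kl) (Isodual.angle_pos kl)
      (Isodual.angle_lt_pi hkl) (Isodual.cosquare_equation_of_aeval hkl (hann kl))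
    rw [hcard, Isodual.natDegree_Psi_of_three_le hkl] at hpq
    exact ⟨p, q, by omega, e⟩
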